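/- Let $k$ be a commutative ring with unit, $A$ a commutative $k$-algebra with an augmentation, i.e. a $k$-algebra map $\varepsilon\colon A\to k$, and let $I=\ker\varepsilon$. Let $M$ be a symmetric $A$-bimodule (that is, an $A$-module regarded as a bimodule with $am=ma$) that is flat over $k$. Definitions. Let $\Omega$ be the category of the sets $\underline{x}=\{1,\dots,x\}$, $x\ge 1$, and surjections, and let $N\Omega_n(\underline x,\underline 1)$ be the set of strings $[f_n\mid\dots\mid f_1]$ of composable morphisms $\underline x\xrightarrow{f_1}\underline{x_1}\to\dots\to\underline{x_{n-1}}\xrightarrow{f_n}\underline 1$ of $\Omega$. The Robinson–Whitehouse complex $C\Gamma_\star(A,M)$ is the chain complex of the simplicial $k$-module $$C\Gamma_n(A,M)=\bigoplus_{x\ge1}k[N\Omega_n(\underline x,\underline 1)]\otimes A^{\otimes x}\otimes M$$ whose degeneracies insert identities and whose faces are $$\partial_0\big([f_n\mid\dots\mid f_1]\otimes(a_1\otimes\dots\otimes a_x)\otimes m\big)=[f_n\mid\dots\mid f_2]\otimes\Big(\bigotimes_{j}\prod_{f_1(i)=j}a_i\Big)\otimes m,$$ $\partial_i$ composes $f_{i+1}$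 and $f_i$ for $0<i<n$, and $$\partial_n\big([f_n\mid\dots\mid f_1]\otimes(a_1\otimes\dots\otimes a_x)\otimes m\big)=\sum_{c\in\underline{x_{n-1}}}[f^c_{n-1}\mid\dots\mid f^c_1]\otimes\Big(\bigotimes_{i\in S_c}a_i\Big)\otimes\Big(\prod_{i\notin S_c}a_i\Big)m,$$ where $S_c\subseteq\underline x$ is the preimage of $c$ under $f_{n-1}\circ\dots\circ f_1$ and $[f^c_{n-1}\mid\dots\mid f^c_1]$ is the restriction of the string to the preimages of $c$, re-indexed in order. The complex $C\Gamma_\star(I,M)$ is given by $\bigoplus_{x\ge1}k[N\Omega_n(\underline x,\underline 1)]\otimes I^{\otimes x}\otimes M$ with the same formulas, and $i\colon C\Gamma_\star(I,M)\to C\Gamma_\star(A,M)$ is the inclusion. Let $\Gamma$ be the category of the sets $[n]=\{0,1,\dots,n\}$, $n\ge0$, and maps preserving the basepoint $0$. Let $\mathcal L(A,M)$ be the functor from $\Gamma$ to $k$-modules with $\mathcal L(A,M)([n])=A^{\otimes n}\otimes M$, where $f\colon[p]\to[q]$ acts by $$a_1\otimes\dots\otimes a_p\otimes m\mapsto\Big(\bigotimes_{j=1}^{q}\prod_{f(i)=j}a_i\Big)\otimes\Big(\prod_{f(i)=0}a_i\Big)m,$$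 and let $t=\mathrm{Hom}_{\mathrm{Set}_*}(-,k)\colon\Gamma^{op}\to k\text{-Mod}$, with $k$ based at $0$. Let $H\Gamma_n(A,M)=\mathrm{Tor}^\Gamma_n(t,\mathcal L(A,M))$, where $\mathrm{Tor}^\Gamma_\star$ denotes the left derived functors of the tensor product over $\Gamma$ of a contravariant and a covariant functor to $k$-modules. The pruning map $P_n\colon C\Gamma_n(A,M)\to C\Gamma_n(I,M)$ is the $k$-linear map determined as follows. Let $a_1\otimes\dots\otimes a_x$ be a basic tensor, i.e. for some $L\subseteq\underline x$ we have $a_i\in I$ for $i\in L$ and $a_i=1$ for $i\notin L$. If $L=\{l_1<\dots<l_h\}\neq\emptyset$, then $$P_n\big([f_n\mid\dots\mid f_1]\otimes(a_1\otimes\dots\otimes a_x)\otimes m\big)=[\widetilde{f_n}\mid\dots\mid\widetilde{f_1}]\otimes(a_{l_1}\otimes\dots\otimes a_{l_h})\otimes m,$$ where $\widetilde{f_j}$ is $f_j$ restricted to the image of $L$ in its domain and to the image of $L$ in its codomain, both re-indexed in order; if $L=\emptyset$ the generator is sent to $0$. Theorem. The maps $P_n$ form a chain map $P\colon C\Gamma_\star(A,M)\to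 C\Gamma_\star(I,M)$, and $P\circ i$ is the identity of $C\Gamma_\star(I,M)$. There is an isomorphism of chain complexes $$C\Gamma_\star(A,M)\cong C\Gamma_\star(I,M)\oplus\ker P,$$ and for every $n\ge0$ there is an isomorphism of $k$-modules $$H\Gamma_n(A,M)\cong H_n(C\Gamma_\star(I,M))\oplus H_n(\ker P).$$ -/

import Mathlib

open CategoryTheory CategoryTheory.Limits Opposite
open scoped TensorProduct DirectSum

universe u

noncomputable section

namespace GammaHomology

/-! ### Functor homology -/

section FunctorHomology

/-- The category of left `C`-modules has enough projectives. -/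
theorem enoughProjectives_functor (k : Type u) [CommRing k] (C : Type) [SmallCategory C] :
    EnoughProjectives (C ⥤ ModuleCat.{u} k) where
  presentation F := by
    let P : C → (C ⥤ ModuleCat.{u} k) := fun c =>
      (evaluationLeftAdjoint (ModuleCat.{u} k) c).obj (Projective.over (F.obj c))
    let φ : ∀ c, P c ⟶ F := fun c =>
      ((evaluationAdjunctionRight (ModuleCat.{u} k) c).homEquiv _ _).symm (Projective.π (F.obj c))
    have hP : ∀ c, Projective (P c) := fun c =>
      (evaluationAdjunctionRight (ModuleCat.{u} k) c).map_projective _ inferInstance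
    have hsum : Projective (∐ P) :=
      ⟨fun f e _ => ⟨Sigma.desc fun c => Projective.factorThru (Sigma.ι P c ≫ f) e,
        Sigma.hom_ext _ _ fun c => by simp⟩⟩
    have hepi : Epi (Sigma.desc φ) := by
      rw [NatTrans.epi_iff_epi_app]
      intro c
      have h1 : (evaluationAdjunctionRight (ModuleCat.{u} k) c).homEquiv _ _ (φ c)
          = Projective.π (F.obj c) := Equiv.apply_symm_apply _ _
      rw [Adjunction.homEquiv_unit] at h1
      have h2 : (Sigma.ι P c).app c ≫ (Sigma.desc φ).app c = (φ c).app c := by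
        rw [← NatTrans.comp_app, Sigma.ι_desc]
      have h3 : Epi ((φ c).app c) := by
        have : Epi ((evaluationAdjunctionRight (ModuleCat.{u} k) c).unit.app
            (Projective.over (F.obj c)) ≫ (φ c).app c) := by
          change Epi ((evaluationAdjunctionRight (ModuleCat.{u} k) c).unit.app
            (Projective.over (F.obj c)) ≫ ((evaluation _ _).obj c).map (φ c))
          rw [h1]; exact Projective.π_epi _
        exact epi_of_epi ((evaluationAdjunctionRight (ModuleCat.{u} k) c).unit.app
          (Projective.over (F.obj c))) _
      rw [← h2] at h3
      exact epi_of_epi ((Sigma.ι P c).app c) _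
    exact ⟨{ p := ∐ P, projective := hsum, f := Sigma.desc φ, epi := hepi }⟩

instance (k : Type u) [CommRing k] (C : Type) [SmallCategory C] :
    EnoughProjectives (C ⥤ ModuleCat.{u} k) :=
  enoughProjectives_functor k C

variable {k : Type u} [CommRing k] {C : Type} [SmallCategory C]

/-- The submodule of `⨁ c, G c ⊗ F c` generated by the elements
`G(α)(x) ⊗ y - x ⊗ F(α)(y)`. -/
def tensorRel (G : Cᵒᵖ ⥤ ModuleCat.{u} k) (F : C ⥤ ModuleCat.{u} k) [DecidableEq C] :
    Submodule k (⨁ c : C, (G.obj (op c) ⊗[k] F.obj c : Type u)) :=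
  Submodule.span k
    {z | ∃ (c d : C) (α : c ⟶ d) (x : G.obj (op d)) (y : F.obj c),
      z = DirectSum.lof k C (fun c => (G.obj (op c) ⊗[k] F.obj c : Type u)) c
            (G.map α.op x ⊗ₜ[k] y)
        - DirectSum.lof k C (fun c => (G.obj (op c) ⊗[k] F.obj c : Type u)) d
            (x ⊗ₜ[k] F.map α y)}

/-- The map `⨁ c, G c ⊗ F c → ⨁ c, G c ⊗ F' c` induced by a natural transformation `F ⟶ F'`. -/
def tensorMapAux (G : Cᵒᵖ ⥤ ModuleCat.{u} k) {F F' : C ⥤ ModuleCat.{u} k} (ψ : F ⟶ F') :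
    (⨁ c : C, (G.obj (op c) ⊗[k] F.obj c : Type u)) →ₗ[k]
      (⨁ c : C, (G.obj (op c) ⊗[k] F'.obj c : Type u)) :=
  DirectSum.lmap fun c => TensorProduct.map LinearMap.id (ψ.app c).hom

theorem tensorMapAux_lof [DecidableEq C] (G : Cᵒᵖ ⥤ ModuleCat.{u} k) {F F' : C ⥤ ModuleCat.{u} k}
    (ψ : F ⟶ F') (c : C) (z : (G.obj (op c) ⊗[k] F.obj c : Type u)) :
    tensorMapAux G ψ (DirectSum.lof k C (fun c => (G.obj (op c) ⊗[k] F.obj c : Type u)) c z) =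
      DirectSum.lof k C (fun c => (G.obj (op c) ⊗[k] F'.obj c : Type u)) c
        (TensorProduct.map LinearMap.id (ψ.app c).hom z) := by
  simp [tensorMapAux]

theorem tensorMapAux_add (G : Cᵒᵖ ⥤ ModuleCat.{u} k) {F F' : C ⥤ ModuleCat.{u} k}
    (ψ ψ' : F ⟶ F') : tensorMapAux G (ψ + ψ') = tensorMapAux G ψ + tensorMapAux G ψ' := by
  classical
  ext c x y
  simp [tensorMapAux_lof, TensorProduct.tmul_add]

theorem tensorRel_le_comap [DecidableEq C] (G : Cᵒᵖ ⥤ ModuleCat.{u} k)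
    {F F' : C ⥤ ModuleCat.{u} k} (ψ : F ⟶ F') :
    tensorRel G F ≤ (tensorRel G F').comap (tensorMapAux G ψ) := by
  refine Submodule.span_le.2 ?_
  rintro _ ⟨c, d, α, x, y, rfl⟩
  refine Submodule.subset_span ⟨c, d, α, x, (ψ.app c).hom y, ?_⟩
  rw [map_sub, tensorMapAux_lof, tensorMapAux_lof]
  simp [NatTrans.naturality_apply]

/-- The tensor product `G ⊗_C F` of a right `C`-module `G` and a left `C`-module `F`,
as a functor of `F`. -/
def tensorFunctor [DecidableEq C] (G : Cᵒᵖ ⥤ ModuleCat.{u} k) :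
    (C ⥤ ModuleCat.{u} k) ⥤ ModuleCat.{u} k where
  obj F := ModuleCat.of k
    ((⨁ c : C, (G.obj (op c) ⊗[k] F.obj c : Type u)) ⧸ tensorRel G F)
  map ψ := ModuleCat.ofHom
    (Submodule.mapQ _ _ (tensorMapAux G ψ) (tensorRel_le_comap G ψ))
  map_id F := by
    ext c x y
    simp [tensorMapAux_lof]
  map_comp ψ ψ' := by
    ext c x y
    simp [tensorMapAux_lof]

instance [DecidableEq C] (G : Cᵒᵖ ⥤ ModuleCat.{u} k) : (tensorFunctor G).Additive where
  map_add {F F' ψ ψ'} := by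
    apply ModuleCat.hom_ext
    apply LinearMap.ext
    intro z
    obtain ⟨z, rfl⟩ := Submodule.Quotient.mk_surjective _ z
    change (tensorRel G F').mkQ (tensorMapAux G (ψ + ψ') z) =
      (tensorRel G F').mkQ (tensorMapAux G ψ z) + (tensorRel G F').mkQ (tensorMapAux G ψ' z)
    rw [tensorMapAux_add, LinearMap.add_apply, map_add]

/-- `Tor_n^C(G, F)`: the left derived functors of the tensor product of functors. -/
def functorTor [DecidableEq C] (G : Cᵒᵖ ⥤ ModuleCat.{u} k) (n : ℕ) (F : C ⥤ ModuleCat.{u} k) :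
    ModuleCat.{u} k :=
  ((tensorFunctor G).leftDerived n).obj F

end FunctorHomology

/-! ### The categories `Γ`, `Γ`-surjections and `Ω` -/

/-- The objects `[n] = {0, 1, …, n}` of `Γ`, based at `0`. -/
@[ext]
structure Gam where
  /-- the number of elements other than the basepoint -/
  size : ℕ
  deriving DecidableEq

/-- The morphisms of `Γ` are the basepoint-preserving maps. -/
instance : Category.{0} Gam where
  Hom p q := {f : Fin (p.size + 1) → Fin (q.size + 1) // f 0 = 0}
  id p := ⟨id, rfl⟩
  comp f g := ⟨g.1 ∘ f.1, by simp [f.2, g.2]⟩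

/-- The objects `[n]` of the category of surjective morphisms of `Γ`. -/
@[ext]
structure GamSurj where
  /-- the number of elements other than the basepoint -/
  size : ℕ

/-- The wide subcategory of `Γ` of the surjective basepoint-preserving maps. -/
instance : Category.{0} GamSurj where
  Hom p q := {f : Fin (p.size + 1) → Fin (q.size + 1) // f 0 = 0 ∧ Function.Surjective f}
  id p := ⟨id, rfl, Function.surjective_id⟩
  comp f g := ⟨g.1 ∘ f.1, by simp [f.2.1, g.2.1], g.2.2.comp f.2.2⟩

/-- The inclusion of the surjective morphisms into `Γ`. -/
def GamSurj.incl : GamSurj ⥤ Gam where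
  obj p := ⟨p.size⟩
  map f := ⟨f.1, f.2.1⟩

@[simp] theorem Gam.id_val (p : Gam) : (𝟙 p : p ⟶ p).1 = id := rfl
@[simp] theorem Gam.comp_val {p q r : Gam} (f : p ⟶ q) (g : q ⟶ r) :
    (f ≫ g).1 = g.1 ∘ f.1 := rfl
@[simp] theorem GamSurj.id_val (p : GamSurj) : (𝟙 p : p ⟶ p).1 = id := rfl
@[simp] theorem GamSurj.comp_val {p q r : GamSurj} (f : p ⟶ q) (g : q ⟶ r) :
    (f ≫ g).1 = g.1 ∘ f.1 := rfl

/-- The objects of `Ω`: the sets with `card ≥ 1` elements, indexed by `Fin card`. -/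
@[ext]
structure Omega where
  /-- the number of elements -/
  card : ℕ
  pos : 1 ≤ card

/-- The morphisms of `Ω` are the surjections. -/
instance : Category.{0} Omega where
  Hom x y := {f : Fin x.card → Fin y.card // Function.Surjective f}
  id x := ⟨id, Function.surjective_id⟩
  comp f g := ⟨g.1 ∘ f.1, g.2.comp f.2⟩

@[simp] theorem Omega.id_val (x : Omega) : (𝟙 x : x ⟶ x).1 = id := rfl
@[simp] theorem Omega.comp_val {x y z : Omega} (f : x ⟶ y) (g : y ⟶ z) :
    (f ≫ g).1 = g.1 ∘ f.1 := rfl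

/-! ### The Loday functors -/

section Loday

variable {k : Type u} [CommRing k]

theorem restrict_update_pos {α B : Type*} [DecidableEq α] {P : α → Prop} (b : α → B) {i : α}
    (h : P i) (v : B) :
    (fun j : {j // P j} => Function.update b i v j) =
      Function.update (fun j : {j // P j} => b j) ⟨i, h⟩ v := by
  funext j
  by_cases hj : (j : α) = i
  · obtain ⟨j, hj'⟩ := j
    subst hj
    simp
  · rw [Function.update_of_ne hj, Function.update_of_ne (fun h' => hj (by rw [h']))]

theorem restrict_update_neg {α B : Type*} [DecidableEq α] {P : α → Prop} (b : α → B) {i : α}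
    (h : ¬ P i) (v : B) :
    (fun j : {j // P j} => Function.update b i v j) = fun j : {j // P j} => b j := by
  funext j
  rw [Function.update_of_ne (fun h' : (j : α) = i => h (h' ▸ j.2))]

theorem fiber_cases {p q : ℕ} [DecidableEq (Fin p)] {B C : Type u} [AddCommGroup B] [Module k B]
    [AddCommGroup C] [Module k C] (g : Fin p → Fin (q + 1)) (b : Fin p → B) (i : Fin p) :
    (∃ h : g i = 0, (∀ v, (fun j : {j // g j = 0} => Function.update b i v j) =
          Function.update (fun j : {j // g j = 0} => b j) ⟨i, h⟩ v) ∧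
        ∀ (l : Fin q) v, (fun j : {j // g j = l.succ} => Function.update b i v j) =
          fun j : {j // g j = l.succ} => b j) ∨
      ∃ (l₀ : Fin q) (h : g i = l₀.succ),
        (∀ v, (fun j : {j // g j = 0} => Function.update b i v j) =
          fun j : {j // g j = 0} => b j) ∧
        ∀ (μ : ∀ j : Fin q, MultilinearMap k (fun _ : {i : Fin p // g i = j.succ} => B) C) (v : B),
          (fun l => μ l fun j => Function.update b i v j) =
            Function.update (fun l => μ l fun j => b j) l₀
              (μ l₀ (Function.update (fun j : {j // g j = l₀.succ} => b j) ⟨i, h⟩ v)) := by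
  by_cases h0 : g i = 0
  · left
    refine ⟨h0, fun v => restrict_update_pos b h0 v, fun l v => restrict_update_neg b ?_ v⟩
    rw [h0]
    exact (Fin.succ_ne_zero l).symm
  · right
    obtain ⟨l₀, hl⟩ := Fin.exists_succ_eq.2 h0
    refine ⟨l₀, hl.symm, fun v => restrict_update_neg b h0 v, fun μ v => ?_⟩
    funext l
    by_cases h : l = l₀
    · subst h
      rw [Function.update_self, restrict_update_pos b hl.symm v]
    · rw [Function.update_of_ne h, restrict_update_neg b (fun h' => h ?_) v]
      exact Fin.succ_injective _ (h'.symm.trans hl.symm)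

/-- Given a map `g : {1, …, p} → {0, 1, …, q}`, multilinear maps `μ j` on the factors in the
fibre of each `j ≠ 0` and a multilinear map `ν` from the factors in the fibre of `0` to the
endomorphisms of `M`, the linear map `B^{⊗ p} ⊗ M → C^{⊗ q} ⊗ M` with
`b ⊗ m ↦ (⨂ j, μ j (b restricted to g⁻¹(j))) ⊗ ν (b restricted to g⁻¹(0)) m`. -/
def fiberTensor {B C M : Type u} [AddCommGroup B] [Module k B] [AddCommGroup C] [Module k C]
    [AddCommGroup M] [Module k M] {p q : ℕ} (g : Fin p → Fin (q + 1))
    (μ : ∀ j : Fin q, MultilinearMap k (fun _ : {i : Fin p // g i = j.succ} => B) C)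
    (ν : MultilinearMap k (fun _ : {i : Fin p // g i = 0} => B) (Module.End k M)) :
    ((⨂[k] _ : Fin p, B) ⊗[k] M) →ₗ[k] ((⨂[k] _ : Fin q, C) ⊗[k] M) :=
  TensorProduct.lift (PiTensorProduct.lift
    { toFun := fun b =>
        (TensorProduct.mk k (⨂[k] _ : Fin q, C) M
          (PiTensorProduct.tprod k fun j => μ j fun i => b i)) ∘ₗ (ν fun i => b i)
      map_update_add' := by
        intro _ b i v w
        obtain ⟨_, hν, hμ⟩ | ⟨_, _, hν, hμ⟩ := fiber_cases (k := k) (C := C) g b i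
        · simp only [hν, hμ, MultilinearMap.map_update_add, LinearMap.comp_add]
        · simp only [hν, hμ μ, MultilinearMap.map_update_add, map_add, LinearMap.add_comp]
      map_update_smul' := by
        intro _ b i r v
        obtain ⟨_, hν, hμ⟩ | ⟨_, _, hν, hμ⟩ := fiber_cases (k := k) (C := C) g b i
        · simp only [hν, hμ, MultilinearMap.map_update_smul, LinearMap.comp_smul]
        · simp only [hν, hμ μ, MultilinearMap.map_update_smul, map_smul, LinearMap.smul_comp] })

@[simp]
theorem fiberTensor_tmul {B C M : Type u} [AddCommGroup B] [Module k B] [AddCommGroup C]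
    [Module k C] [AddCommGroup M] [Module k M] {p q : ℕ} (g : Fin p → Fin (q + 1))
    (μ : ∀ j : Fin q, MultilinearMap k (fun _ : {i : Fin p // g i = j.succ} => B) C)
    (ν : MultilinearMap k (fun _ : {i : Fin p // g i = 0} => B) (Module.End k M))
    (b : Fin p → B) (m : M) :
    fiberTensor g μ ν (PiTensorProduct.tprod k b ⊗ₜ[k] m) =
      (PiTensorProduct.tprod k fun j => μ j fun i => b i) ⊗ₜ[k] (ν (fun i => b i) m) := by
  simp [fiberTensor]

variable {A : Type u} [CommRing A] [Algebra k A]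

/-- Multiplication by the product of the factors in the fibre of the basepoint. -/
def prodAct (M : Type u) [AddCommGroup M] [Module k M] [Module A M] [IsScalarTower k A M]
    {B : Type u} [AddCommGroup B] [Module k B] (φ : B →ₗ[k] A) (ι : Type) [Fintype ι] :
    MultilinearMap k (fun _ : ι => B) (Module.End k M) :=
  (Algebra.lsmul k k M : A →ₐ[k] Module.End k M).toLinearMap.compMultilinearMap
    ((MultilinearMap.mkPiAlgebra k ι A).compLinearMap fun _ => φ)

@[simp]
theorem prodAct_apply {M : Type u} [AddCommGroup M] [Module k M] [Module A M]
    [IsScalarTower k A M] {B : Type u} [AddCommGroup B] [Module k B] (φ : B →ₗ[k] A)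
    (ι : Type) [Fintype ι] (b : ι → B) (m : M) :
    prodAct M φ ι b m = (∏ i, φ (b i)) • m := by
  simp [prodAct]

theorem prod_mem_ideal (I : Ideal A) {ι : Type} [Fintype ι] [h : Nonempty ι] (y : ι → A)
    (hy : ∀ i, y i ∈ I) : ∏ i, y i ∈ I :=
  I.prod_mem (Finset.mem_univ h.some) (hy _)

/-- The inclusion of an ideal of `A`, as a `k`-linear map. -/
abbrev idealIncl (k : Type u) [CommRing k] [Algebra k A] (I : Ideal A) : I →ₗ[k] A :=
  I.subtype.restrictScalars k

/-- The product of a non-empty family of elements of an ideal, as an element of the ideal. -/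
def prodIdeal (I : Ideal A) (ι : Type) [Fintype ι] [Nonempty ι] :
    MultilinearMap k (fun _ : ι => I) I where
  toFun y := ⟨∏ i, (y i : A), prod_mem_ideal I _ fun i => (y i).2⟩
  map_update_add' y i v w := Subtype.ext
    (((MultilinearMap.mkPiAlgebra k ι A).compLinearMap fun _ => idealIncl k I).map_update_add
      y i v w)
  map_update_smul' y i c v := Subtype.ext
    (((MultilinearMap.mkPiAlgebra k ι A).compLinearMap fun _ => idealIncl k I).map_update_smul
      y i c v)

@[simp]
theorem prodIdeal_apply (I : Ideal A) (ι : Type) [Fintype ι] [Nonempty ι] (y : ι → I) :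
    ((prodIdeal (k := k) I ι y : I) : A) = ∏ i, (y i : A) := by
  rfl

theorem prod_subtype_eq {α : Type} [Fintype α] (P : α → Prop) [DecidablePred P] (a : α → A) :
    ∏ i : {i // P i}, a i = ∏ i with P i, a i :=
  (Finset.prod_subtype _ (by simp) a).symm

theorem prod_fiber_aux {p q r : ℕ} (f : Fin p → Fin (q + 1)) (g : Fin (q + 1) → Fin (r + 1))
    (a : Fin p → A) (y : Fin (r + 1)) :
    ∏ i : {i // g (f i) = y}, a i =
      (if g 0 = y then ∏ i : {i // f i = 0}, a i else 1) *
        ∏ l : {l : Fin q // g l.succ = y}, ∏ i : {i // f i = (l : Fin q).succ}, a i := by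
  rw [prod_subtype_eq (fun l : Fin q => g l.succ = y)
    (fun l => ∏ i : {i // f i = l.succ}, a i), Finset.prod_filter,
    ← Fin.prod_univ_succ (fun l => if g l = y then ∏ i : {i // f i = l}, a i else 1),
    prod_subtype_eq (fun i => g (f i) = y) a, ← Finset.prod_filter]
  simp_rw [prod_subtype_eq]
  rw [← Finset.prod_fiberwise_of_maps_to (s := {i | g (f i) = y}) (t := {l | g l = y}) (g := f)
    (by simp)]
  refine Finset.prod_congr rfl fun l hl => Finset.prod_congr ?_ fun _ _ => rfl
  ext i
  simp only [Finset.mem_filter, Finset.mem_univ, true_and] at hl ⊢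
  exact ⟨fun h => h.2, fun h => ⟨by rw [h, hl], h⟩⟩

theorem prod_fiber_succ {p q r : ℕ} (f : Fin p → Fin (q + 1)) (g : Fin (q + 1) → Fin (r + 1))
    (hg : g 0 = 0) (a : Fin p → A) (j : Fin r) :
    ∏ i : {i // g (f i) = j.succ}, a i =
      ∏ l : {l : Fin q // g l.succ = j.succ}, ∏ i : {i // f i = (l : Fin q).succ}, a i := by
  rw [prod_fiber_aux, if_neg (by rw [hg]; exact (Fin.succ_ne_zero j).symm), one_mul]

theorem prod_fiber_zero {p q r : ℕ} (f : Fin p → Fin (q + 1)) (g : Fin (q + 1) → Fin (r + 1))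
    (hg : g 0 = 0) (a : Fin p → A) :
    ∏ i : {i // g (f i) = 0}, a i =
      (∏ l : {l : Fin q // g l.succ = 0}, ∏ i : {i // f i = (l : Fin q).succ}, a i) *
        ∏ i : {i // f i = 0}, a i := by
  rw [prod_fiber_aux, if_pos hg, mul_comm]

theorem prod_fiber_id (p : ℕ) (a : Fin p → A) (j : Fin p) :
    ∏ i : {i : Fin p // i.succ = j.succ}, a i = a j := by
  rw [prod_subtype_eq (fun i : Fin p => i.succ = j.succ) a]
  simp [Fin.succ_inj, Finset.prod_filter]

theorem prod_fiber_id_zero (p : ℕ) (a : Fin p → A) :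
    ∏ i : {i : Fin p // i.succ = 0}, a i = 1 := by
  rw [prod_subtype_eq (fun i : Fin p => i.succ = 0) a]
  simp

variable (M : Type u) [AddCommGroup M] [Module k M] [Module A M] [IsScalarTower k A M]

variable (k A) in
/-- The map `A^{⊗ p} ⊗ M → A^{⊗ q} ⊗ M` with `a ⊗ m ↦ b ⊗ cm`, where `b j` is the product of the
`a i` with `f i = j` for `1 ≤ j ≤ q` and `c` is the product of the `a i` with `f i = 0`. -/
def lodayMap {p q : Gam} (f : p ⟶ q) :
    ((⨂[k] _ : Fin p.size, A) ⊗[k] M) →ₗ[k] ((⨂[k] _ : Fin q.size, A) ⊗[k] M) :=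
  fiberTensor (fun i => f.1 i.succ) (fun _ => MultilinearMap.mkPiAlgebra k _ A)
    (prodAct M LinearMap.id _)

@[simp]
theorem lodayMap_tmul {p q : Gam} (f : p ⟶ q) (a : Fin p.size → A) (m : M) :
    lodayMap k A M f (PiTensorProduct.tprod k a ⊗ₜ[k] m) =
      (PiTensorProduct.tprod k fun j : Fin q.size => ∏ i : {i : Fin p.size // f.1 i.succ = j.succ}, a i) ⊗ₜ[k]
        ((∏ i : {i : Fin p.size // f.1 i.succ = 0}, a i) • m) := by
  simp [lodayMap]

variable (k A) in
/-- The Loday functor `L(A, M)`, with `L(A, M)[n] = A^{⊗ n} ⊗ M`. -/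
def loday : Gam ⥤ ModuleCat.{u} k where
  obj p := ModuleCat.of k ((⨂[k] _ : Fin p.size, A) ⊗[k] M)
  map f := ModuleCat.ofHom (lodayMap k A M f)
  map_id p := by
    apply ModuleCat.hom_ext
    refine TensorProduct.ext (PiTensorProduct.ext (MultilinearMap.ext fun a =>
      LinearMap.ext fun m => ?_))
    change lodayMap k A M (𝟙 p) (PiTensorProduct.tprod k a ⊗ₜ[k] m) = _
    rw [lodayMap_tmul]
    simp only [Gam.id_val, id, prod_fiber_id, prod_fiber_id_zero, one_smul]
    rfl
  map_comp {p q r} f g := by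
    apply ModuleCat.hom_ext
    refine TensorProduct.ext (PiTensorProduct.ext (MultilinearMap.ext fun a =>
      LinearMap.ext fun m => ?_))
    change lodayMap k A M (f ≫ g) (PiTensorProduct.tprod k a ⊗ₜ[k] m) =
      lodayMap k A M g (lodayMap k A M f (PiTensorProduct.tprod k a ⊗ₜ[k] m))
    rw [lodayMap_tmul, lodayMap_tmul, lodayMap_tmul, smul_smul]
    congr 1
    · congr 1
      funext j
      exact prod_fiber_succ (fun i => f.1 i.succ) g.1 g.2 a j
    · congr 1
      exact prod_fiber_zero (fun i => f.1 i.succ) g.1 g.2 a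

theorem GamSurj.fiber_nonempty {p q : GamSurj} (f : p ⟶ q) (j : Fin q.size) :
    Nonempty {i : Fin p.size // f.1 i.succ = j.succ} := by
  obtain ⟨i, hi⟩ := f.2.2 j.succ
  have h0 : i ≠ 0 := by
    rintro rfl
    exact Fin.succ_ne_zero j (hi.symm.trans f.2.1)
  obtain ⟨i, rfl⟩ := Fin.exists_succ_eq.2 h0
  exact ⟨⟨i, hi⟩⟩

variable (k) in
/-- The map `I^{⊗ p} ⊗ M → I^{⊗ q} ⊗ M` given by the formula of `lodayMap` when `f` is
surjective, so that the products that define the tensor factors are not empty. -/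
def lodayIdealMap (I : Ideal A) {p q : GamSurj} (f : p ⟶ q) :
    ((⨂[k] _ : Fin p.size, I) ⊗[k] M) →ₗ[k] ((⨂[k] _ : Fin q.size, I) ⊗[k] M) :=
  fiberTensor (fun i => f.1 i.succ)
    (fun j => haveI := GamSurj.fiber_nonempty f j; prodIdeal I _)
    (prodAct M (idealIncl k I) _)

@[simp]
theorem lodayIdealMap_tmul (I : Ideal A) {p q : GamSurj} (f : p ⟶ q) (y : Fin p.size → I) (m : M) :
    lodayIdealMap k M I f (PiTensorProduct.tprod k y ⊗ₜ[k] m) =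
      (PiTensorProduct.tprod k fun j : Fin q.size =>
        haveI := GamSurj.fiber_nonempty f j
        prodIdeal (k := k) I {i : Fin p.size // f.1 i.succ = j.succ} fun i => y i) ⊗ₜ[k]
        ((∏ i : {i : Fin p.size // f.1 i.succ = 0}, (y i : A)) • m) := by
  simp [lodayIdealMap]

variable (k) in
/-- The functor `[n] ↦ I^{⊗ n} ⊗ M` on the surjective morphisms of `Γ`. -/
def lodayIdeal (I : Ideal A) : GamSurj ⥤ ModuleCat.{u} k where
  obj p := ModuleCat.of k ((⨂[k] _ : Fin p.size, I) ⊗[k] M)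
  map f := ModuleCat.ofHom (lodayIdealMap k M I f)
  map_id p := by
    apply ModuleCat.hom_ext
    refine TensorProduct.ext (PiTensorProduct.ext (MultilinearMap.ext fun y =>
      LinearMap.ext fun m => ?_))
    change lodayIdealMap k M I (𝟙 p) (PiTensorProduct.tprod k y ⊗ₜ[k] m) =
      PiTensorProduct.tprod k y ⊗ₜ[k] m
    rw [lodayIdealMap_tmul]
    congr 1
    · congr 1
      funext j
      apply Subtype.ext
      rw [prodIdeal_apply]
      exact prod_fiber_id p.size (fun i => (y i : A)) j
    · exact (congrArg (· • m) (prod_fiber_id_zero p.size (fun i => (y i : A)))).trans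
        (one_smul A m)
  map_comp {p q r} f g := by
    apply ModuleCat.hom_ext
    refine TensorProduct.ext (PiTensorProduct.ext (MultilinearMap.ext fun y =>
      LinearMap.ext fun m => ?_))
    change lodayIdealMap k M I (f ≫ g) (PiTensorProduct.tprod k y ⊗ₜ[k] m) =
      lodayIdealMap k M I g (lodayIdealMap k M I f (PiTensorProduct.tprod k y ⊗ₜ[k] m))
    rw [lodayIdealMap_tmul, lodayIdealMap_tmul, lodayIdealMap_tmul, smul_smul]
    simp only [prodIdeal_apply]
    congr 1
    · congr 1
      funext j
      apply Subtype.ext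
      simp only [prodIdeal_apply]
      exact prod_fiber_succ (fun i => f.1 i.succ) g.1 g.2.1 (fun i => (y i : A)) j
    · congr 1
      exact prod_fiber_zero (fun i => f.1 i.succ) g.1 g.2.1 (fun i => (y i : A))

variable (k) in
/-- The natural map `I^{⊗ n} ⊗ M → A^{⊗ n} ⊗ M` induced by the inclusion of `I` into `A`. -/
def lodayIdealIncl (I : Ideal A) : lodayIdeal k M I ⟶ GamSurj.incl ⋙ loday k A M where
  app p := ModuleCat.ofHom
    (TensorProduct.map
      (PiTensorProduct.map fun _ : Fin p.size => idealIncl k I) LinearMap.id)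
  naturality {p q} f := by
    apply ModuleCat.hom_ext
    refine TensorProduct.ext (PiTensorProduct.ext (MultilinearMap.ext fun y =>
      LinearMap.ext fun m => ?_))
    change (TensorProduct.map
        (PiTensorProduct.map fun _ : Fin q.size => idealIncl k I) LinearMap.id)
        (lodayIdealMap k M I f (PiTensorProduct.tprod k y ⊗ₜ[k] m)) =
      lodayMap k A M (GamSurj.incl.map f) ((TensorProduct.map
        (PiTensorProduct.map fun _ : Fin p.size => idealIncl k I) LinearMap.id)
        (PiTensorProduct.tprod k y ⊗ₜ[k] m))
    rw [lodayIdealMap_tmul, TensorProduct.map_tmul, TensorProduct.map_tmul,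
      PiTensorProduct.map_tprod, PiTensorProduct.map_tprod]
    refine Eq.trans ?_ (lodayMap_tmul M (GamSurj.incl.map f) (fun i => (y i : A)) m).symm
    rfl

end Loday

/-! ### Strings of surjections -/

section Strings

/-- A string `x_0 → x_1 → ⋯ → x_n` of `n` composable morphisms of `Ω`, as a functor; the map
`x_i → x_j` for `i ≤ j` is the composite of the string from `x_i` to `x_j`. -/
abbrev Str (n : ℕ) := ComposableArrows Omega n

/-- The map `x_i → x_j` in a string of surjections. -/
def Str.tr {n : ℕ} (s : Str n) {i j : Fin (n + 1)} (h : i ≤ j) :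
    Fin (s.obj i).card → Fin (s.obj j).card :=
  (s.map (homOfLE h)).1

theorem Str.tr_surjective {n : ℕ} (s : Str n) {i j : Fin (n + 1)} (h : i ≤ j) :
    Function.Surjective (s.tr h) := (s.map (homOfLE h)).2

@[simp]
theorem Str.tr_self {n : ℕ} (s : Str n) {i : Fin (n + 1)} (h : i ≤ i)
    (a : Fin (s.obj i).card) : s.tr h a = a :=
  congrFun (congrArg Subtype.val (s.map_id i)) a

@[simp]
theorem Str.tr_tr {n : ℕ} (s : Str n) {i j l : Fin (n + 1)} (h : i ≤ j) (h' : j ≤ l)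
    (a : Fin (s.obj i).card) : s.tr h' (s.tr h a) = s.tr (h.trans h') a :=
  (congrFun (congrArg Subtype.val (s.map_comp (homOfLE h) (homOfLE h'))) a).symm

theorem Omega.eqToHom_val {x y : Omega} (h : x = y) (a : Fin x.card) :
    (((eqToHom h).1 a : Fin y.card) : ℕ) = a := by
  subst h; rfl

/-- Two strings are equal if their sets and maps agree. -/
theorem Str.ext {n : ℕ} {s t : Str n} (hobj : ∀ i, (s.obj i).card = (t.obj i).card)
    (hmap : ∀ (i j : Fin (n + 1)) (h : i ≤ j) (a : Fin (s.obj i).card) (b : Fin (t.obj i).card),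
      (a : ℕ) = b → (s.tr h a : ℕ) = t.tr h b) : s = t := by
  refine CategoryTheory.Functor.ext (fun i => Omega.ext (hobj i)) fun i j f => ?_
  apply Subtype.ext
  funext a
  apply Fin.ext
  have := hmap i j (leOfHom f) a ((eqToHom (Omega.ext (hobj i))).1 a) (Omega.eqToHom_val _ _).symm
  simp only [Omega.comp_val, Function.comp_apply]
  rw [Omega.eqToHom_val]
  exact this

/-- The elements of a finite subset `S` of `{1, …, x}`, re-indexed by `{1, …, |S|}` in order. -/
abbrev emb {x : ℕ} (S : Finset (Fin x)) : Fin S.card ↪o Fin x := S.orderEmbOfFin rfl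

/-- The index in `{1, …, |S|}` of an element of `S`. -/
def idx {x : ℕ} (S : Finset (Fin x)) (a : Fin x) (h : a ∈ S) : Fin S.card :=
  (S.orderIsoOfFin rfl).symm ⟨a, h⟩

@[simp]
theorem emb_idx {x : ℕ} (S : Finset (Fin x)) (a : Fin x) (h : a ∈ S) : emb S (idx S a h) = a := by
  rw [← Finset.coe_orderIsoOfFin_apply, idx, OrderIso.apply_symm_apply]

theorem emb_mem {x : ℕ} (S : Finset (Fin x)) (a : Fin S.card) : emb S a ∈ S :=
  S.orderEmbOfFin_mem rfl a

@[simp]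
theorem idx_emb {x : ℕ} (S : Finset (Fin x)) (a : Fin S.card) :
    idx S (emb S a) (emb_mem S a) = a :=
  (emb S).injective (emb_idx S _ _)

/-- Let `S j ⊆ x_j` be non-empty subsets such that each map `x_i → x_j` of the string maps `S i`
onto `S j`. The string obtained by restricting all the domains and codomains to these subsets and
re-indexing them in order. -/
def Str.restrict {n : ℕ} (s : Str n) (S : ∀ j, Finset (Fin (s.obj j).card))
    (hS : ∀ j, (S j).Nonempty) (him : ∀ i j (h : i ≤ j), (S i).image (s.tr h) = S j) : Str n where
  obj j := ⟨(S j).card, (hS j).card_pos⟩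
  map {i j} f :=
    ⟨fun a => idx (S j) (s.tr (leOfHom f) (emb (S i) a))
        (by rw [← him i j (leOfHom f)]; exact Finset.mem_image_of_mem _ (emb_mem _ _)),
      fun b => by
        obtain ⟨a, ha, hab⟩ := Finset.mem_image.1
          ((him i j (leOfHom f)).symm ▸ emb_mem (S j) b :
            emb (S j) b ∈ (S i).image (s.tr (leOfHom f)))
        refine ⟨idx (S i) a ha, (emb (S j)).injective ?_⟩
        rw [emb_idx, emb_idx, hab]⟩
  map_id i := by
    apply Subtype.ext
    funext a
    apply (emb (S i)).injective
    simp
  map_comp {i j l} f g := by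
    apply Subtype.ext
    funext a
    apply (emb (S l)).injective
    simp

theorem Str.emb_restrict_tr {n : ℕ} (s : Str n) (S : ∀ j, Finset (Fin (s.obj j).card))
    (hS : ∀ j, (S j).Nonempty) (him : ∀ i j (h : i ≤ j), (S i).image (s.tr h) = S j)
    {i j : Fin (n + 1)} (h : i ≤ j) (a : Fin (S i).card) :
    emb (S j) ((s.restrict S hS him).tr h a) = s.tr h (emb (S i) a) :=
  emb_idx _ _ _

/-- The subset of `x_j` of the elements that are mapped to `c ∈ x_n`. -/
def Str.fiber {n : ℕ} (s : Str n) (c : Fin (s.obj (Fin.last n)).card) (j : Fin (n + 1)) :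
    Finset (Fin (s.obj j).card) :=
  {b | s.tr (Fin.le_last j) b = c}

@[simp]
theorem Str.mem_fiber {n : ℕ} (s : Str n) (c : Fin (s.obj (Fin.last n)).card) (j : Fin (n + 1))
    (b : Fin (s.obj j).card) : b ∈ s.fiber c j ↔ s.tr (Fin.le_last j) b = c := by
  simp [Str.fiber]

/-- The component of a string `x_0 → ⋯ → x_n` at `c ∈ x_n`: its restriction to the preimages
of `c`. -/
def Str.component {n : ℕ} (s : Str n) (c : Fin (s.obj (Fin.last n)).card) : Str n :=
  s.restrict (s.fiber c)
    (fun j => by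
      obtain ⟨b, hb⟩ := s.tr_surjective (Fin.le_last j) c
      exact ⟨b, by simpa using hb⟩)
    (fun i j h => by
      ext b
      simp only [Finset.mem_image, Str.mem_fiber]
      constructor
      · rintro ⟨a, ha, rfl⟩
        rw [Str.tr_tr, ha]
      · intro hb
        obtain ⟨a, rfl⟩ := s.tr_surjective h b
        exact ⟨a, by rw [← hb, Str.tr_tr], rfl⟩)

theorem Str.component_last {n : ℕ} (s : Str n) (c : Fin (s.obj (Fin.last n)).card) :
    ((s.component c).obj (Fin.last n)).card = 1 := by
  change (s.fiber c (Fin.last n)).card = 1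
  rw [Finset.card_eq_one]
  exact ⟨c, by ext b; simp⟩

/-- For `L ⊆ x_0`, the image of `L` in `x_j`. -/
def Str.img {n : ℕ} (s : Str n) (L : Finset (Fin (s.obj 0).card)) (j : Fin (n + 1)) :
    Finset (Fin (s.obj j).card) :=
  L.image (s.tr (Fin.zero_le j))

/-- For `L ⊆ x_0` non-empty, the pruned string: the restriction of the string to the images
of `L`. -/
def Str.prune {n : ℕ} (s : Str n) (L : Finset (Fin (s.obj 0).card)) (hL : L.Nonempty) : Str n :=
  s.restrict (s.img L) (fun _ => hL.image _)
    (fun i j h => by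
      ext b
      simp [Str.img])

theorem Str.prune_last {n : ℕ} (s : Str n) (L : Finset (Fin (s.obj 0).card)) (hL : L.Nonempty)
    (hs : (s.obj (Fin.last n)).card = 1) : ((s.prune L hL).obj (Fin.last n)).card = 1 := by
  apply le_antisymm
  · refine (Finset.card_le_univ (s.img L (Fin.last n))).trans ?_
    simp [hs]
  · exact ((s.prune L hL).obj (Fin.last n)).pos

/-- `NΩ_n(-, 1)`: the strings of `n` composable surjections with final codomain `{1}`. -/
@[ext]
structure OneStr (n : ℕ) where
  /-- the string -/
  str : Str n
  card_last : (str.obj (Fin.last n)).card = 1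

instance (n : ℕ) : DecidableEq (OneStr n) := Classical.decEq _

/-- The initial domain of a string. -/
abbrev OneStr.dom {n : ℕ} (s : OneStr n) : ℕ := (s.str.obj 0).card

/-- The pullback of a string along a monotone map `{0, …, m} → {0, …, n}`. -/
abbrev Str.pull {m n : ℕ} (s : Str n) (θ : Fin (m + 1) →o Fin (n + 1)) : Str m :=
  s.whiskerLeft θ.monotone.functor

end Strings

/-! ### The Robinson-Whitehouse complex -/

section RobinsonWhitehouse

/-- A surjection `{1, …, x} → {1, …, y}`, as a basepoint-preserving map. -/
def GamSurj.ofSurj {x y : ℕ} (f : Fin x → Fin y) (hf : Function.Surjective f) :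
    (⟨x⟩ : GamSurj) ⟶ ⟨y⟩ :=
  ⟨Fin.cases 0 fun i => (f i).succ, rfl, fun j => by
    refine Fin.cases ⟨0, rfl⟩ (fun j => ?_) j
    obtain ⟨i, rfl⟩ := hf j
    exact ⟨i.succ, rfl⟩⟩

@[simp]
theorem GamSurj.ofSurj_succ {x y : ℕ} (f : Fin x → Fin y) (hf : Function.Surjective f)
    (i : Fin x) : (GamSurj.ofSurj f hf).1 i.succ = (f i).succ := rfl

/-- For `S ⊆ {1, …, x}`, the basepoint-preserving map `[x] → [|S|]` that re-indexes the elements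
of `S` in order and sends all other elements to the basepoint. -/
def GamSurj.collapse {x : ℕ} (S : Finset (Fin x)) : (⟨x⟩ : GamSurj) ⟶ ⟨S.card⟩ :=
  ⟨Fin.cases 0 fun i => if h : i ∈ S then (idx S i h).succ else 0, rfl, fun j => by
    refine Fin.cases ⟨0, rfl⟩ (fun j => ?_) j
    exact ⟨(emb S j).succ, by simp⟩⟩

theorem GamSurj.collapse_succ {x : ℕ} (S : Finset (Fin x)) (i : Fin x) :
    (GamSurj.collapse S).1 i.succ = if h : i ∈ S then (idx S i h).succ else 0 := rfl

variable {k : Type u} [CommRing k]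

/-- The module `⨁_{x ≥ 1} k[NΩ_n(x, 1)] ⊗ F[x]`, as the direct sum of a copy of `F[x]` for each
string in `NΩ_n(x, 1)`. -/
abbrev RWMod (F : GamSurj ⥤ ModuleCat.{u} k) (n : ℕ) : Type u :=
  ⨁ s : OneStr n, F.obj ⟨s.dom⟩

/-- The element `[f_n | ⋯ | f_1] ⊗ v` for `v` in `F[x]`. -/
abbrev RWMod.of (F : GamSurj ⥤ ModuleCat.{u} k) {n : ℕ} (s : OneStr n) :
    F.obj ⟨s.dom⟩ →ₗ[k] RWMod F n :=
  DirectSum.lof k (OneStr n) (fun s => F.obj ⟨s.dom⟩) s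

/-- For a monotone map `θ : {0, …, m} → {0, …, n}`, a string `x_0 → ⋯ → x_n` and `c ∈ x_{θ(m)}`:
the composite of the map `x_0 → x_{θ(0)}` of the string and the map that collapses the complement
of the preimage of `c` in `x_{θ(0)}` to the basepoint. -/
def Str.coeffMap {m n : ℕ} (s : Str n) (θ : Fin (m + 1) →o Fin (n + 1))
    (c : Fin ((s.pull θ).obj (Fin.last m)).card) :
    (⟨(s.obj 0).card⟩ : GamSurj) ⟶ ⟨(((s.pull θ).component c).obj 0).card⟩ :=
  GamSurj.ofSurj (s.tr (Fin.zero_le (θ 0))) (s.tr_surjective _) ≫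
    GamSurj.collapse ((s.pull θ).fiber c 0)

/-- The operator of a monotone map `θ : {0, …, m} → {0, …, n}` on the summand of a string
`x_0 → x_1 → ⋯ → x_n = {1}`. The string is pulled back to `x_{θ(0)} → ⋯ → x_{θ(m)}`, which is
replaced by the sum of its components at all `c ∈ x_{θ(m)}`.

If `θ(m) = n`, as for all degeneracies and for the faces `∂_0, …, ∂_{n-1}`, then `x_{θ(m)} = {1}`
and there is only one component, the whole string. For `∂_n` one gets the sum of the components
at all `c ∈ x_{n-1}`. -/
def RWMod.mapOf (F : GamSurj ⥤ ModuleCat.{u} k) {m n : ℕ} (θ : Fin (m + 1) →o Fin (n + 1))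
    (s : OneStr n) : F.obj ⟨s.dom⟩ →ₗ[k] RWMod F m :=
  ∑ c : Fin ((s.str.pull θ).obj (Fin.last m)).card,
    RWMod.of F ⟨(s.str.pull θ).component c, (s.str.pull θ).component_last c⟩ ∘ₗ
      (F.map (s.str.coeffMap θ c)).hom

theorem GamSurj.hom_ext_val {p : GamSurj} {x y : ℕ} (h : x = y) (φ : p ⟶ ⟨x⟩) (ψ : p ⟶ ⟨y⟩)
    (H : ∀ (i : Fin p.size) (a : Fin x) (b : Fin y), (a : ℕ) = b →
      (φ.1 i.succ = a.succ ↔ ψ.1 i.succ = b.succ)) : ∀ i, (φ.1 i : ℕ) = ψ.1 i := by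
  subst h
  refine Fin.cases ?_ fun i => ?_
  · rw [φ.2.1, ψ.2.1]
  · congr 1
    by_cases h : φ.1 i.succ = 0
    · rw [h]
      by_contra h'
      obtain ⟨b, hb⟩ := Fin.exists_succ_eq.2 (Ne.symm h')
      exact Fin.succ_ne_zero b (((H i b b rfl).2 hb.symm).symm.trans h)
    · obtain ⟨b, hb⟩ := Fin.exists_succ_eq.2 h
      rw [← hb, (H i b b rfl).1 hb.symm]

theorem RWMod.of_congr (F : GamSurj ⥤ ModuleCat.{u} k) {n : ℕ} {s t : OneStr n} (h : s = t)
    {p : GamSurj} (φ : p ⟶ ⟨s.dom⟩) (ψ : p ⟶ ⟨t.dom⟩) (H : ∀ i, (φ.1 i : ℕ) = ψ.1 i)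
    (v : F.obj p) : RWMod.of F s ((F.map φ).hom v) = RWMod.of F t ((F.map ψ).hom v) := by
  subst h
  have : φ = ψ := Subtype.ext (funext fun i => Fin.ext (H i))
  rw [this]

theorem GamSurj.collapse_eq_succ {x : ℕ} (S : Finset (Fin x)) (i : Fin x) (a : Fin S.card) :
    (GamSurj.collapse S).1 i.succ = a.succ ↔ i = emb S a := by
  rw [GamSurj.collapse_succ]
  split_ifs with h
  · rw [Fin.succ_inj]
    constructor
    · rintro rfl; simp
    · rintro rfl; simp
  · refine ⟨fun h' => (Fin.succ_ne_zero a h'.symm).elim, fun h' => (h ?_).elim⟩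
    rw [h']; exact emb_mem S a

theorem strictMono_unique {x y z : ℕ} {e : Fin x → Fin z} {e' : Fin y → Fin z}
    (he : StrictMono e) (he' : StrictMono e') (h : Set.range e = Set.range e') :
    x = y ∧ ∀ (a : Fin x) (b : Fin y), (a : ℕ) = (b : ℕ) → e a = e' b := by
  have hxy : x = y := by
    have h1 := Set.ncard_range_of_injective he.injective
    have h2 := Set.ncard_range_of_injective he'.injective
    rw [h, h2] at h1
    simpa using h1.symm
  subst hxy
  refine ⟨rfl, fun a b hab => ?_⟩
  rw [(he.range_inj he').1 h, Fin.ext hab]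

/-- Two strings which embed into a third string, in an order-preserving way and with the same
ranges, are equal. -/
theorem Str.eq_of_emb {n : ℕ} (r s t : Str n)
    (e : ∀ j, Fin (s.obj j).card → Fin (r.obj j).card) (he : ∀ j, StrictMono (e j))
    (hes : ∀ i j (h : i ≤ j) a, e j (s.tr h a) = r.tr h (e i a))
    (e' : ∀ j, Fin (t.obj j).card → Fin (r.obj j).card) (he' : ∀ j, StrictMono (e' j))
    (hes' : ∀ i j (h : i ≤ j) a, e' j (t.tr h a) = r.tr h (e' i a))
    (hr : ∀ j, Set.range (e j) = Set.range (e' j)) : s = t := by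
  have key := fun j => strictMono_unique (he j) (he' j) (hr j)
  refine Str.ext (fun j => (key j).1) fun i j h a b hab => ?_
  have h1 := (key j).2 (s.tr h a) (Fin.cast (key j).1 (s.tr h a)) rfl
  rw [hes, (key i).2 a b hab, ← hes'] at h1
  rw [(he' j).injective h1, Fin.val_cast]

/-- The inclusion of a component into the string. -/
def Str.cemb {n : ℕ} (s : Str n) (c : Fin (s.obj (Fin.last n)).card) (j : Fin (n + 1)) :
    Fin ((s.component c).obj j).card → Fin (s.obj j).card :=
  emb (s.fiber c j)

theorem Str.cemb_strictMono {n : ℕ} (s : Str n) (c : Fin (s.obj (Fin.last n)).card)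
    (j : Fin (n + 1)) : StrictMono (s.cemb c j) :=
  (emb (s.fiber c j)).strictMono

theorem Str.cemb_tr {n : ℕ} (s : Str n) (c : Fin (s.obj (Fin.last n)).card)
    {i j : Fin (n + 1)} (h : i ≤ j) (a : Fin ((s.component c).obj i).card) :
    s.cemb c j ((s.component c).tr h a) = s.tr h (s.cemb c i a) :=
  emb_idx _ _ _

theorem Str.range_cemb {n : ℕ} (s : Str n) (c : Fin (s.obj (Fin.last n)).card)
    (j : Fin (n + 1)) : Set.range (s.cemb c j) = {b | s.tr (Fin.le_last j) b = c} := by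
  refine (Finset.range_orderEmbOfFin (s.fiber c j) rfl).trans ?_
  ext b
  simp

theorem Str.tr_cemb {n : ℕ} (s : Str n) (c : Fin (s.obj (Fin.last n)).card)
    (j : Fin (n + 1)) (a : Fin ((s.component c).obj j).card) :
    s.tr (Fin.le_last j) (s.cemb c j a) = c := by
  have : s.cemb c j a ∈ Set.range (s.cemb c j) := ⟨a, rfl⟩
  rw [Str.range_cemb] at this
  exact this

theorem Str.component_of_last {n : ℕ} (s : Str n) (hs : (s.obj (Fin.last n)).card = 1)
    (c : Fin (s.obj (Fin.last n)).card) : s.component c = s := by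
  have hsub : Subsingleton (Fin (s.obj (Fin.last n)).card) := by rw [hs]; infer_instance
  refine Str.eq_of_emb s _ _ (s.cemb c) (s.cemb_strictMono c) (fun _ _ h a => s.cemb_tr c h a)
    (fun _ => id) (fun _ => strictMono_id) (fun _ _ _ _ => rfl) fun j => ?_
  rw [Str.range_cemb, Set.range_id]
  exact Set.eq_univ_of_forall fun b => Subsingleton.elim _ _

theorem Str.range_cemb_cemb {m n : ℕ} (s : Str n) (θ : Fin (m + 1) →o Fin (n + 1))
    (c : Fin (s.obj (Fin.last n)).card)
    (d : Fin ((s.component c).obj (θ (Fin.last m))).card) (j : Fin (m + 1)) :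
    Set.range (fun a => s.cemb c (θ j) (((s.component c).pull θ).cemb d j a)) =
      Set.range ((s.pull θ).cemb (s.cemb c (θ (Fin.last m)) d) j) := by
  have hθ : θ j ≤ θ (Fin.last m) := θ.monotone (Fin.le_last j)
  have h1 : ∀ b : Fin ((s.component c).obj (θ j)).card,
      (∃ x, ((s.component c).pull θ).cemb d j x = b) ↔ (s.component c).tr hθ b = d := fun b =>
    Set.ext_iff.1 (((s.component c).pull θ).range_cemb d j) b
  have h2 : ∀ a : Fin (s.obj (θ j)).card,
      (∃ x, (s.pull θ).cemb (s.cemb c (θ (Fin.last m)) d) j x = a) ↔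
        s.tr hθ a = s.cemb c (θ (Fin.last m)) d := fun a =>
    Set.ext_iff.1 ((s.pull θ).range_cemb (s.cemb c (θ (Fin.last m)) d) j) a
  refine Set.ext fun (a : Fin (s.obj (θ j)).card) => Iff.trans ?_ (h2 a).symm
  constructor
  · rintro ⟨x, hx⟩
    have h3 := (h1 _).1 ⟨x, rfl⟩
    rw [← hx]
    exact (s.cemb_tr c hθ _).symm.trans (congrArg (s.cemb c (θ (Fin.last m))) h3)
  · intro h
    have ha : a ∈ Set.range (s.cemb c (θ j)) := by
      rw [Str.range_cemb, Set.mem_ofPred_eq, ← s.tr_tr hθ (Fin.le_last _), h, s.tr_cemb]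
    obtain ⟨b, rfl⟩ := ha
    rw [← Str.cemb_tr] at h
    obtain ⟨x, hx⟩ := (h1 b).2 ((s.cemb_strictMono c _).injective h)
    exact ⟨x, congrArg (s.cemb c (θ j)) hx⟩

theorem Str.component_component {m n : ℕ} (s : Str n) (θ : Fin (m + 1) →o Fin (n + 1))
    (c : Fin (s.obj (Fin.last n)).card)
    (d : Fin ((s.component c).obj (θ (Fin.last m))).card) :
    ((s.component c).pull θ).component d =
      (s.pull θ).component (s.cemb c (θ (Fin.last m)) d) :=
  Str.eq_of_emb (s.pull θ) _ _
    (fun j a => s.cemb c (θ j) (((s.component c).pull θ).cemb d j a))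
    (fun j => (s.cemb_strictMono c (θ j)).comp (((s.component c).pull θ).cemb_strictMono d j))
    (fun i j h a => (congrArg (s.cemb c (θ j)) (((s.component c).pull θ).cemb_tr d h a)).trans
      (s.cemb_tr c (θ.monotone h) (((s.component c).pull θ).cemb d i a)))
    ((s.pull θ).cemb (s.cemb c (θ (Fin.last m)) d))
    ((s.pull θ).cemb_strictMono (s.cemb c (θ (Fin.last m)) d))
    (fun _ _ h a => (s.pull θ).cemb_tr (s.cemb c (θ (Fin.last m)) d) h a)
    (s.range_cemb_cemb θ c d)

/-- The elements of the set `x_{θ(m)}`, in terms of the components over `x_n`. -/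
theorem Str.bijective_cemb {n : ℕ} (s : Str n) (i : Fin (n + 1)) :
    Function.Bijective (fun p : Σ c : Fin (s.obj (Fin.last n)).card,
      Fin ((s.component c).obj i).card => s.cemb p.1 i p.2) := by
  constructor
  · rintro ⟨c, a⟩ ⟨c', a'⟩ (h : s.cemb c i a = s.cemb c' i a')
    have : c = c' := by rw [← s.tr_cemb c i a, h, s.tr_cemb]
    subst this
    rw [(s.cemb_strictMono c i).injective h]
  · intro b
    have : b ∈ Set.range (s.cemb (s.tr (Fin.le_last i) b) i) := by
      rw [Str.range_cemb]; rfl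
    obtain ⟨a, ha⟩ := this
    exact ⟨⟨_, a⟩, ha⟩

theorem GamSurj.collapse_fiber_eq_succ {n : ℕ} (s : Str n)
    (c : Fin (s.obj (Fin.last n)).card) (i : Fin (s.obj 0).card)
    (a : Fin ((s.component c).obj 0).card) :
    (GamSurj.collapse (s.fiber c 0)).1 i.succ = a.succ ↔ i = s.cemb c 0 a :=
  GamSurj.collapse_eq_succ (s.fiber c 0) i a

theorem Str.coeffMap_eq_succ {m n : ℕ} (s : Str n) (θ : Fin (m + 1) →o Fin (n + 1))
    (c : Fin ((s.pull θ).obj (Fin.last m)).card) (i : Fin (s.obj 0).card)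
    (a : Fin (((s.pull θ).component c).obj 0).card) :
    (s.coeffMap θ c).1 i.succ = a.succ ↔
      s.tr (Fin.zero_le (θ 0)) i = (s.pull θ).cemb c 0 a :=
  GamSurj.collapse_fiber_eq_succ (s.pull θ) c _ a

theorem RWMod.mapOf_apply (F : GamSurj ⥤ ModuleCat.{u} k) {m n : ℕ}
    (θ : Fin (m + 1) →o Fin (n + 1)) (s : OneStr n) (v : F.obj ⟨s.dom⟩) :
    RWMod.mapOf F θ s v = ∑ c : Fin ((s.str.pull θ).obj (Fin.last m)).card,
      RWMod.of F ⟨(s.str.pull θ).component c, (s.str.pull θ).component_last c⟩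
        ((F.map (s.str.coeffMap θ c)).hom v) := by
  rw [RWMod.mapOf, LinearMap.sum_apply]
  rfl

/-- The operator of a monotone map on the whole module. -/
def RWMod.map (F : GamSurj ⥤ ModuleCat.{u} k) {m n : ℕ} (θ : Fin (m + 1) →o Fin (n + 1)) :
    RWMod F n →ₗ[k] RWMod F m :=
  DirectSum.toModule k (OneStr n) (RWMod F m) (RWMod.mapOf F θ)

theorem RWMod.map_of (F : GamSurj ⥤ ModuleCat.{u} k) {m n : ℕ} (θ : Fin (m + 1) →o Fin (n + 1))
    (s : OneStr n) (v : F.obj ⟨s.dom⟩) :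
    RWMod.map F θ (RWMod.of F s v) = RWMod.mapOf F θ s v :=
  DirectSum.toModule_lof (R := k) (M := fun s : OneStr n => F.obj ⟨s.dom⟩)
    (φ := RWMod.mapOf F θ) s v

/-- If `θ(m) = n`, then the operator of `θ` pulls back strings and applies the map
`x_0 → x_{θ(0)}` to the coefficients. -/
theorem RWMod.mapOf_of_last (F : GamSurj ⥤ ModuleCat.{u} k) {m n : ℕ}
    (θ : Fin (m + 1) →o Fin (n + 1)) (s : OneStr n) (v : F.obj ⟨s.dom⟩)
    (hs : ((s.str.pull θ).obj (Fin.last m)).card = 1) :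
    RWMod.mapOf F θ s v = RWMod.of F ⟨s.str.pull θ, hs⟩
      ((F.map (GamSurj.ofSurj (s.str.tr (Fin.zero_le (θ 0))) (s.str.tr_surjective _))).hom v) := by
  rw [RWMod.mapOf_apply]
  have hu : Unique (Fin ((s.str.pull θ).obj (Fin.last m)).card) := by
    rw [hs]; infer_instance
  rw [Fintype.sum_unique]
  have h : (s.str.pull θ).component hu.default = s.str.pull θ :=
    (s.str.pull θ).component_of_last hs _
  refine RWMod.of_congr F (s := ⟨(s.str.pull θ).component hu.default,
    (s.str.pull θ).component_last _⟩) (t := ⟨s.str.pull θ, hs⟩) (OneStr.ext h)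
    (s.str.coeffMap θ hu.default)
    (GamSurj.ofSurj (s.str.tr (Fin.zero_le (θ 0))) (s.str.tr_surjective _)) ?_ v
  refine GamSurj.hom_ext_val (p := ⟨s.dom⟩) (congrArg (fun t : Str m => (t.obj 0).card) h) _ _
    fun i a b hab => ?_
  refine (s.str.coeffMap_eq_succ θ hu.default i a).trans ?_
  have h3 := (strictMono_unique ((s.str.pull θ).cemb_strictMono hu.default 0) (e' := id)
    strictMono_id (((s.str.pull θ).range_cemb hu.default 0).trans (Set.range_id.symm ▸
      Set.eq_univ_of_forall fun b => hu.instSubsingleton.elim _ _))).2 a b hab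
  refine Iff.trans ?_ Fin.succ_inj.symm
  exact iff_of_eq (congrArg (s.str.tr (Fin.zero_le (θ 0)) i = ·) h3)

theorem RWMod.map_id (F : GamSurj ⥤ ModuleCat.{u} k) (n : ℕ) :
    RWMod.map F (OrderHom.id : Fin (n + 1) →o Fin (n + 1)) = LinearMap.id := by
  refine DirectSum.linearMap_ext k fun s => LinearMap.ext fun v => ?_
  change RWMod.map F OrderHom.id (RWMod.of F s v) = RWMod.of F s v
  rw [RWMod.map_of, RWMod.mapOf_of_last F OrderHom.id s v s.card_last]
  have h := RWMod.of_congr F (s := ⟨s.str.pull OrderHom.id, s.card_last⟩) (t := s) rfl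
    (GamSurj.ofSurj (s.str.tr (Fin.zero_le 0)) (s.str.tr_surjective _)) (𝟙 _)
    (Fin.cases rfl fun i => congrArg (fun j : Fin s.dom => (j.succ : ℕ)) (s.str.tr_self _ i)) v
  rw [F.map_id] at h
  exact h

theorem Str.coeffMap_comp {l m n : ℕ} (s : Str n)
    (θ : Fin (m + 1) →o Fin (n + 1)) (θ' : Fin (l + 1) →o Fin (m + 1))
    (c : Fin ((s.pull θ).obj (Fin.last m)).card)
    (d : Fin (((s.pull θ).component c).obj (θ' (Fin.last l))).card)
    (i : Fin ((s.obj 0).card + 1)) :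
    ((s.coeffMap θ c ≫ ((s.pull θ).component c).coeffMap θ' d).1 i : ℕ) =
      (s.coeffMap (θ.comp θ') ((s.pull θ).cemb c (θ' (Fin.last l)) d)).1 i := by
  have hcard : (((((s.pull θ).component c).pull θ').component d).obj 0).card =
      (((s.pull (θ.comp θ')).component ((s.pull θ).cemb c (θ' (Fin.last l)) d)).obj 0).card :=
    congrArg (fun t : Str l => (t.obj 0).card) ((s.pull θ).component_component θ' c d)
  have hkey : ∀ (a : Fin (((((s.pull θ).component c).pull θ').component d).obj 0).card)
      (b : Fin (((s.pull (θ.comp θ')).component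
        ((s.pull θ).cemb c (θ' (Fin.last l)) d)).obj 0).card), (a : ℕ) = b → (s.pull θ).cemb c (θ' 0)
      ((((s.pull θ).component c).pull θ').cemb d 0 a) =
      (s.pull (θ.comp θ')).cemb ((s.pull θ).cemb c (θ' (Fin.last l)) d) 0 b :=
    (strictMono_unique
      (((s.pull θ).cemb_strictMono c (θ' 0)).comp
        ((((s.pull θ).component c).pull θ').cemb_strictMono d 0))
      ((s.pull (θ.comp θ')).cemb_strictMono ((s.pull θ).cemb c (θ' (Fin.last l)) d) 0)
      ((s.pull θ).range_cemb_cemb θ' c d 0)).2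
  refine GamSurj.hom_ext_val (p := ⟨(s.obj 0).card⟩) hcard _ _ (fun i a b hab => ?_) i
  have h0 : θ 0 ≤ θ (θ' 0) := θ.monotone (Fin.zero_le _)
  refine Iff.trans ?_ (s.coeffMap_eq_succ (θ.comp θ') _ i b).symm
  rw [← hkey a b hab]
  have hval : (s.coeffMap θ c ≫ ((s.pull θ).component c).coeffMap θ' d).1 i.succ =
    (((s.pull θ).component c).coeffMap θ' d).1 ((s.coeffMap θ c).1 i.succ) := rfl
  rw [hval]
  have h1 := s.coeffMap_eq_succ θ c i
  have h2 := ((s.pull θ).component c).coeffMap_eq_succ θ' d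
  constructor
  · intro h
    have hne : (s.coeffMap θ c).1 i.succ ≠ 0 := by
      intro h'
      rw [h', (((s.pull θ).component c).coeffMap θ' d).2.1] at h
      exact Fin.succ_ne_zero a h.symm
    obtain ⟨y, hy⟩ := Fin.exists_succ_eq.2 hne
    have h3 := (h1 y).1 hy.symm
    rw [← hy] at h
    have h4 := (h2 y a).1 h
    refine (s.tr_tr (Fin.zero_le (θ 0)) h0 i).symm.trans ?_
    refine (congrArg (s.tr h0) h3).trans ?_
    refine ((s.pull θ).cemb_tr c (Fin.zero_le (θ' 0)) y).symm.trans ?_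
    exact congrArg ((s.pull θ).cemb c (θ' 0)) h4
  · intro h
    have h3 : s.tr (Fin.zero_le (θ 0)) i ∈ Set.range ((s.pull θ).cemb c 0) := by
      rw [Str.range_cemb]
      have h4 := (s.pull θ).tr_cemb c (θ' 0) ((((s.pull θ).component c).pull θ').cemb d 0 a)
      refine Eq.trans ?_ h4
      refine Eq.trans ?_ (congrArg (s.tr (θ.monotone (Fin.le_last (θ' 0)))) h)
      exact (s.tr_tr _ _ i).trans (s.tr_tr _ _ i).symm
    obtain ⟨y, hy⟩ := h3
    rw [(h1 y).2 hy.symm, h2 y a]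
    refine ((s.pull θ).cemb_strictMono c (θ' 0)).injective ?_
    refine ((s.pull θ).cemb_tr c (Fin.zero_le (θ' 0)) y).trans ?_
    refine (congrArg (s.tr h0) hy).trans ?_
    exact (s.tr_tr (Fin.zero_le (θ 0)) h0 i).trans h

theorem RWMod.map_comp_term (F : GamSurj ⥤ ModuleCat.{u} k) {l m n : ℕ}
    (θ : Fin (m + 1) →o Fin (n + 1)) (θ' : Fin (l + 1) →o Fin (m + 1)) (s : OneStr n)
    (v : F.obj ⟨s.dom⟩) (c : Fin ((s.str.pull θ).obj (Fin.last m)).card)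
    (d : Fin (((s.str.pull θ).component c).obj (θ' (Fin.last l))).card) :
    RWMod.of F ⟨(((s.str.pull θ).component c).pull θ').component d, Str.component_last _ _⟩
        ((F.map (((s.str.pull θ).component c).coeffMap θ' d)).hom
          ((F.map (s.str.coeffMap θ c)).hom v)) =
      RWMod.of F ⟨(s.str.pull (θ.comp θ')).component ((s.str.pull θ).cemb c (θ' (Fin.last l)) d),
        Str.component_last _ _⟩
        ((F.map (s.str.coeffMap (θ.comp θ')
          ((s.str.pull θ).cemb c (θ' (Fin.last l)) d))).hom v) := by
  have h := RWMod.of_congr F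
    (s := ⟨(((s.str.pull θ).component c).pull θ').component d, Str.component_last _ _⟩)
    (t := ⟨(s.str.pull (θ.comp θ')).component ((s.str.pull θ).cemb c (θ' (Fin.last l)) d),
      Str.component_last _ _⟩)
    (OneStr.ext ((s.str.pull θ).component_component θ' c d))
    (s.str.coeffMap θ c ≫ ((s.str.pull θ).component c).coeffMap θ' d)
    (s.str.coeffMap (θ.comp θ') ((s.str.pull θ).cemb c (θ' (Fin.last l)) d))
    (s.str.coeffMap_comp θ θ' c d) v
  rw [F.map_comp] at h
  exact h

theorem RWMod.map_comp (F : GamSurj ⥤ ModuleCat.{u} k) {l m n : ℕ}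
    (θ : Fin (m + 1) →o Fin (n + 1)) (θ' : Fin (l + 1) →o Fin (m + 1)) :
    RWMod.map F (θ.comp θ') = RWMod.map F θ' ∘ₗ RWMod.map F θ := by
  refine DirectSum.linearMap_ext k fun s => LinearMap.ext fun v => ?_
  change RWMod.map F (θ.comp θ') (RWMod.of F s v) = RWMod.map F θ' (RWMod.map F θ (RWMod.of F s v))
  have h1 : RWMod.map F (θ.comp θ') (RWMod.of F s v) =
      ∑ e : Fin ((s.str.pull θ).obj (θ' (Fin.last l))).card,
        RWMod.of F ⟨(s.str.pull (θ.comp θ')).component e, Str.component_last _ _⟩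
          ((F.map (s.str.coeffMap (θ.comp θ') e)).hom v) :=
    (RWMod.map_of F _ s v).trans (RWMod.mapOf_apply F _ s v)
  rw [h1, RWMod.map_of, RWMod.mapOf_apply, _root_.map_sum,
    ← Fintype.sum_bijective _ ((s.str.pull θ).bijective_cemb (θ' (Fin.last l))) _ _
      fun p => RWMod.map_comp_term F θ θ' s v p.1 p.2, Fintype.sum_sigma]
  exact Finset.sum_congr rfl fun c _ =>
    ((RWMod.map_of F θ' ⟨(s.str.pull θ).component c, Str.component_last _ _⟩
      ((F.map (s.str.coeffMap θ c)).hom v)).trans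
      (RWMod.mapOf_apply F θ' ⟨(s.str.pull θ).component c, Str.component_last _ _⟩
        ((F.map (s.str.coeffMap θ c)).hom v))).symm

/-- The simplicial `k`-module `n ↦ ⨁_{x ≥ 1} k[NΩ_n(x, 1)] ⊗ F[x]`. -/
def rwSimplicial (F : GamSurj ⥤ ModuleCat.{u} k) : SimplicialObject (ModuleCat.{u} k) where
  obj n := ModuleCat.of k (RWMod F n.unop.len)
  map θ := ModuleCat.ofHom (RWMod.map F θ.unop.toOrderHom)
  map_id n := by
    apply ModuleCat.hom_ext
    exact RWMod.map_id F n.unop.len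
  map_comp θ θ' := by
    apply ModuleCat.hom_ext
    exact RWMod.map_comp F θ.unop.toOrderHom θ'.unop.toOrderHom

/-- The associated chain complex, whose boundary map is the alternating sum of the faces. -/
def rwComplex (F : GamSurj ⥤ ModuleCat.{u} k) : ChainComplex (ModuleCat.{u} k) ℕ :=
  (AlgebraicTopology.alternatingFaceMapComplex (ModuleCat.{u} k)).obj (rwSimplicial F)

/-- The map of simplicial modules induced by a natural transformation `F ⟶ G`. -/
def rwSimplicialMap {F G : GamSurj ⥤ ModuleCat.{u} k} (η : F ⟶ G) :
    rwSimplicial F ⟶ rwSimplicial G where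
  app n := ModuleCat.ofHom (DirectSum.lmap fun s : OneStr n.unop.len => (η.app ⟨s.dom⟩).hom)
  naturality {n m} θ := by
    apply ModuleCat.hom_ext
    refine DirectSum.linearMap_ext k fun s => LinearMap.ext fun v => ?_
    have hof : ∀ {j : ℕ} (t : OneStr j) w,
        DirectSum.lmap (fun s : OneStr j => (η.app ⟨s.dom⟩).hom) (RWMod.of F t w) =
          RWMod.of G t ((η.app ⟨t.dom⟩).hom w) := fun t w =>
      DirectSum.lmap_lof (fun s : OneStr _ => (η.app ⟨s.dom⟩).hom) t w
    change DirectSum.lmap (fun s : OneStr m.unop.len => (η.app ⟨s.dom⟩).hom)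
        (RWMod.map F θ.unop.toOrderHom (RWMod.of F s v)) =
      RWMod.map G θ.unop.toOrderHom
        (DirectSum.lmap (fun s : OneStr n.unop.len => (η.app ⟨s.dom⟩).hom) (RWMod.of F s v))
    rw [hof, RWMod.map_of, RWMod.map_of, RWMod.mapOf_apply, RWMod.mapOf_apply, _root_.map_sum]
    refine Finset.sum_congr rfl fun c _ => ?_
    rw [hof]
    congr 1
    exact NatTrans.naturality_apply η _ v

/-- The chain map induced by a natural transformation `F ⟶ G`. -/
def rwComplexMap {F G : GamSurj ⥤ ModuleCat.{u} k} (η : F ⟶ G) : rwComplex F ⟶ rwComplex G :=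
  (AlgebraicTopology.alternatingFaceMapComplex (ModuleCat.{u} k)).map (rwSimplicialMap η)

end RobinsonWhitehouse

/-! ### `Γ`-homology -/

section GammaHomologyDef

variable (k : Type u) [CommRing k]

/-- The based functions `[n] → k`, where `k` is based at `0`. -/
def basedFun (p : Gam) : Submodule k (Fin (p.size + 1) → k) where
  carrier := {φ | φ 0 = 0}
  add_mem' {φ ψ} hφ hψ := by
    change φ 0 + ψ 0 = 0
    rw [show φ 0 = 0 from hφ, show ψ 0 = 0 from hψ, add_zero]
  zero_mem' := rfl
  smul_mem' c φ hφ := by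
    change c • φ 0 = 0
    rw [show φ 0 = 0 from hφ, smul_zero]

/-- The right `Γ`-module `t = Hom_{Set_*}(-, k)`. -/
def basedCochains : Gamᵒᵖ ⥤ ModuleCat.{u} k where
  obj p := ModuleCat.of k (basedFun k p.unop)
  map {p q} f := ModuleCat.ofHom
    ((LinearMap.funLeft k k f.unop.1).restrict (p := basedFun k p.unop) (q := basedFun k q.unop)
      fun φ hφ => by
        change φ (f.unop.1 0) = 0
        rw [f.unop.2]
        exact hφ)

/-- The `Γ`-homology `HΓ_n(A, M) = Tor_n^Γ(t, L(A, M))`. -/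
def HGamma (A M : Type u) [CommRing A] [Algebra k A] [AddCommGroup M] [Module k M] [Module A M]
    [IsScalarTower k A M] (n : ℕ) : ModuleCat.{u} k :=
  functorTor (basedCochains k) n (loday k A M)

end GammaHomologyDef

/-! ### The complexes `CΓ(A, M)` and `CΓ(I, M)` and the pruning map -/

section Pruning

variable {k : Type u} [CommRing k] {A : Type u} [CommRing A] [Algebra k A] (ε : A →ₐ[k] k)
variable (M : Type u) [AddCommGroup M] [Module k M] [Module A M] [IsScalarTower k A M]

variable (k A) in
/-- The Robinson-Whitehouse complex `CΓ(A, M)`. -/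
def CGamma : ChainComplex (ModuleCat.{u} k) ℕ := rwComplex (GamSurj.incl ⋙ loday k A M)

/-- The complex `CΓ(I, M)`, where `I` is the augmentation ideal. -/
def CGammaIdeal : ChainComplex (ModuleCat.{u} k) ℕ := rwComplex (lodayIdeal k M (RingHom.ker ε))

/-- The inclusion `CΓ(I, M) → CΓ(A, M)`. -/
def CGammaIncl : CGammaIdeal ε M ⟶ CGamma k A M :=
  rwComplexMap (lodayIdealIncl k M (RingHom.ker ε))

/-- The projection `A → I`, `a ↦ a - ε(a)`. -/
def augProj : A →ₗ[k] RingHom.ker ε where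
  toFun a := ⟨a - algebraMap k A (ε a), by simp [RingHom.mem_ker]⟩
  map_add' a b := Subtype.ext (by simp; ring)
  map_smul' c a := Subtype.ext (by
    simp [Algebra.smul_def, mul_sub])

/-- For `L ⊆ {1, …, x}`, the linear map `A^{⊗ x} → I^{⊗ |L|}` with
`a_1 ⊗ ⋯ ⊗ a_x ↦ (∏_{i ∉ L} ε(a_i)) • ⨂_{i ∈ L} (a_i - ε(a_i))`. -/
def pruneTensor {x : ℕ} (L : Finset (Fin x)) :
    (⨂[k] _ : Fin x, A) →ₗ[k] (⨂[k] _ : Fin L.card, RingHom.ker ε) :=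
  PiTensorProduct.lift
    ((TensorProduct.rid k (⨂[k] _ : Fin L.card, RingHom.ker ε)).toLinearMap.compMultilinearMap
      ((((PiTensorProduct.tprod k).compLinearMap fun _ : Fin L.card => augProj ε).domCoprod
          ((MultilinearMap.mkPiAlgebra k (Fin Lᶜ.card) k).compLinearMap
            fun _ => ε.toLinearMap)).domDomCongr
        (finSumEquivOfFinset (s := L) rfl rfl)))

theorem pruneTensor_tprod {x : ℕ} (L : Finset (Fin x)) (a : Fin x → A) :
    pruneTensor ε L (PiTensorProduct.tprod k a) =
      (∏ i ∈ Lᶜ, ε (a i)) • PiTensorProduct.tprod k fun j => augProj ε (a (emb L j)) := by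
  have h : ∏ i ∈ Lᶜ, ε (a i) = ∏ j : Fin Lᶜ.card, ε (a (Lᶜ.orderEmbOfFin rfl j)) := by
    refine Eq.trans ?_ (Finset.prod_map Finset.univ (Lᶜ.orderEmbOfFin rfl).toEmbedding
      (fun i => ε (a i)))
    rw [Finset.map_orderEmbOfFin_univ]
  rw [h, pruneTensor, PiTensorProduct.lift.tprod]
  simp [MultilinearMap.domCoprod_apply]

/-- The pruning map on the summand of a string. As every element of `A` is the sum of an element
of `I` and a multiple of `1`, a tensor `a_1 ⊗ ⋯ ⊗ a_x` is the sum over all `L ⊆ {1, …, x}` of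
`∏_{i ∉ L} ε(a_i)` times the basic tensor with the factors `a_i - ε(a_i)` for `i ∈ L` and `1` for
`i ∉ L`. The string of the basic tensor that belongs to `L ≠ ∅` is pruned along `L` and
its trivial factors are omitted; the basic tensor `1 ⊗ ⋯ ⊗ 1` that belongs to `L = ∅` is sent
to `0`. -/
def pruneOf {n : ℕ} (s : OneStr n) :
    ((⨂[k] _ : Fin s.dom, A) ⊗[k] M) →ₗ[k] RWMod (lodayIdeal k M (RingHom.ker ε)) n :=
  ∑ L : {L : Finset (Fin s.dom) // L.Nonempty},
    RWMod.of (lodayIdeal k M (RingHom.ker ε))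
        ⟨s.str.prune L.1 L.2, s.str.prune_last L.1 L.2 s.card_last⟩ ∘ₗ
      TensorProduct.map (pruneTensor ε (s.str.img L.1 0)) (LinearMap.id : M →ₗ[k] M)

/-- The pruning map in degree `n`. -/
def pruneMap (n : ℕ) :
    RWMod (GamSurj.incl ⋙ loday k A M) n →ₗ[k] RWMod (lodayIdeal k M (RingHom.ker ε)) n :=
  DirectSum.toModule k (OneStr n) _ fun s => pruneOf ε M s

theorem pruneMap_of {n : ℕ} (s : OneStr n) (a : Fin s.dom → A) (m : M) :
    pruneMap ε M n (RWMod.of (GamSurj.incl ⋙ loday k A M) s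
        (PiTensorProduct.tprod k a ⊗ₜ[k] m)) =
      ∑ L : {L : Finset (Fin s.dom) // L.Nonempty},
        RWMod.of (lodayIdeal k M (RingHom.ker ε))
          ⟨s.str.prune L.1 L.2, s.str.prune_last L.1 L.2 s.card_last⟩
          (pruneTensor ε (s.str.img L.1 0) (PiTensorProduct.tprod k a) ⊗ₜ[k] m) := by
  have h : pruneMap ε M n (RWMod.of (GamSurj.incl ⋙ loday k A M) s
      (PiTensorProduct.tprod k a ⊗ₜ[k] m)) = pruneOf ε M s (PiTensorProduct.tprod k a ⊗ₜ[k] m) :=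
    DirectSum.toModule_lof (R := k)
      (M := fun s : OneStr n => (GamSurj.incl ⋙ loday k A M).obj ⟨s.dom⟩)
      (φ := fun s => pruneOf ε M s) s _
  rw [h, pruneOf, LinearMap.sum_apply]
  rfl

theorem augProj_one : augProj ε 1 = 0 := by
  apply Subtype.ext
  simp [augProj]

theorem augProj_of_mem {a : A} (ha : a ∈ RingHom.ker ε) : augProj ε a = ⟨a, ha⟩ := by
  apply Subtype.ext
  simp [augProj, (RingHom.mem_ker).1 ha]

/-- On a basic tensor whose set of non-trivial factors is `L`, only the summand of `L`
contributes. -/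
theorem pruneTensor_basic_ne {x : ℕ} {L L' : Finset (Fin x)} (h : L' ≠ L) (a : Fin x → A)
    (hL : ∀ i ∈ L, a i ∈ RingHom.ker ε) (hL' : ∀ i ∉ L, a i = 1) :
    pruneTensor ε L' (PiTensorProduct.tprod k a) = 0 := by
  rw [pruneTensor_tprod]
  by_cases hs : L ⊆ L'
  · obtain ⟨i, hi, hi'⟩ := Finset.exists_of_ssubset (hs.ssubset_of_ne h.symm)
    rw [(PiTensorProduct.tprod k).map_coord_zero (idx L' i hi), smul_zero]
    rw [emb_idx, hL' i hi', augProj_one]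
  · obtain ⟨i, hi, hi'⟩ := Finset.not_subset.1 hs
    rw [Finset.prod_eq_zero (Finset.mem_compl.2 hi') ((RingHom.mem_ker).1 (hL i hi)), zero_smul]

theorem Str.img_zero {n : ℕ} (s : Str n) (L : Finset (Fin (s.obj 0).card)) : s.img L 0 = L := by
  ext a
  simp [Str.img]

/-- The pruning map on basic tensors: if `a_i ∈ I` for `i ∈ L ≠ ∅` and `a_i = 1` for `i ∉ L`,
then `[f_n | ⋯ | f_1] ⊗ (a_1 ⊗ ⋯ ⊗ a_x) ⊗ m` is sent to the element with the pruned string and the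
tensor factors `a_i` for `i ∈ L`. -/
theorem pruneMap_basic {n : ℕ} (s : OneStr n) (L : Finset (Fin s.dom)) (hne : L.Nonempty)
    (a : Fin s.dom → A) (hL : ∀ i ∈ L, a i ∈ RingHom.ker ε) (hL' : ∀ i ∉ L, a i = 1) (m : M) :
    pruneMap ε M n (RWMod.of (GamSurj.incl ⋙ loday k A M) s
        (PiTensorProduct.tprod k a ⊗ₜ[k] m)) =
      RWMod.of (lodayIdeal k M (RingHom.ker ε))
        ⟨s.str.prune L hne, s.str.prune_last L hne s.card_last⟩
        ((PiTensorProduct.tprod k fun j => ⟨a (emb (s.str.img L 0) j),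
          hL _ ((Finset.ext_iff.1 (s.str.img_zero L) _).1 (emb_mem _ j))⟩) ⊗ₜ[k] m) := by
  have h : pruneTensor ε (s.str.img L 0) (PiTensorProduct.tprod k a) =
      PiTensorProduct.tprod k fun j => ⟨a (emb (s.str.img L 0) j),
        hL _ ((Finset.ext_iff.1 (s.str.img_zero L) _).1 (emb_mem _ j))⟩ := by
    rw [pruneTensor_tprod, Finset.prod_eq_one, one_smul]
    · congr 1
      funext j
      exact augProj_of_mem ε _
    · intro i hi
      rw [s.str.img_zero, Finset.mem_compl] at hi
      rw [hL' i hi, map_one]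
  rw [pruneMap_of, Finset.sum_eq_single ⟨L, hne⟩, h]
  · rfl
  · intro L' _ hL''
    rw [pruneTensor_basic_ne ε (L := L) _ a hL hL']
    · exact (congrArg _ (TensorProduct.zero_tmul _ m)).trans (map_zero _)
    · rw [s.str.img_zero]
      exact fun h' => hL'' (Subtype.ext h')
  · exact fun h' => (h' (Finset.mem_univ _)).elim

/-- The pruning map sends the basic tensor all of whose factors are trivial to `0`. -/
theorem pruneMap_one {n : ℕ} (s : OneStr n) (m : M) :
    pruneMap ε M n (RWMod.of (GamSurj.incl ⋙ loday k A M) s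
      ((PiTensorProduct.tprod k fun _ => (1 : A)) ⊗ₜ[k] m)) = 0 := by
  refine (pruneMap_of ε M s (fun _ => 1) m).trans (Finset.sum_eq_zero fun L _ => ?_)
  rw [pruneTensor_basic_ne ε (L := ∅)]
  · exact (congrArg _ (TensorProduct.zero_tmul _ m)).trans (map_zero _)
  · rw [s.str.img_zero]
    exact L.2.ne_empty
  · simp
  · simp

/-- The pruning map in degree `n`, as a morphism from `CΓ_n(A, M)` to `CΓ_n(I, M)`. -/
def pruning (n : ℕ) : (CGamma k A M).X n ⟶ (CGammaIdeal ε M).X n :=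
  ModuleCat.ofHom (pruneMap ε M n)

end Pruning

end GammaHomology

end

noncomputable section

namespace GammaHomology

/-! ### Forests -/

section Forests

variable {k : Type u} [CommRing k]

/-! A string x_0 → ⋯ → x_n of surjections is a forest with leaves x_0 and roots x_n; the strings
that end at {1} are the trees. All simplicial operators then have one form: push the coefficient to
x_{θ(0)}, pull the forest back along θ, and sum over the trees of the result
(`RWMod.map_of_eq_forest`).

Pruning is tested on basic tensors, which span because every element of A is an element of I plus a
multiple of 1 (`tensor_ext_basic`). A product over a fibre lies in I if the fibre meets L and is 1
otherwise, so pushing a basic tensor forward gives a basic tensor supported on the image of L, and a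
tree that L misses carries only trivial factors and is killed. Hence pruning commutes with every
simplicial operator (`pruneMap_map`). Tensors of elements of I are basic with L everything, so
pruning retracts the inclusion. The split epimorphism decomposes the complex, and its homology with
it.

It remains to identify the homology of the complex with Tor, which is done for every Γ-module F
(`nonempty_functorTor_iso`). The complex is exact in F (`shortExact_rwFunctor`), its degree zero
homology is t ⊗ F (`homologyZeroIso`), and its positive homology vanishes on projectives
(`isZero_homology_rwFunctor`). Dimension shifting along a projective resolution
(`nonempty_leftDerived_iso`) then gives the derived functors.

The vanishing comes from two homotopies made by gluing forests. A monotone map χ from {0, …, n} to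
{0, 1} cuts a string in two: where χ is 0 a second forest stands beside the string, where χ is 1 it
has merged into it. Let b be induced by the zero maps of Γ. Gluing a second copy of the string
yields a homotopy between b + 1 and 1, so b is zero on homology (`homologyMap_basepointMap`). For a
free Γ-module, gluing paths that start at the values of a basis element yields a homotopy between
the identity and b plus a map that factors through a constant simplicial module
(`sproutingHomotopy`). Constant simplicial modules have no positive homology, so neither has a free
Γ-module, nor a projective one, being a retract of a free one. -/

theorem GamSurj.hom_ext_succ {p : GamSurj} {x : ℕ} (φ ψ : p ⟶ ⟨x⟩)
    (H : ∀ (i : Fin p.size) (a : Fin x), φ.1 i.succ = a.succ ↔ ψ.1 i.succ = a.succ) : φ = ψ :=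
  Subtype.ext <| funext fun i => Fin.ext <|
    GamSurj.hom_ext_val rfl φ ψ (fun i a b hab => by obtain rfl := Fin.ext hab; exact H i a) i

theorem Gam.hom_ext_succ {p : Gam} {x : ℕ} (φ ψ : p ⟶ ⟨x⟩)
    (H : ∀ (i : Fin p.size) (a : Fin x), φ.1 i.succ = a.succ ↔ ψ.1 i.succ = a.succ) : φ = ψ := by
  refine Subtype.ext <| funext <| Fin.cases (by rw [φ.2, ψ.2]) fun i => ?_
  by_cases h : φ.1 i.succ = 0
  · rw [h]
    by_contra h'
    obtain ⟨b, hb⟩ := Fin.exists_succ_eq.2 (Ne.symm h')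
    exact Fin.succ_ne_zero b (((H i b).2 hb.symm).symm.trans h)
  · obtain ⟨b, hb⟩ := Fin.exists_succ_eq.2 h
    rw [← hb, (H i b).1 hb.symm]

/-- The basepoint-preserving retraction of an injection, which sends the elements outside of the
range to the basepoint. -/
def GamSurj.pinch {a b : ℕ} (e : Fin a → Fin b) (he : Function.Injective e) :
    (⟨b⟩ : GamSurj) ⟶ ⟨a⟩ := by
  classical
  exact ⟨Fin.cases 0 fun i => if h : ∃ j, e j = i then h.choose.succ else 0, rfl, fun j => by
    refine Fin.cases ⟨0, rfl⟩ (fun j => ?_) j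
    refine ⟨(e j).succ, ?_⟩
    have h : ∃ j', e j' = e j := ⟨j, rfl⟩
    simp only [Fin.cases_succ, dif_pos h]
    rw [he h.choose_spec]⟩

theorem GamSurj.pinch_eq_succ {a b : ℕ} (e : Fin a → Fin b) (he : Function.Injective e)
    (i : Fin b) (j : Fin a) : (GamSurj.pinch e he).1 i.succ = j.succ ↔ i = e j := by
  classical
  change (if h : ∃ j, e j = i then h.choose.succ else 0) = j.succ ↔ _
  split_ifs with h
  · rw [Fin.succ_inj]
    constructor
    · intro h'
      rw [← h', h.choose_spec]
    · intro h'
      exact he (h.choose_spec.trans h')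
  · exact ⟨fun h' => (Fin.succ_ne_zero j h'.symm).elim, fun h' => (h ⟨j, h'.symm⟩).elim⟩

theorem GamSurj.pinch_apply {a b : ℕ} (e : Fin a → Fin b) (he : Function.Injective e)
    (j : Fin a) : (GamSurj.pinch e he).1 (e j).succ = j.succ :=
  (GamSurj.pinch_eq_succ e he _ _).2 rfl

/-- The composite of a map with a map to `{0, …, y}`, in terms of non-basepoints. -/
theorem GamSurj.comp_eq_succ {p q r : GamSurj} (f : p ⟶ q) (g : q ⟶ r) (i : Fin p.size)
    (a : Fin r.size) : (f ≫ g).1 i.succ = a.succ ↔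
      ∃ b : Fin q.size, f.1 i.succ = b.succ ∧ g.1 b.succ = a.succ := by
  change g.1 (f.1 i.succ) = a.succ ↔ _
  constructor
  · intro h
    have hne : f.1 i.succ ≠ 0 := by
      intro h'
      rw [h', g.2.1] at h
      exact Fin.succ_ne_zero a h.symm
    obtain ⟨b, hb⟩ := Fin.exists_succ_eq.2 hne
    exact ⟨b, hb.symm, hb ▸ h⟩
  · rintro ⟨b, hb, hb'⟩
    rw [hb, hb']

theorem Gam.comp_eq_succ {p q r : Gam} (f : p ⟶ q) (g : q ⟶ r) (i : Fin p.size)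
    (a : Fin r.size) : (f ≫ g).1 i.succ = a.succ ↔
      ∃ b : Fin q.size, f.1 i.succ = b.succ ∧ g.1 b.succ = a.succ := by
  change g.1 (f.1 i.succ) = a.succ ↔ _
  constructor
  · intro h
    have hne : f.1 i.succ ≠ 0 := by
      intro h'
      rw [h', g.2] at h
      exact Fin.succ_ne_zero a h.symm
    obtain ⟨b, hb⟩ := Fin.exists_succ_eq.2 hne
    exact ⟨b, hb.symm, hb ▸ h⟩
  · rintro ⟨b, hb, hb'⟩
    rw [hb, hb']

/-- The map of a string between the sets at two positions, as a morphism of `GamSurj`. -/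
abbrev Str.trHom {n : ℕ} (s : Str n) {i j : Fin (n + 1)} (h : i ≤ j) :
    (⟨(s.obj i).card⟩ : GamSurj) ⟶ ⟨(s.obj j).card⟩ :=
  GamSurj.ofSurj (s.tr h) (s.tr_surjective h)

/-- The map `x_0 → x_{θ(0)}` of a string, as a map to the first set of the pullback along `θ`. -/
def Str.pullHom {m n : ℕ} (s : Str n) (θ : Fin (m + 1) →o Fin (n + 1)) :
    (⟨(s.obj 0).card⟩ : GamSurj) ⟶ ⟨((s.pull θ).obj 0).card⟩ :=
  s.trHom (Fin.zero_le (θ 0))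

theorem Str.pullHom_eq_succ {m n : ℕ} (s : Str n) (θ : Fin (m + 1) →o Fin (n + 1))
    (a : Fin (s.obj 0).card) (b : Fin ((s.pull θ).obj 0).card) :
    (s.pullHom θ).1 a.succ = b.succ ↔ s.tr (Fin.zero_le (θ 0)) a = b := Fin.succ_inj

theorem Str.pullHom_id {n : ℕ} (s : Str n) : s.pullHom OrderHom.id = 𝟙 _ :=
  GamSurj.hom_ext_succ _ _ fun i a => by
    refine (s.pullHom_eq_succ _ i a).trans ?_
    rw [show s.tr (Fin.zero_le ((OrderHom.id : Fin (n + 1) →o Fin (n + 1)) 0)) i = i from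
      s.tr_self _ i]
    exact Fin.succ_inj.symm

/-- The map that collapses the complement of a component to the basepoint. -/
def Str.collapse {n : ℕ} (s : Str n) (c : Fin (s.obj (Fin.last n)).card) :
    (⟨(s.obj 0).card⟩ : GamSurj) ⟶ ⟨((s.component c).obj 0).card⟩ :=
  GamSurj.collapse (s.fiber c 0)

theorem Str.collapse_eq_succ {n : ℕ} (s : Str n) (c : Fin (s.obj (Fin.last n)).card)
    (i : Fin (s.obj 0).card) (a : Fin ((s.component c).obj 0).card) :
    (s.collapse c).1 i.succ = a.succ ↔ i = s.cemb c 0 a :=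
  GamSurj.collapse_eq_succ (s.fiber c 0) i a

/-- The string with one tree that is a component of a forest. -/
abbrev Str.tree {n : ℕ} (s : Str n) (c : Fin (s.obj (Fin.last n)).card) : OneStr n :=
  ⟨s.component c, s.component_last c⟩

/-- The sum of the components of a forest `x_0 → ⋯ → x_n`, with the coefficients obtained from an
element of `F[x_0]` by collapsing the complements of the components. -/
def RWMod.forest (F : GamSurj ⥤ ModuleCat.{u} k) {n : ℕ} (t : Str n) :
    F.obj ⟨(t.obj 0).card⟩ →ₗ[k] RWMod F n :=
  ∑ c : Fin (t.obj (Fin.last n)).card, RWMod.of F (t.tree c) ∘ₗ (F.map (t.collapse c)).hom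

theorem RWMod.forest_apply (F : GamSurj ⥤ ModuleCat.{u} k) {n : ℕ} (t : Str n)
    (v : F.obj ⟨(t.obj 0).card⟩) : RWMod.forest F t v =
      ∑ c : Fin (t.obj (Fin.last n)).card,
        RWMod.of F (t.tree c) ((F.map (t.collapse c)).hom v) := by
  rw [RWMod.forest, LinearMap.sum_apply]
  rfl

theorem GamSurj.map_comp_apply (F : GamSurj ⥤ ModuleCat.{u} k) {p q r : GamSurj} (f : p ⟶ q)
    (g : q ⟶ r) (v : F.obj p) : (F.map g).hom ((F.map f).hom v) = (F.map (f ≫ g)).hom v := by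
  rw [F.map_comp]
  rfl

/-- `Str.coeffMap` is by definition a push to x_{θ(0)} followed by a collapse onto one component.
Separating the two leaves a sum over components that no longer refers to θ. -/
theorem RWMod.mapOf_eq_forest (F : GamSurj ⥤ ModuleCat.{u} k) {m n : ℕ}
    (θ : Fin (m + 1) →o Fin (n + 1)) (s : OneStr n) (v : F.obj ⟨s.dom⟩) :
    RWMod.mapOf F θ s v = RWMod.forest F (s.str.pull θ) ((F.map (s.str.pullHom θ)).hom v) := by
  rw [RWMod.mapOf_apply, RWMod.forest_apply]
  refine Finset.sum_congr rfl fun c _ => ?_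
  rw [GamSurj.map_comp_apply]
  rfl

/-- A tree is its own only component. This is read off from the operator of the identity, which is
already known to be the identity. -/
theorem RWMod.forest_of_last (F : GamSurj ⥤ ModuleCat.{u} k) {n : ℕ} (s : OneStr n)
    (v : F.obj ⟨s.dom⟩) : RWMod.forest F s.str v = RWMod.of F s v := by
  have h := RWMod.mapOf_eq_forest F OrderHom.id s v
  rw [← RWMod.map_of, RWMod.map_id] at h
  refine Eq.trans ?_ h.symm
  have h1 := congrArg (fun φ => RWMod.forest F s.str ((F.map φ).hom v)) s.str.pullHom_id
  refine Eq.trans ?_ h1.symm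
  change _ = RWMod.forest F s.str ((F.map (𝟙 _)).hom v)
  rw [F.map_id]
  rfl

/-- A forest is the sum of disjoint sub-forests that are closed under preimages and
contain all roots. -/
theorem RWMod.forest_eq_sum (F : GamSurj ⥤ ModuleCat.{u} k) {n : ℕ} {ι : Type*} [Fintype ι]
    (G : Str n) (t : ι → Str n) (e : ∀ c j, Fin ((t c).obj j).card → Fin (G.obj j).card)
    (he : ∀ c j, StrictMono (e c j))
    (hes : ∀ c i j (h : i ≤ j) a, e c j ((t c).tr h a) = G.tr h (e c i a))
    (hcl : ∀ c j g a, G.tr (Fin.le_last j) g = e c (Fin.last n) a → g ∈ Set.range (e c j))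
    (hb : Function.Bijective fun p : Σ c, Fin ((t c).obj (Fin.last n)).card =>
      e p.1 (Fin.last n) p.2) (v : F.obj ⟨(G.obj 0).card⟩) :
    RWMod.forest F G v = ∑ c, RWMod.forest F (t c)
      ((F.map (GamSurj.pinch (e c 0) (he c 0).injective)).hom v) := by
  have key : ∀ p : Σ c, Fin ((t c).obj (Fin.last n)).card,
      RWMod.of F ((t p.1).tree p.2) ((F.map ((t p.1).collapse p.2)).hom
          ((F.map (GamSurj.pinch (e p.1 0) (he p.1 0).injective)).hom v)) =
      RWMod.of F (G.tree (e p.1 (Fin.last n) p.2))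
        ((F.map (G.collapse (e p.1 (Fin.last n) p.2))).hom v) := by
    rintro ⟨c, d⟩
    -- Closure under preimages makes the tree of `t c` over the root d the full tree of G over the
    -- image of d.
    have hr : ∀ j, Set.range (fun a => e c j ((t c).cemb d j a)) =
        Set.range (G.cemb (e c (Fin.last n) d) j) := by
      intro j
      rw [G.range_cemb]
      ext g
      constructor
      · rintro ⟨a, rfl⟩
        change G.tr _ _ = _
        rw [← hes, (t c).tr_cemb]
      · intro hg
        obtain ⟨a, rfl⟩ := hcl c j g d hg
        have h1 : (t c).tr (Fin.le_last j) a = d :=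
          (he c _).injective ((hes c _ _ _ a).trans hg)
        have h2 : a ∈ Set.range ((t c).cemb d j) := by rw [(t c).range_cemb]; exact h1
        obtain ⟨a', rfl⟩ := h2
        exact ⟨a', rfl⟩
    have hs : (t c).component d = G.component (e c (Fin.last n) d) :=
      Str.eq_of_emb G _ _ (fun j a => e c j ((t c).cemb d j a))
        (fun j => (he c j).comp ((t c).cemb_strictMono d j))
        (fun i j h a => by
          rw [(t c).cemb_tr d h a, hes])
        (G.cemb (e c (Fin.last n) d)) (G.cemb_strictMono _) (fun _ _ h a => G.cemb_tr _ h a) hr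
    have h0 := (strictMono_unique ((he c 0).comp ((t c).cemb_strictMono d 0))
      (G.cemb_strictMono (e c (Fin.last n) d) 0) (hr 0)).2
    refine (congrArg _ (GamSurj.map_comp_apply F _ _ v)).trans
      (RWMod.of_congr F (s := (t c).tree d) (t := G.tree (e c (Fin.last n) d)) (OneStr.ext hs)
      (GamSurj.pinch (e c 0) (he c 0).injective ≫ (t c).collapse d)
      (G.collapse (e c (Fin.last n) d)) ?_ v)
    refine GamSurj.hom_ext_val (p := ⟨(G.obj 0).card⟩)
      (congrArg (fun t : Str n => (t.obj 0).card) hs) _ _ fun i a b hab => ?_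
    refine (GamSurj.comp_eq_succ (GamSurj.pinch (e c 0) (he c 0).injective)
      ((t c).collapse d) i a).trans ?_
    refine Iff.trans ?_ (G.collapse_eq_succ _ i b).symm
    rw [← h0 a b hab]
    constructor
    · rintro ⟨y, hy, hy'⟩
      rw [(GamSurj.pinch_eq_succ _ _ _ _).1 hy, ((t c).collapse_eq_succ d y a).1 hy']
      rfl
    · rintro rfl
      exact ⟨_, GamSurj.pinch_apply _ _ _, ((t c).collapse_eq_succ d _ a).2 rfl⟩
  -- The bijection on roots matches the trees of G with all the trees of all the sub-forests.
  rw [RWMod.forest_apply, ← Fintype.sum_bijective _ hb _ _ key, Fintype.sum_sigma]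
  exact Finset.sum_congr rfl fun c _ => (RWMod.forest_apply F (t c)
    ((F.map (GamSurj.pinch (e c 0) (he c 0).injective)).hom v)).symm

/-- The inclusion of the pullback of a component. -/
def Str.pemb {m n : ℕ} (s : Str n) (θ : Fin (m + 1) →o Fin (n + 1))
    (c : Fin (s.obj (Fin.last n)).card) (j : Fin (m + 1)) :
    Fin (((s.component c).pull θ).obj j).card → Fin ((s.pull θ).obj j).card :=
  s.cemb c (θ j)

theorem Str.pemb_strictMono {m n : ℕ} (s : Str n) (θ : Fin (m + 1) →o Fin (n + 1))
    (c : Fin (s.obj (Fin.last n)).card) (j : Fin (m + 1)) : StrictMono (s.pemb θ c j) :=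
  s.cemb_strictMono c (θ j)

/-- The operator of a monotone map on the sum of the components of a forest. -/
theorem RWMod.map_forest (F : GamSurj ⥤ ModuleCat.{u} k) {m n : ℕ}
    (θ : Fin (m + 1) →o Fin (n + 1)) (t : Str n) (v : F.obj ⟨(t.obj 0).card⟩) :
    RWMod.map F θ (RWMod.forest F t v) =
      RWMod.forest F (t.pull θ) ((F.map (t.pullHom θ)).hom v) := by
  -- The pullback of a tree need not be a tree, since θ may omit the root; the pullbacks of the
  -- components are still disjoint sub-forests that exhaust the pullback of t.
  have hE := RWMod.forest_eq_sum F (t.pull θ) (fun c => (t.component c).pull θ)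
    (t.pemb θ) (t.pemb_strictMono θ)
    (fun c i j h a => t.cemb_tr c (θ.monotone h) a)
    (fun c j g a h => by
      refine (Set.ext_iff.1 (t.range_cemb c (θ j)) g).2 ?_
      change t.tr _ g = c
      refine (t.tr_tr (θ.monotone (Fin.le_last j)) (Fin.le_last _) g).symm.trans ?_
      exact (congrArg (t.tr (Fin.le_last _)) h).trans (t.tr_cemb c _ a))
    (t.bijective_cemb (θ (Fin.last m))) ((F.map (t.pullHom θ)).hom v)
  rw [hE, RWMod.forest_apply, _root_.map_sum]
  refine Finset.sum_congr rfl fun c _ => ?_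
  -- Collapsing and pushing commute: a leaf lies in the component of c exactly when its image in
  -- x_{θ(0)} does.
  have h : t.collapse c ≫ (t.component c).pullHom θ =
      t.pullHom θ ≫ GamSurj.pinch (t.pemb θ c 0) (t.pemb_strictMono θ c 0).injective := by
    refine GamSurj.hom_ext_succ _ _ fun i a => ?_
    rw [GamSurj.comp_eq_succ, GamSurj.comp_eq_succ]
    constructor
    · rintro ⟨b, hb, hb'⟩
      have h1 := (t.collapse_eq_succ c i b).1 hb
      have h2 := ((t.component c).pullHom_eq_succ θ b a).1 hb'
      refine ⟨t.tr (Fin.zero_le (θ 0)) i, rfl, (GamSurj.pinch_eq_succ _ _ _ _).2 ?_⟩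
      rw [h1, ← h2]
      exact (t.cemb_tr c (Fin.zero_le (θ 0)) b).symm
    · rintro ⟨b, hb, hb'⟩
      have h1 := (t.pullHom_eq_succ θ i b).1 hb
      have h2 := (GamSurj.pinch_eq_succ _ _ _ _).1 hb'
      have h3 : i ∈ Set.range (t.cemb c 0) := by
        rw [t.range_cemb]
        change t.tr _ i = c
        rw [← t.tr_tr (Fin.zero_le (θ 0)) (Fin.le_last _), h1, h2]
        exact t.tr_cemb c _ a
      obtain ⟨y, rfl⟩ := h3
      refine ⟨y, (t.collapse_eq_succ c _ y).2 rfl,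
        ((t.component c).pullHom_eq_succ θ y a).2 ((t.cemb_strictMono c _).injective ?_)⟩
      exact (t.cemb_tr c (Fin.zero_le (θ 0)) y).trans (h1.trans h2)
  refine (RWMod.map_of F θ (t.tree c) _).trans ((RWMod.mapOf_eq_forest F θ (t.tree c) _).trans ?_)
  refine congrArg (RWMod.forest F ((t.component c).pull θ)) ?_
  refine (GamSurj.map_comp_apply F (t.collapse c) ((t.component c).pullHom θ) v).trans ?_
  rw [h, GamSurj.map_comp_apply]

theorem RWMod.map_of_eq_forest (F : GamSurj ⥤ ModuleCat.{u} k) {m n : ℕ}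
    (θ : Fin (m + 1) →o Fin (n + 1)) (s : OneStr n) (v : F.obj ⟨s.dom⟩) :
    RWMod.map F θ (RWMod.of F s v) =
      RWMod.forest F (s.str.pull θ) ((F.map (s.str.pullHom θ)).hom v) :=
  (RWMod.map_of F θ s v).trans (RWMod.mapOf_eq_forest F θ s v)

end Forests

end GammaHomology

end

noncomputable section

namespace GammaHomology

/-! ### The pruning map is a chain map -/

section PruningChainMap

/-- The inclusion of a pruned string. -/
def Str.remb {n : ℕ} (s : Str n) (L : Finset (Fin (s.obj 0).card)) (hL : L.Nonempty)
    (j : Fin (n + 1)) : Fin ((s.prune L hL).obj j).card → Fin (s.obj j).card :=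
  emb (s.img L j)

theorem Str.remb_strictMono {n : ℕ} (s : Str n) (L : Finset (Fin (s.obj 0).card))
    (hL : L.Nonempty) (j : Fin (n + 1)) : StrictMono (s.remb L hL j) :=
  (emb (s.img L j)).strictMono

theorem Str.remb_tr {n : ℕ} (s : Str n) (L : Finset (Fin (s.obj 0).card)) (hL : L.Nonempty)
    {i j : Fin (n + 1)} (h : i ≤ j) (a : Fin ((s.prune L hL).obj i).card) :
    s.remb L hL j ((s.prune L hL).tr h a) = s.tr h (s.remb L hL i a) :=
  emb_idx _ _ _

theorem Str.range_remb {n : ℕ} (s : Str n) (L : Finset (Fin (s.obj 0).card)) (hL : L.Nonempty)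
    (j : Fin (n + 1)) : Set.range (s.remb L hL j) = s.tr (Fin.zero_le j) '' L := by
  refine (Finset.range_orderEmbOfFin (s.img L j) rfl).trans ?_
  simp [Str.img]

theorem Str.remb_zero_mem {n : ℕ} (s : Str n) (L : Finset (Fin (s.obj 0).card))
    (hL : L.Nonempty) (j : Fin ((s.prune L hL).obj 0).card) : s.remb L hL 0 j ∈ L := by
  have h : s.remb L hL 0 j ∈ Set.range (s.remb L hL 0) := ⟨j, rfl⟩
  rw [s.range_remb] at h
  obtain ⟨a, ha, hab⟩ := h
  rw [s.tr_self] at hab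
  exact hab ▸ ha

theorem Str.exists_remb_zero {n : ℕ} (s : Str n) (L : Finset (Fin (s.obj 0).card))
    (hL : L.Nonempty) {i : Fin (s.obj 0).card} (hi : i ∈ L) : ∃ j, s.remb L hL 0 j = i := by
  have h : i ∈ Set.range (s.remb L hL 0) := by
    rw [s.range_remb]
    exact ⟨i, hi, s.tr_self _ i⟩
  exact h

variable {k : Type u} [CommRing k] {A : Type u} [CommRing A] [Algebra k A]
variable {M : Type u} [AddCommGroup M] [Module k M] [Module A M] [IsScalarTower k A M]

theorem prod_fiber_eq_single {x y : ℕ} (φ : Fin x → Fin (y + 1)) (e : Fin y → Fin x)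
    (h : ∀ i j, φ i = j.succ ↔ i = e j) (a : Fin x → A) (j : Fin y) :
    ∏ i : {i // φ i = j.succ}, a i = a (e j) := by
  rw [prod_subtype_eq (fun i => φ i = j.succ) a]
  simp only [h]
  rw [Finset.prod_filter, Finset.prod_ite_eq' Finset.univ (e j) a, if_pos (Finset.mem_univ _)]

variable (k) in
/-- The element `a_1 ⊗ ⋯ ⊗ a_x ⊗ m` of `L(A, M)[x]`. -/
def lodayPure {x : ℕ} (a : Fin x → A) (m : M) : (GamSurj.incl ⋙ loday k A M).obj ⟨x⟩ :=
  (PiTensorProduct.tprod k a ⊗ₜ[k] m : (⨂[k] _ : Fin x, A) ⊗[k] M)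

variable (k) in
/-- The element `a_1 ⊗ ⋯ ⊗ a_x ⊗ m` of `I^{⊗ x} ⊗ M`. -/
def lodayIdealPure {I : Ideal A} {x : ℕ} (a : Fin x → I) (m : M) : (lodayIdeal k M I).obj ⟨x⟩ :=
  (PiTensorProduct.tprod k a ⊗ₜ[k] m : (⨂[k] _ : Fin x, I) ⊗[k] M)

/-- Each fibre over a non-basepoint is the single element `e j`, so no factors are multiplied
together; those in the basepoint fibre act on m. -/
theorem loday_map_collapse {x y : ℕ} (φ : (⟨x⟩ : GamSurj) ⟶ ⟨y⟩) (e : Fin y → Fin x)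
    (h : ∀ i j, φ.1 i.succ = j.succ ↔ i = e j) (a : Fin x → A) (m : M) :
    ((GamSurj.incl ⋙ loday k A M).map φ).hom (lodayPure k a m) =
      lodayPure k (fun j => a (e j)) ((∏ i with φ.1 (Fin.succ i) = 0, a i) • m) := by
  refine (lodayMap_tmul M (GamSurj.incl.map φ) a m).trans ?_
  refine congrArg₂ (lodayPure k) ?_ ?_
  · funext j
    exact prod_fiber_eq_single (fun i => φ.1 i.succ) e h a j
  · congr 1
    exact prod_subtype_eq (fun i : Fin x => φ.1 i.succ = 0) a

theorem lodayIdeal_map_collapse (I : Ideal A) {x y : ℕ} (φ : (⟨x⟩ : GamSurj) ⟶ ⟨y⟩)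
    (e : Fin y → Fin x) (h : ∀ i j, φ.1 i.succ = j.succ ↔ i = e j) (a : Fin x → I) (m : M) :
    ((lodayIdeal k M I).map φ).hom (lodayIdealPure k a m) =
      lodayIdealPure k (fun j => a (e j))
        ((∏ i with φ.1 (Fin.succ i) = 0, (a i : A)) • m) := by
  refine (lodayIdealMap_tmul M I φ a m).trans ?_
  refine congrArg₂ (lodayIdealPure k) ?_ ?_
  · funext j
    apply Subtype.ext
    rw [prodIdeal_apply]
    exact prod_fiber_eq_single (fun i => φ.1 i.succ) e h (fun i => (a i : A)) j
  · congr 1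
    exact prod_subtype_eq (fun i : Fin x => φ.1 i.succ = 0) fun i => (a i : A)

/-- The basepoint fibre contains no index, so the empty product acts on m. -/
theorem loday_map_surj {x y : ℕ} (φ : (⟨x⟩ : GamSurj) ⟶ ⟨y⟩)
    (h : ∀ i : Fin x, φ.1 i.succ ≠ 0) (a : Fin x → A) (m : M) :
    ((GamSurj.incl ⋙ loday k A M).map φ).hom (lodayPure k a m) =
      lodayPure k (fun j : Fin y => ∏ i with φ.1 (Fin.succ i) = Fin.succ j, a i) m := by
  refine (lodayMap_tmul M (GamSurj.incl.map φ) a m).trans ?_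
  refine congrArg₂ (lodayPure k) ?_ ?_
  · funext j
    exact prod_subtype_eq (fun i : Fin x => φ.1 i.succ = Fin.succ (n := y) j) a
  · refine Eq.trans ?_ (one_smul A m)
    congr 1
    refine (prod_subtype_eq (fun i : Fin x => φ.1 i.succ = 0) a).trans ?_
    refine Finset.prod_eq_one fun i hi => (h i ?_).elim
    simpa using hi

theorem lodayIdeal_map_surj (I : Ideal A) {x y : ℕ} (φ : (⟨x⟩ : GamSurj) ⟶ ⟨y⟩)
    (h : ∀ i : Fin x, φ.1 i.succ ≠ 0) (a : Fin x → I) (b : Fin y → I)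
    (hb : ∀ j : Fin y, (b j : A) = ∏ i with φ.1 (Fin.succ i) = Fin.succ j, (a i : A)) (m : M) :
    ((lodayIdeal k M I).map φ).hom (lodayIdealPure k a m) =
      lodayIdealPure k b m := by
  refine (lodayIdealMap_tmul M I φ a m).trans ?_
  refine congrArg₂ (lodayIdealPure k) ?_ ?_
  · funext j
    apply Subtype.ext
    rw [prodIdeal_apply, hb]
    exact prod_subtype_eq (fun i : Fin x => φ.1 i.succ = j.succ) fun i => (a i : A)
  · refine Eq.trans ?_ (one_smul A m)
    congr 1
    refine (prod_subtype_eq (fun i : Fin x => φ.1 i.succ = 0) fun i => (a i : A)).trans ?_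
    refine Finset.prod_eq_one fun i hi => (h i ?_).elim
    simpa using hi

/-- Equal strings have domains that are equal only propositionally. Comparing indices by their
numerical values avoids transporting the tensors. -/
theorem RWMod.of_tprod_congr (I : Ideal A) {n : ℕ} {s t : OneStr n} (h : s = t)
    (y : Fin s.dom → I) (z : Fin t.dom → I)
    (H : ∀ (i : Fin s.dom) (j : Fin t.dom), (i : ℕ) = j → y i = z j) (m : M) :
    RWMod.of (lodayIdeal k M I) s (lodayIdealPure k y m) =
      RWMod.of (lodayIdeal k M I) t (lodayIdealPure k z m) := by
  subst h
  obtain rfl : y = z := funext fun i => H i i rfl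
  rfl

theorem RWMod.forest_tprod_congr (I : Ideal A) {n : ℕ} {s t : Str n} (h : s = t)
    (y : Fin (s.obj 0).card → I) (z : Fin (t.obj 0).card → I)
    (H : ∀ (i : Fin (s.obj 0).card) (j : Fin (t.obj 0).card), (i : ℕ) = j → y i = z j) (m : M) :
    RWMod.forest (lodayIdeal k M I) s (lodayIdealPure k y m) =
      RWMod.forest (lodayIdeal k M I) t (lodayIdealPure k z m) := by
  subst h
  obtain rfl : y = z := funext fun i => H i i rfl
  rfl

/-- Linear maps on `A^{⊗ x} ⊗ M` that agree on the tensors all of whose factors belong to the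
augmentation ideal or are trivial are equal. -/
theorem tensor_ext_basic {M : Type u} [AddCommGroup M] [Module k M] (ε : A →ₐ[k] k) {N : Type*} [AddCommGroup N] [Module k N] {x : ℕ}
    {f g : ((⨂[k] _ : Fin x, A) ⊗[k] M) →ₗ[k] N}
    (H : ∀ (L : Finset (Fin x)) (a : Fin x → A), (∀ i ∈ L, a i ∈ RingHom.ker ε) →
      (∀ i ∉ L, a i = 1) → ∀ m, f (PiTensorProduct.tprod k a ⊗ₜ[k] m) =
        g (PiTensorProduct.tprod k a ⊗ₜ[k] m)) : f = g := by
  classical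
  refine TensorProduct.ext (PiTensorProduct.ext (MultilinearMap.ext fun a =>
    LinearMap.ext fun m => ?_))
  change f (PiTensorProduct.tprod k a ⊗ₜ[k] m) = g (PiTensorProduct.tprod k a ⊗ₜ[k] m)
  -- T contains the positions whose factors may still be arbitrary; the induction makes them basic
  -- one at a time.
  have key : ∀ (T : Finset (Fin x)) (a : Fin x → A),
      (∀ i ∉ T, a i ∈ RingHom.ker ε ∨ a i = 1) →
      f (PiTensorProduct.tprod k a ⊗ₜ[k] m) = g (PiTensorProduct.tprod k a ⊗ₜ[k] m) := by
    intro T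
    induction T using Finset.induction_on with
    | empty =>
      intro a ha
      refine H {i | a i ∈ RingHom.ker ε} a (fun i hi => by simpa using hi) (fun i hi => ?_) m
      exact (ha i (Finset.notMem_empty i)).resolve_left (by simpa using hi)
    | insert i T hi ih =>
      intro a ha
      have hu : ∀ v : A, (v ∈ RingHom.ker ε ∨ v = 1) →
          f (PiTensorProduct.tprod k (Function.update a i v) ⊗ₜ[k] m) =
            g (PiTensorProduct.tprod k (Function.update a i v) ⊗ₜ[k] m) := by
        intro v hv
        refine ih _ fun j hj => ?_
        by_cases hji : j = i
        · subst hji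
          simpa using hv
        · rw [Function.update_of_ne hji]
          exact ha j (by simp [hji, hj])
      -- The splitting a_i = (a_i - ε(a_i)) + ε(a_i) · 1 replaces the factor by one in the ideal and
      -- one that is trivial.
      have hd : a = Function.update a i ((augProj ε (a i) : A) + ε (a i) • (1 : A)) := by
        have h : (augProj ε (a i) : A) + ε (a i) • (1 : A) = a i := by
          change a i - algebraMap k A (ε (a i)) + _ = _
          rw [Algebra.algebraMap_eq_smul_one, sub_add_cancel]
        rw [h, Function.update_eq_self]
      rw [hd, MultilinearMap.map_update_add, MultilinearMap.map_update_smul,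
        TensorProduct.add_tmul, ← TensorProduct.smul_tmul', map_add, map_add, map_smul, map_smul,
        hu _ (Or.inl (augProj ε (a i)).2), hu _ (Or.inr rfl)]
  exact key Finset.univ a fun i hi => (hi (Finset.mem_univ i)).elim

variable (ε : A →ₐ[k] k)

/-- The preimage of `L` in the first set of a component. -/
def Str.inComp {n : ℕ} (t : Str n) (L : Finset (Fin (t.obj 0).card))
    (c : Fin (t.obj (Fin.last n)).card) : Finset (Fin ((t.component c).obj 0).card) :=
  {i | t.cemb c 0 i ∈ L}

@[simp]
theorem Str.mem_inComp {n : ℕ} (t : Str n) (L : Finset (Fin (t.obj 0).card))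
    (c : Fin (t.obj (Fin.last n)).card) (i : Fin ((t.component c).obj 0).card) :
    i ∈ t.inComp L c ↔ t.cemb c 0 i ∈ L := by
  simp [Str.inComp]

theorem Str.collapse_eq_zero {n : ℕ} (t : Str n) (c : Fin (t.obj (Fin.last n)).card)
    (i : Fin (t.obj 0).card) :
    (t.collapse c).1 i.succ = 0 ↔ t.tr (Fin.zero_le (Fin.last n)) i ≠ c := by
  have h : t.tr (Fin.zero_le (Fin.last n)) i = c ↔ i ∈ Set.range (t.cemb c 0) := by
    rw [t.range_cemb]; rfl
  rw [Ne, h]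
  constructor
  · rintro h0 ⟨a, rfl⟩
    rw [(t.collapse_eq_succ c _ a).2 rfl] at h0
    exact Fin.succ_ne_zero a h0
  · intro h0
    by_contra h'
    obtain ⟨b, hb⟩ := Fin.exists_succ_eq.2 h'
    exact h0 ⟨b, ((t.collapse_eq_succ c i b).1 hb.symm).symm⟩

/-- Pruning commutes with taking components. On both sides the vertices at level j are the images of
those elements of L whose root is the chosen one. -/
theorem Str.range_prune_component {n : ℕ} (t : Str n) (L : Finset (Fin (t.obj 0).card))
    (hL : L.Nonempty) (d : Fin ((t.prune L hL).obj (Fin.last n)).card)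
    (hc : (t.inComp L (t.remb L hL (Fin.last n) d)).Nonempty) (j : Fin (n + 1)) :
    Set.range (fun a => t.cemb (t.remb L hL (Fin.last n) d) j
        ((t.component (t.remb L hL (Fin.last n) d)).remb _ hc j a)) =
      Set.range (fun a => t.remb L hL j ((t.prune L hL).cemb d j a)) := by
  have h1 := (t.component (t.remb L hL (Fin.last n) d)).range_remb _ hc j
  have h2 := (t.prune L hL).range_cemb d j
  ext b
  constructor
  · rintro ⟨a, rfl⟩
    have ha := Set.mem_range_self (f := (t.component (t.remb L hL (Fin.last n) d)).remb _ hc j) a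
    rw [h1] at ha
    obtain ⟨i, hi, hia⟩ := ha
    rw [Finset.mem_coe, Str.mem_inComp] at hi
    obtain ⟨i', hi'⟩ := t.exists_remb_zero L hL hi
    have h3 : (t.prune L hL).tr (Fin.zero_le j) i' ∈ Set.range ((t.prune L hL).cemb d j) := by
      rw [h2]
      refine ((t.prune L hL).tr_tr _ _ i').trans ((t.remb_strictMono L hL _).injective ?_)
      rw [t.remb_tr, hi', t.tr_cemb]
    obtain ⟨y, hy⟩ := h3
    refine ⟨y, ?_⟩
    change t.remb L hL j ((t.prune L hL).cemb d j y) = _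
    rw [hy, t.remb_tr, hi']
    change _ = t.cemb _ j _
    rw [← hia, t.cemb_tr]
  · rintro ⟨a, rfl⟩
    obtain ⟨i, hi⟩ := (t.prune L hL).tr_surjective (Fin.zero_le j) ((t.prune L hL).cemb d j a)
    have h3 : t.remb L hL 0 i ∈ Set.range (t.cemb (t.remb L hL (Fin.last n) d) 0) := by
      rw [t.range_cemb]
      change t.tr _ _ = _
      rw [← t.remb_tr, ← (t.prune L hL).tr_tr (Fin.zero_le j) (Fin.le_last j), hi,
        (t.prune L hL).tr_cemb]
    obtain ⟨y, hy⟩ := h3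
    have h4 : (t.component _).tr (Fin.zero_le j) y ∈
        Set.range ((t.component (t.remb L hL (Fin.last n) d)).remb _ hc j) := by
      rw [h1]
      refine ⟨y, ?_, rfl⟩
      rw [Finset.mem_coe, Str.mem_inComp, hy]
      exact t.remb_zero_mem L hL i
    obtain ⟨z, hz⟩ := h4
    refine ⟨z, ?_⟩
    change t.cemb _ j _ = t.remb L hL j _
    rw [hz, t.cemb_tr, hy, ← hi, t.remb_tr]

theorem Str.prune_component {n : ℕ} (t : Str n) (L : Finset (Fin (t.obj 0).card))
    (hL : L.Nonempty) (d : Fin ((t.prune L hL).obj (Fin.last n)).card)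
    (hc : (t.inComp L (t.remb L hL (Fin.last n) d)).Nonempty) :
    (t.component (t.remb L hL (Fin.last n) d)).prune _ hc = (t.prune L hL).component d :=
  Str.eq_of_emb t _ _
    (fun j a => t.cemb (t.remb L hL (Fin.last n) d) j
        ((t.component (t.remb L hL (Fin.last n) d)).remb _ hc j a))
    (fun j => (t.cemb_strictMono _ j).comp (Str.remb_strictMono _ _ hc j))
    (fun i j h a => by rw [Str.remb_tr, Str.cemb_tr])
    (fun j a => t.remb L hL j ((t.prune L hL).cemb d j a))
    (fun j => (t.remb_strictMono L hL j).comp (Str.cemb_strictMono _ _ j))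
    (fun i j h a => by rw [Str.cemb_tr, Str.remb_tr])
    (t.range_prune_component L hL d hc)

variable (M)

/-- Each summand of the forest is again an elementary tensor, in the form to which `pruneMap_basic`
and `pruneMap_one` apply. -/
theorem pruneMap_tree {n : ℕ} (t : Str n) (c : Fin (t.obj (Fin.last n)).card)
    (a : Fin (t.obj 0).card → A) (m : M) :
    RWMod.of (GamSurj.incl ⋙ loday k A M) (t.tree c)
      (((GamSurj.incl ⋙ loday k A M).map (t.collapse c)).hom
        (lodayPure k a m)) =
    RWMod.of (GamSurj.incl ⋙ loday k A M) (t.tree c)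
      (lodayPure k (fun j => a (t.cemb c 0 j))
        ((∏ i with t.tr (Fin.zero_le (Fin.last n)) i ≠ c, a i) • m)) := by
  refine congrArg _ ((loday_map_collapse (t.collapse c) (t.cemb c 0)
    (t.collapse_eq_succ c) a m).trans ?_)
  refine congrArg (fun b => lodayPure k _ (b • m)) (Finset.prod_congr ?_ fun _ _ => rfl)
  ext i
  simp [t.collapse_eq_zero]

/-- The pruning map on the sum of the components of a forest with a basic tensor as its
coefficient. -/
theorem pruneMap_forest {n : ℕ} (t : Str n) (L : Finset (Fin (t.obj 0).card)) (hL : L.Nonempty)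
    (a : Fin (t.obj 0).card → A) (ha : ∀ i ∈ L, a i ∈ RingHom.ker ε) (ha' : ∀ i ∉ L, a i = 1)
    (m : M) :
    pruneMap ε M n (RWMod.forest (GamSurj.incl ⋙ loday k A M) t
        (lodayPure k a m)) =
      RWMod.forest (lodayIdeal k M (RingHom.ker ε)) (t.prune L hL)
        (lodayIdealPure k (fun j => ⟨a (t.remb L hL 0 j), ha _ (t.remb_zero_mem L hL j)⟩) m) := by
  rw [RWMod.forest_apply, RWMod.forest_apply, _root_.map_sum]
  symm
  -- The roots of the pruned forest are the roots reached from L. A tree over any other root has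
  -- only trivial factors and is killed by pruning.
  refine Fintype.sum_of_injective (t.remb L hL (Fin.last n))
    (t.remb_strictMono L hL _).injective _ _ (fun c hc => ?_) fun d => ?_
  · rw [pruneMap_tree]
    have h : (fun j => a (t.cemb c 0 j)) = fun _ => (1 : A) := by
      funext j
      refine ha' _ fun hj => hc ?_
      rw [t.range_remb]
      exact ⟨_, hj, t.tr_cemb c 0 j⟩
    rw [h]
    exact pruneMap_one ε M (t.tree c) _
  · rw [pruneMap_tree]
    have hc : (t.inComp L (t.remb L hL (Fin.last n) d)).Nonempty := by
      have hd := Set.mem_range_self (f := t.remb L hL (Fin.last n)) d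
      rw [t.range_remb] at hd
      obtain ⟨i, hi, hid⟩ := hd
      have h3 : i ∈ Set.range (t.cemb (t.remb L hL (Fin.last n) d) 0) := by
        rw [t.range_cemb]
        exact hid
      obtain ⟨y, rfl⟩ := h3
      exact ⟨y, by simpa using hi⟩
    have hb := pruneMap_basic ε M (t.tree (t.remb L hL (Fin.last n) d)) (t.inComp L _) hc
      (fun j => a (t.cemb _ 0 j)) (fun i hi => ha _ ((t.mem_inComp L _ i).1 hi))
      (fun i hi => ha' _ (fun h => hi ((t.mem_inComp L _ i).2 h)))
      ((∏ i with t.tr (Fin.zero_le (Fin.last n)) i ≠ t.remb L hL (Fin.last n) d, a i) • m)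
    refine Eq.trans ?_ hb.symm
    refine (congrArg _ (lodayIdeal_map_collapse (RingHom.ker ε) ((t.prune L hL).collapse d)
      ((t.prune L hL).cemb d 0) ((t.prune L hL).collapse_eq_succ d) _ m)).trans ?_
    -- The factors acting on m are those outside the tree. The unpruned product has additional
    -- factors only at indices outside L, and these are 1.
    have hm : (∏ i with ((t.prune L hL).collapse d).1 (Fin.succ i) = 0,
          a (t.remb L hL 0 i)) =
        ∏ i with t.tr (Fin.zero_le (Fin.last n)) i ≠ t.remb L hL (Fin.last n) d, a i := by
      refine Finset.prod_of_injOn (t.remb L hL 0) (t.remb_strictMono L hL 0).injective.injOn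
        (fun i hi => ?_) (fun i hi hi' => ha' i fun hiL => hi' ?_) fun i _ => rfl
      · rw [Finset.coe_filter, Set.mem_ofPred_eq, Str.collapse_eq_zero] at hi
        rw [Finset.coe_filter, Set.mem_ofPred_eq, ← t.remb_tr]
        exact ⟨Finset.mem_univ _, fun h => hi.2 ((t.remb_strictMono L hL _).injective h)⟩
      · obtain ⟨y, rfl⟩ := t.exists_remb_zero L hL hiL
        refine ⟨y, ?_, rfl⟩
        rw [Finset.mem_filter, ← t.remb_tr] at hi
        rw [Finset.coe_filter, Set.mem_ofPred_eq, Str.collapse_eq_zero]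
        exact ⟨Finset.mem_univ _, fun h => hi.2 (congrArg _ h)⟩
    rw [hm]
    refine RWMod.of_tprod_congr (RingHom.ker ε) (OneStr.ext (t.prune_component L hL d hc)).symm
      _ _ (fun i j hij => Subtype.ext (congrArg a ?_)) _
    exact ((strictMono_unique ((t.cemb_strictMono _ 0).comp (Str.remb_strictMono _ _ hc 0))
      ((t.remb_strictMono L hL 0).comp (Str.cemb_strictMono _ d 0))
      (t.range_prune_component L hL d hc 0)).2 j i hij.symm).symm

theorem pruneMap_forest_one {n : ℕ} (t : Str n) (m : M) :
    pruneMap ε M n (RWMod.forest (GamSurj.incl ⋙ loday k A M) t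
        (lodayPure k (fun _ => (1 : A)) m)) = 0 := by
  rw [RWMod.forest_apply, _root_.map_sum]
  refine Finset.sum_eq_zero fun c _ => ?_
  rw [pruneMap_tree]
  exact pruneMap_one ε M (t.tree c) _

theorem Str.prune_pull_aux {m n : ℕ} (s : Str n) (θ : Fin (m + 1) →o Fin (n + 1))
    (L : Finset (Fin (s.obj 0).card)) (hL : L.Nonempty)
    (L' : Finset (Fin ((s.pull θ).obj 0).card)) (hL' : L'.Nonempty)
    (h : (L' : Set (Fin ((s.pull θ).obj 0).card)) = s.tr (Fin.zero_le (θ 0)) '' L)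
    (j : Fin (m + 1)) : Set.range ((s.pull θ).remb L' hL' j) = Set.range (s.remb L hL (θ j)) := by
  rw [(s.pull θ).range_remb, s.range_remb, h]
  refine (Set.image_image (s.tr (θ.monotone (Fin.zero_le j))) _ _).trans ?_
  exact Set.image_congr fun a _ => s.tr_tr _ _ a

/-- The image of L at level θ(j) is the same whether it is formed directly or by way of its image in
x_{θ(0)}, so pruning and pulling back can be interchanged. -/
theorem Str.prune_pull {m n : ℕ} (s : Str n) (θ : Fin (m + 1) →o Fin (n + 1))
    (L : Finset (Fin (s.obj 0).card)) (hL : L.Nonempty)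
    (L' : Finset (Fin ((s.pull θ).obj 0).card)) (hL' : L'.Nonempty)
    (h : (L' : Set (Fin ((s.pull θ).obj 0).card)) = s.tr (Fin.zero_le (θ 0)) '' L) :
    (s.pull θ).prune L' hL' = (s.prune L hL).pull θ :=
  Str.eq_of_emb (s.pull θ) _ _ ((s.pull θ).remb L' hL') ((s.pull θ).remb_strictMono L' hL')
    (fun _ _ h' a => (s.pull θ).remb_tr L' hL' h' a) (fun j => s.remb L hL (θ j))
    (fun j => s.remb_strictMono L hL (θ j))
    (fun _ _ h' a => s.remb_tr L hL (θ.monotone h') a) (s.prune_pull_aux θ L hL L' hL' h)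

/-- The products of the factors in the fibres of the map `x_0 → x_{θ(0)}`. -/
def Str.pushProd {m n : ℕ} (s : Str n) (θ : Fin (m + 1) →o Fin (n + 1))
    (a : Fin (s.obj 0).card → A) (j : Fin ((s.pull θ).obj 0).card) : A :=
  ∏ i with s.tr (Fin.zero_le (θ 0)) i = (show Fin (s.obj (θ 0)).card from j), a i

/-- The push-forward of a basic tensor is basic for the image L' of L: a product over a fibre that
meets L lies in the ideal, and over any other fibre it is 1. The claim thus reduces to
`pruneMap_forest` for L' and `Str.prune_pull`. -/
theorem pruneMap_map_basic {m n : ℕ} (θ : Fin (m + 1) →o Fin (n + 1)) (s : OneStr n)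
    (L : Finset (Fin s.dom)) (a : Fin s.dom → A) (ha : ∀ i ∈ L, a i ∈ RingHom.ker ε)
    (ha' : ∀ i ∉ L, a i = 1) (x : M) :
    pruneMap ε M m (RWMod.map (GamSurj.incl ⋙ loday k A M) θ
        (RWMod.of (GamSurj.incl ⋙ loday k A M) s (lodayPure k a x))) =
      RWMod.map (lodayIdeal k M (RingHom.ker ε)) θ
        (pruneMap ε M n (RWMod.of (GamSurj.incl ⋙ loday k A M) s (lodayPure k a x))) := by
  have hpull : ((GamSurj.incl ⋙ loday k A M).map (s.str.pullHom θ)).hom (lodayPure k a x) =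
      lodayPure k (s.str.pushProd θ a) x := by
    refine (loday_map_surj (s.str.pullHom θ) (fun i => Fin.succ_ne_zero _) a x).trans ?_
    refine congrArg (fun b => lodayPure k b x) (funext fun j => Finset.prod_congr ?_ fun _ _ => rfl)
    ext i
    simp only [Finset.mem_filter, Finset.mem_univ, true_and]
    exact s.str.pullHom_eq_succ θ i j
  rw [RWMod.map_of_eq_forest, hpull]
  rcases L.eq_empty_or_nonempty with rfl | hL
  · have h1 : a = fun _ => 1 := funext fun i => ha' i (Finset.notMem_empty i)
    subst h1
    have h2 : pruneMap ε M n (RWMod.of (GamSurj.incl ⋙ loday k A M) s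
        (lodayPure k (fun _ => (1 : A)) x)) = 0 := pruneMap_one ε M s x
    rw [h2, map_zero]
    have h3 : s.str.pushProd θ (fun _ => (1 : A)) = fun _ => 1 :=
      funext fun j => Finset.prod_const_one
    rw [h3]
    exact pruneMap_forest_one M ε (s.str.pull θ) x
  · let L' : Finset (Fin ((s.str.pull θ).obj 0).card) := L.image (s.str.tr (Fin.zero_le (θ 0)))
    have hL' : L'.Nonempty := hL.image _
    have hLL : (L' : Set (Fin ((s.str.pull θ).obj 0).card)) =
      s.str.tr (Fin.zero_le (θ 0)) '' L := Finset.coe_image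
    have hbasic : pruneMap ε M n (RWMod.of (GamSurj.incl ⋙ loday k A M) s (lodayPure k a x)) =
        RWMod.of (lodayIdeal k M (RingHom.ker ε)) ⟨s.str.prune L hL, s.str.prune_last L hL s.card_last⟩
          (lodayIdealPure k (fun j => ⟨a (s.str.remb L hL 0 j),
            ha _ (s.str.remb_zero_mem L hL j)⟩) x) := pruneMap_basic ε M s L hL a ha ha' x
    rw [hbasic]
    refine (pruneMap_forest M ε (s.str.pull θ) L' hL' (s.str.pushProd θ a) (fun j hj => ?_) (fun j hj => ?_) x).trans
      (Eq.trans ?_ (RWMod.map_of_eq_forest _ θ _ _).symm)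
    · obtain ⟨i, hi, rfl⟩ := Finset.mem_image.1 hj
      exact Ideal.prod_mem _ (Finset.mem_filter.2 ⟨Finset.mem_univ i, rfl⟩) (ha i hi)
    · refine Finset.prod_eq_one fun i hi => ha' i fun hiL => hj ?_
      rw [Finset.mem_filter] at hi
      exact Finset.mem_image.2 ⟨i, hiL, hi.2⟩
    · refine Eq.trans ?_ (congrArg (RWMod.forest _ ((s.str.prune L hL).pull θ))
        (lodayIdeal_map_surj (RingHom.ker ε) ((s.str.prune L hL).pullHom θ)
          (fun i => Fin.succ_ne_zero _) _
          (fun j => ⟨s.str.pushProd θ a (s.str.remb L hL (θ 0) j), ?_⟩)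
          (fun j => ?_) x)).symm
      · refine RWMod.forest_tprod_congr (RingHom.ker ε) (s.str.prune_pull θ L hL L' hL' hLL) _ _
          (fun i j hij => Subtype.ext ?_) x
        have h3 := (strictMono_unique ((s.str.pull θ).remb_strictMono L' hL' 0)
          (s.str.remb_strictMono L hL (θ 0)) (s.str.prune_pull_aux θ L hL L' hL' hLL 0)).2 i j hij
        exact congrArg (s.str.pushProd θ a) h3
      · have h4 := Set.mem_range_self (f := s.str.remb L hL (θ 0)) j
        rw [s.str.range_remb] at h4
        obtain ⟨i, hi, hij⟩ := h4
        exact Ideal.prod_mem _ (Finset.mem_filter.2 ⟨Finset.mem_univ i, hij⟩) (ha i hi)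
      -- Passing from the whole fibre to its part in L omits only factors equal to 1.
      · refine (Finset.prod_of_injOn
          (s := {i | ((s.str.prune L hL).pullHom θ).1 (Fin.succ i) = Fin.succ j})
          (t := {i | s.str.tr (Fin.zero_le (θ 0)) i = s.str.remb L hL (θ 0) j})
          (f := fun i => a (s.str.remb L hL 0 i)) (g := a) (s.str.remb L hL 0)
          (s.str.remb_strictMono L hL 0).injective.injOn (fun i hi => ?_)
          (fun i hi hi' => ha' i fun hiL => hi' ?_) fun i _ => rfl).symm
        · rw [Finset.coe_filter, Set.mem_ofPred_eq] at hi
          rw [Finset.coe_filter, Set.mem_ofPred_eq]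
          refine ⟨Finset.mem_univ _, ?_⟩
          rw [← s.str.remb_tr]
          exact congrArg _ (((s.str.prune L hL).pullHom_eq_succ θ i j).1 hi.2)
        · obtain ⟨y, rfl⟩ := s.str.exists_remb_zero L hL hiL
          refine ⟨y, ?_, rfl⟩
          rw [Finset.mem_filter, ← s.str.remb_tr] at hi
          rw [Finset.coe_filter, Set.mem_ofPred_eq]
          exact ⟨Finset.mem_univ _, ((s.str.prune L hL).pullHom_eq_succ θ y j).2
            ((s.str.remb_strictMono L hL (θ 0)).injective hi.2)⟩

/-- Treating all monotone maps at once makes pruning a map of simplicial modules, so no face needs a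
separate argument and the chain map comes from functoriality. -/
theorem pruneMap_map {m n : ℕ} (θ : Fin (m + 1) →o Fin (n + 1)) :
    pruneMap ε M m ∘ₗ RWMod.map (GamSurj.incl ⋙ loday k A M) θ =
      RWMod.map (lodayIdeal k M (RingHom.ker ε)) θ ∘ₗ pruneMap ε M n :=
  DirectSum.linearMap_ext k fun s => tensor_ext_basic (M := M) ε fun L a ha ha' x =>
    pruneMap_map_basic M ε θ s L a ha ha' x

/-- The pruning map, as a map of simplicial modules. -/
def pruneSimplicial :
    rwSimplicial (GamSurj.incl ⋙ loday k A M) ⟶ rwSimplicial (lodayIdeal k M (RingHom.ker ε)) where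
  app n := ModuleCat.ofHom (pruneMap ε M n.unop.len)
  naturality _ _ θ := by
    apply ModuleCat.hom_ext
    exact pruneMap_map M ε θ.unop.toOrderHom

/-- The pruning map, as a chain map. -/
def pruneChain : CGamma k A M ⟶ CGammaIdeal ε M :=
  (AlgebraicTopology.alternatingFaceMapComplex (ModuleCat.{u} k)).map (pruneSimplicial M ε)

theorem Str.prune_univ {n : ℕ} (s : Str n) (h : (Finset.univ : Finset (Fin _)).Nonempty) :
    s.prune Finset.univ h = s := by
  refine Str.eq_of_emb s _ _ (s.remb _ h) (s.remb_strictMono _ h) (fun _ _ h' a => s.remb_tr _ h h' a)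
    (fun _ => id) (fun _ => strictMono_id) (fun _ _ _ _ => rfl) fun j => ?_
  rw [s.range_remb, Set.range_id, Finset.coe_univ, Set.image_univ, (s.tr_surjective _).range_eq]

/-- A tensor of elements of the ideal is basic with L the whole domain, and pruning along the whole
domain removes nothing, because the maps of a string are surjective. -/
theorem rwSimplicialMap_pruneSimplicial :
    rwSimplicialMap (lodayIdealIncl k M (RingHom.ker ε)) ≫ pruneSimplicial M ε = 𝟙 _ := by
  refine NatTrans.ext (funext fun n => ModuleCat.hom_ext ?_)
  refine DirectSum.linearMap_ext k fun s => TensorProduct.ext (PiTensorProduct.ext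
    (MultilinearMap.ext fun a => LinearMap.ext fun m => ?_))
  change pruneMap ε M n.unop.len (DirectSum.lmap _ (RWMod.of (lodayIdeal k M (RingHom.ker ε)) s
    (lodayIdealPure k a m))) = RWMod.of (lodayIdeal k M (RingHom.ker ε)) s (lodayIdealPure k a m)
  have h1 : DirectSum.lmap (fun s : OneStr n.unop.len =>
      ((lodayIdealIncl k M (RingHom.ker ε)).app ⟨s.dom⟩).hom)
        (RWMod.of (lodayIdeal k M (RingHom.ker ε)) s (lodayIdealPure k a m)) =
      RWMod.of (GamSurj.incl ⋙ loday k A M) s (lodayPure k (fun i => (a i : A)) m) := by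
    refine (DirectSum.lmap_lof (fun s : OneStr n.unop.len =>
      ((lodayIdealIncl k M (RingHom.ker ε)).app ⟨s.dom⟩).hom) s _).trans ?_
    refine congrArg (RWMod.of (GamSurj.incl ⋙ loday k A M) s) ?_
    refine (TensorProduct.map_tmul _ _ (PiTensorProduct.tprod k a) m).trans ?_
    exact congrArg (· ⊗ₜ[k] m) (PiTensorProduct.map_tprod _ _)
  refine (congrArg _ h1).trans ?_
  have hne : (Finset.univ : Finset (Fin s.dom)).Nonempty := ⟨⟨0, (s.str.obj 0).pos⟩, Finset.mem_univ _⟩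
  refine (pruneMap_basic ε M s Finset.univ hne (fun i => (a i : A)) (fun i _ => (a i).2)
    (fun i hi => (hi (Finset.mem_univ i)).elim) m).trans ?_
  refine RWMod.of_tprod_congr (RingHom.ker ε) (OneStr.ext (s.str.prune_univ hne)) _ _
    (fun i j hij => Subtype.ext (congrArg (fun i => (a i : A)) ?_)) m
  refine (strictMono_unique (s.str.remb_strictMono _ hne 0) strictMono_id ?_).2 i j hij
  rw [s.str.range_remb, Set.range_id, Finset.coe_univ, Set.image_univ,
    (s.str.tr_surjective _).range_eq]

theorem CGammaIncl_pruneChain : CGammaIncl ε M ≫ pruneChain M ε = 𝟙 (CGammaIdeal ε M) := by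
  refine (((AlgebraicTopology.alternatingFaceMapComplex (ModuleCat.{u} k)).map_comp _ _).symm).trans
    ?_
  rw [rwSimplicialMap_pruneSimplicial]
  exact (AlgebraicTopology.alternatingFaceMapComplex (ModuleCat.{u} k)).map_id _

end PruningChainMap

end GammaHomology

end

noncomputable section

namespace GammaHomology

/-! ### Gluing -/

section Gluing

/-- A forest whose vertices form finite linearly ordered sets. -/
structure OForest (n : ℕ) where
  /-- the vertices -/
  V : Fin (n + 1) → Type
  [ord : ∀ j, LinearOrder (V j)]
  [fin : ∀ j, Fintype (V j)]
  [ne : ∀ j, Nonempty (V j)]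
  /-- the maps between the sets of vertices -/
  tr : ∀ {i j : Fin (n + 1)}, i ≤ j → V i → V j
  tr_self : ∀ {i : Fin (n + 1)} (h : i ≤ i) (a : V i), tr h a = a
  tr_tr : ∀ {i j l : Fin (n + 1)} (h : i ≤ j) (h' : j ≤ l) (a : V i),
    tr h' (tr h a) = tr (h.trans h') a
  tr_surj : ∀ {i j : Fin (n + 1)} (h : i ≤ j), Function.Surjective (tr h)

attribute [instance] OForest.ord OForest.fin OForest.ne

/-- The numbering of the vertices. -/
def OForest.num {n : ℕ} (G : OForest n) (j : Fin (n + 1)) : Fin (Fintype.card (G.V j)) ≃o G.V j :=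
  Fintype.orderIsoFinOfCardEq (G.V j) rfl

/-- The string of surjections that is obtained by numbering the vertices. -/
def OForest.toStr {n : ℕ} (G : OForest n) : Str n where
  obj j := ⟨Fintype.card (G.V j), Fintype.card_pos⟩
  map {i j} f := ⟨fun a => (G.num j).symm (G.tr (leOfHom f) (G.num i a)),
    (G.num j).symm.surjective.comp ((G.tr_surj _).comp (G.num i).surjective)⟩
  map_id i := by
    apply Subtype.ext
    funext a
    simp [G.tr_self]
  map_comp f g := by
    apply Subtype.ext
    funext a
    simp [G.tr_tr]

/-- The number of a vertex. -/
def OForest.idx {n : ℕ} (G : OForest n) {j : Fin (n + 1)} (v : G.V j) :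
    Fin (G.toStr.obj j).card :=
  (G.num j).symm v

theorem OForest.idx_strictMono {n : ℕ} (G : OForest n) {j : Fin (n + 1)} :
    StrictMono (G.idx (j := j)) :=
  (G.num j).symm.strictMono

theorem OForest.idx_surjective {n : ℕ} (G : OForest n) {j : Fin (n + 1)} :
    Function.Surjective (G.idx (j := j)) :=
  (G.num j).symm.surjective

theorem OForest.toStr_tr {n : ℕ} (G : OForest n) {i j : Fin (n + 1)} (h : i ≤ j) (v : G.V i) :
    G.toStr.tr h (G.idx v) = G.idx (G.tr h v) := by
  change (G.num j).symm (G.tr _ (G.num i ((G.num i).symm v))) = _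
  rw [OrderIso.apply_symm_apply]
  rfl

/-- A finite forest, possibly empty, over a string. -/
structure Over {n : ℕ} (t : Str n) where
  /-- the vertices -/
  B : Fin (n + 1) → Type
  [ord : ∀ j, LinearOrder (B j)]
  [fin : ∀ j, Fintype (B j)]
  /-- the maps between the sets of vertices -/
  tr : ∀ {i j : Fin (n + 1)}, i ≤ j → B i → B j
  tr_self : ∀ {i : Fin (n + 1)} (h : i ≤ i) (a : B i), tr h a = a
  tr_tr : ∀ {i j l : Fin (n + 1)} (h : i ≤ j) (h' : j ≤ l) (a : B i),
    tr h' (tr h a) = tr (h.trans h') a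
  tr_surj : ∀ {i j : Fin (n + 1)} (h : i ≤ j), Function.Surjective (tr h)
  /-- the projection to the string -/
  proj : ∀ {j : Fin (n + 1)}, B j → Fin (t.obj j).card
  proj_tr : ∀ {i j : Fin (n + 1)} (h : i ≤ j) (a : B i), proj (tr h a) = t.tr h (proj a)

attribute [instance] Over.ord Over.fin

/-- The pullback along a monotone map. -/
def Over.pull {m n : ℕ} {t : Str n} (X : Over t) (θ : Fin (m + 1) →o Fin (n + 1)) :
    Over (t.pull θ) where
  B j := X.B (θ j)
  tr h := X.tr (θ.monotone h)
  tr_self _ := X.tr_self _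
  tr_tr _ _ := X.tr_tr _ _
  tr_surj _ := X.tr_surj _
  proj := X.proj
  proj_tr _ := X.proj_tr _

/-- The forest over a string that is the string itself. -/
def Over.self {n : ℕ} (t : Str n) : Over t where
  B j := Fin (t.obj j).card
  tr := t.tr
  tr_self := t.tr_self
  tr_tr := t.tr_tr
  tr_surj := t.tr_surjective
  proj a := a
  proj_tr _ _ := rfl

/-- The forest without branchings over a string that starts at a family of elements of the
first set. -/
def Over.const {n : ℕ} (t : Str n) (D : Type) [LinearOrder D] [Fintype D]
    (f : D → Fin (t.obj 0).card) : Over t where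
  B _ := D
  tr _ a := a
  tr_self _ _ := rfl
  tr_tr _ _ _ := rfl
  tr_surj _ := Function.surjective_id
  proj {j} a := t.tr (Fin.zero_le j) (f a)
  proj_tr _ _ := (t.tr_tr _ _ _).symm

variable {n : ℕ} {t : Str n} (X : Over t) (χ : Fin (n + 1) →o Fin 2)

/-- The vertices of the forest that is glued from `X` at the positions `j` with `χ j = 0` and the
string itself. -/
abbrev Over.GlueV (j : Fin (n + 1)) : Type :=
  Lex (Fin (t.obj j).card ⊕ {_b : X.B j // χ j = 0})

/-- The transition maps of the glued forest. -/
def Over.glueTr {i j : Fin (n + 1)} (h : i ≤ j) (v : X.GlueV χ i) : X.GlueV χ j :=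
  Sum.elim (fun a => toLex (Sum.inl (t.tr h a)))
    (fun b => if hj : χ j = 0 then toLex (Sum.inr ⟨X.tr h b.1, hj⟩)
      else toLex (Sum.inl (t.tr h (X.proj b.1)))) (ofLex v)

theorem Over.glueTr_inl {i j : Fin (n + 1)} (h : i ≤ j) (a : Fin (t.obj i).card) :
    X.glueTr χ h (toLex (Sum.inl a)) = toLex (Sum.inl (t.tr h a)) := rfl

theorem Over.glueTr_inr {i j : Fin (n + 1)} (h : i ≤ j) (b : X.B i) (hi : χ i = 0)
    (hj : χ j = 0) : X.glueTr χ h (toLex (Sum.inr ⟨b, hi⟩)) =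
      toLex (Sum.inr ⟨X.tr h b, hj⟩) :=
  dif_pos hj

/-- Crossing the cut merges a vertex of X into the vertex of the string below it. -/
theorem Over.glueTr_inr' {i j : Fin (n + 1)} (h : i ≤ j) (b : X.B i) (hi : χ i = 0)
    (hj : χ j ≠ 0) : X.glueTr χ h (toLex (Sum.inr ⟨b, hi⟩)) =
      toLex (Sum.inl (t.tr h (X.proj b))) :=
  dif_neg hj

/-- The positions with χ = 0 form an initial segment. A vertex of X may therefore merge into the
string but never reappears, which makes the transition maps composable and surjective. -/
theorem eq_zero_of_monotone {n : ℕ} (χ : Fin (n + 1) →o Fin 2) {i j : Fin (n + 1)} (h : i ≤ j)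
    (hj : χ j = 0) : χ i = 0 :=
  le_antisymm ((χ.monotone h).trans hj.le) (Fin.zero_le _)

theorem Over.glue_cases {j : Fin (n + 1)} {P : X.GlueV χ j → Prop} (v : X.GlueV χ j)
    (h1 : ∀ a, P (toLex (Sum.inl a))) (h2 : ∀ b h, P (toLex (Sum.inr ⟨b, h⟩))) : P v := by
  rcases v with a | ⟨b, h⟩
  · exact h1 a
  · exact h2 b h

/-- The forest that is glued from `X` and the string at the positions `j` with `χ j = 0` and
is the string at the other positions. -/
def Over.glue : OForest n where
  V := X.GlueV χ
  ord j := inferInstance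
  fin j := inferInstanceAs (Fintype (Fin (t.obj j).card ⊕ {_b : X.B j // χ j = 0}))
  ne j := ⟨toLex (Sum.inl ⟨0, (t.obj j).pos⟩)⟩
  tr := X.glueTr χ
  tr_self {i} h v := by
    refine X.glue_cases χ (P := fun v => X.glueTr χ h v = v) v (fun a => ?_) fun b hi => ?_
    · rw [X.glueTr_inl, t.tr_self]
    · rw [X.glueTr_inr χ h b hi hi, X.tr_self]
  tr_tr {i j l} h h' v := by
    refine X.glue_cases χ (P := fun v => X.glueTr χ h' (X.glueTr χ h v) = X.glueTr χ _ v) v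
      (fun a => ?_) fun b hi => ?_
    · rw [X.glueTr_inl, X.glueTr_inl, X.glueTr_inl, t.tr_tr]
    · by_cases hl : χ l = 0
      · have hj := eq_zero_of_monotone χ h' hl
        rw [X.glueTr_inr χ h b hi hj, X.glueTr_inr χ h' _ hj hl, X.glueTr_inr χ _ b hi hl,
          X.tr_tr]
      · rw [X.glueTr_inr' χ _ b hi hl]
        by_cases hj : χ j = 0
        · rw [X.glueTr_inr χ h b hi hj, X.glueTr_inr' χ h' _ hj hl, X.proj_tr, t.tr_tr]
        · rw [X.glueTr_inr' χ h b hi hj, X.glueTr_inl, t.tr_tr]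
  tr_surj {i j} h v := by
    refine X.glue_cases χ (P := fun v => ∃ a, X.glueTr χ h a = v) v (fun a => ?_) fun b hj => ?_
    · obtain ⟨a, rfl⟩ := t.tr_surjective h a
      exact ⟨_, X.glueTr_inl χ h a⟩
    · obtain ⟨b, rfl⟩ := X.tr_surj h b
      exact ⟨_, X.glueTr_inr χ h b (eq_zero_of_monotone χ h hj) hj⟩

/-- The copy of an element of `X` in the glued forest. -/
def Over.lift {j : Fin (n + 1)} (b : X.B j) : X.GlueV χ j :=
  if hj : χ j = 0 then toLex (Sum.inr ⟨b, hj⟩) else toLex (Sum.inl (X.proj b))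

/-- The copy of X moves through the glued forest without regard to where the cut lies. The marks
hence stay on X under every operator. -/
theorem Over.glueTr_lift {i j : Fin (n + 1)} (h : i ≤ j) (b : X.B i) :
    X.glueTr χ h (X.lift χ b) = X.lift χ (X.tr h b) := by
  by_cases hj : χ j = 0
  · have hi := eq_zero_of_monotone χ h hj
    rw [Over.lift, Over.lift, dif_pos hi, dif_pos hj, X.glueTr_inr χ h b hi hj]
  · rw [Over.lift, Over.lift, dif_neg hj]
    split_ifs with hi
    · rw [X.glueTr_inr' χ h b hi hj, X.proj_tr]
    · rw [X.glueTr_inl, X.proj_tr]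

/-- The number of a vertex of the glued forest. -/
def Over.gidx {j : Fin (n + 1)} (v : X.GlueV χ j) : Fin ((X.glue χ).toStr.obj j).card :=
  (X.glue χ).idx v

theorem Over.gidx_strictMono {j : Fin (n + 1)} : StrictMono (X.gidx χ (j := j)) :=
  (X.glue χ).idx_strictMono

theorem Over.gidx_injective {j : Fin (n + 1)} : Function.Injective (X.gidx χ (j := j)) :=
  (X.gidx_strictMono χ).injective

theorem Over.gidx_surjective {j : Fin (n + 1)} : Function.Surjective (X.gidx χ (j := j)) :=
  (X.glue χ).idx_surjective

theorem Over.glue_tr {i j : Fin (n + 1)} (h : i ≤ j) (v : X.GlueV χ i) :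
    (X.glue χ).toStr.tr h (X.gidx χ v) = X.gidx χ (X.glueTr χ h v) :=
  (X.glue χ).toStr_tr h v

theorem Gam.map_comp_apply {k : Type u} [CommRing k] (F : Gam ⥤ ModuleCat.{u} k) {p q r : Gam}
    (f : p ⟶ q) (g : q ⟶ r) (v : F.obj p) :
    (F.map g).hom ((F.map f).hom v) = (F.map (f ≫ g)).hom v := by
  rw [F.map_comp]
  rfl

/-! ### Marks -/

/-- The basepoint-preserving map that is given by a partially defined map to the vertices of `X`
in the first set of the glued forest. -/
def Over.marks {p : ℕ} (μ : Fin p → Option (X.B 0)) :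
    (⟨p⟩ : Gam) ⟶ ⟨((X.glue χ).toStr.obj 0).card⟩ :=
  ⟨Fin.cases 0 fun i => (μ i).elim 0 fun b => (X.gidx χ (X.lift χ b)).succ, rfl⟩

theorem Over.marks_eq_succ {p : ℕ} (μ : Fin p → Option (X.B 0)) (i : Fin p)
    (a : Fin ((X.glue χ).toStr.obj 0).card) : (X.marks χ μ).1 i.succ = a.succ ↔
      ∃ b, μ i = some b ∧ X.gidx χ (X.lift χ b) = a := by
  change (μ i).elim 0 (fun b => (X.gidx χ (X.lift χ b)).succ) = a.succ ↔ _
  cases h : μ i with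
  | none => simpa using fun h => Fin.succ_ne_zero a h.symm
  | some b => simp

variable {k : Type u} [CommRing k] (F : Gam ⥤ ModuleCat.{u} k)

/-- The sum of the components of the glued forest, with the coefficient given by marks. -/
def Over.glueSum {p : ℕ} (μ : Fin p → Option (X.B 0)) :
    F.obj ⟨p⟩ →ₗ[k] RWMod (GamSurj.incl ⋙ F) n :=
  RWMod.forest (GamSurj.incl ⋙ F) (X.glue χ).toStr ∘ₗ (F.map (X.marks χ μ)).hom

/-- Pulling back a glued forest is, by definition, gluing the pullbacks along χ ∘ θ; only the marks
have to be compared, by `Over.glueTr_lift`. This is the naturality in the simplicial direction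
needed for a homotopy. -/
theorem Over.map_glueSum {m p : ℕ} (μ : Fin p → Option (X.B 0)) (θ : Fin (m + 1) →o Fin (n + 1))
    (v : F.obj ⟨p⟩) : RWMod.map (GamSurj.incl ⋙ F) θ (X.glueSum χ F μ v) =
      (X.pull θ).glueSum (χ.comp θ) F (fun i => (μ i).map (X.tr (Fin.zero_le (θ 0)))) v := by
  refine (RWMod.map_forest (GamSurj.incl ⋙ F) θ (X.glue χ).toStr _).trans ?_
  refine congrArg (RWMod.forest (GamSurj.incl ⋙ F) ((X.pull θ).glue (χ.comp θ)).toStr) ?_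
  have h : X.marks χ μ ≫ GamSurj.incl.map ((X.glue χ).toStr.pullHom θ) =
      (X.pull θ).marks (χ.comp θ) (fun i => (μ i).map (X.tr (Fin.zero_le (θ 0)))) := by
    refine Gam.hom_ext_succ _ _ fun i a => ?_
    refine (Gam.comp_eq_succ _ _ i a).trans (Iff.trans ?_ ((X.pull θ).marks_eq_succ (χ.comp θ) _ i a).symm)
    constructor
    · rintro ⟨b, hb, hb'⟩
      obtain ⟨b, hμ, rfl⟩ := (X.marks_eq_succ χ μ i b).1 hb
      refine ⟨X.tr (Fin.zero_le (θ 0)) b, by rw [hμ]; rfl, ?_⟩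
      refine Eq.trans ?_ (((X.glue χ).toStr.pullHom_eq_succ θ _ a).1 hb')
      refine Eq.trans ?_ (X.glue_tr χ (Fin.zero_le (θ 0)) (X.lift χ b)).symm
      exact congrArg (X.gidx χ) (X.glueTr_lift χ (Fin.zero_le (θ 0)) b).symm
    · rintro ⟨b', hb', rfl⟩
      obtain ⟨b, hb, rfl⟩ := Option.map_eq_some_iff.1 hb'
      refine ⟨_, (X.marks_eq_succ χ μ i _).2 ⟨b, hb, rfl⟩,
        ((X.glue χ).toStr.pullHom_eq_succ θ _ _).2 ?_⟩
      refine (X.glue_tr χ (Fin.zero_le (θ 0)) (X.lift χ b)).trans ?_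
      exact congrArg (X.gidx χ) (X.glueTr_lift χ (Fin.zero_le (θ 0)) b)
  rw [← h]
  exact Gam.map_comp_apply F _ (GamSurj.incl.map ((X.glue χ).toStr.pullHom θ)) v

/-- The decomposition `RWMod.forest_eq_sum` for glued forests, stated with the vertices themselves
in place of their numbers. A sub-forest receives exactly the marks that land in it. -/
theorem Over.forest_glueSum {p : ℕ} (μ : Fin p → Option (X.B 0)) {ι : Type*} [Fintype ι]
    (s : ι → Str n) (e : ∀ c j, Fin ((s c).obj j).card → X.GlueV χ j)
    (he : ∀ c j, StrictMono (e c j))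
    (hes : ∀ c i j (h : i ≤ j) a, e c j ((s c).tr h a) = X.glueTr χ h (e c i a))
    (hcl : ∀ c j g a, X.glueTr χ (Fin.le_last j) g = e c (Fin.last n) a → g ∈ Set.range (e c j))
    (hb : Function.Bijective fun p : Σ c, Fin ((s c).obj (Fin.last n)).card =>
      e p.1 (Fin.last n) p.2)
    (ρ : ∀ c, (⟨p⟩ : Gam) ⟶ ⟨((s c).obj 0).card⟩)
    (hρ : ∀ c i a, (ρ c).1 i.succ = a.succ ↔ ∃ b, μ i = some b ∧ X.lift χ b = e c 0 a)
    (v : F.obj ⟨p⟩) : X.glueSum χ F μ v =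
      ∑ c, RWMod.forest (GamSurj.incl ⋙ F) (s c) ((F.map (ρ c)).hom v) := by
  refine (RWMod.forest_eq_sum (GamSurj.incl ⋙ F) (X.glue χ).toStr s
    (fun c j a => X.gidx χ (e c j a)) (fun c j => (X.gidx_strictMono χ).comp (he c j))
    (fun c i j h a => ?_) (fun c j g a h => ?_) ?_ _).trans (Finset.sum_congr rfl fun c _ => ?_)
  · rw [hes]
    exact (X.glue_tr χ h _).symm
  · obtain ⟨g, rfl⟩ := X.gidx_surjective χ g
    rw [X.glue_tr χ] at h
    obtain ⟨y, rfl⟩ := hcl c j g a (X.gidx_injective χ h)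
    exact ⟨y, rfl⟩
  · exact Function.Bijective.comp ⟨X.gidx_injective χ, X.gidx_surjective χ⟩ hb
  · refine congrArg (RWMod.forest (GamSurj.incl ⋙ F) (s c)) ?_
    have h : X.marks χ μ ≫ GamSurj.incl.map (GamSurj.pinch (fun a => X.gidx χ (e c 0 a))
        ((X.gidx_strictMono χ).comp (he c 0)).injective) = ρ c := by
      refine Gam.hom_ext_succ _ _ fun i a => ?_
      refine (Gam.comp_eq_succ _ _ i a).trans (Iff.trans ?_ (hρ c i a).symm)
      constructor
      · rintro ⟨b, hb, hb'⟩
        obtain ⟨b, hμ, rfl⟩ := (X.marks_eq_succ χ μ i b).1 hb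
        exact ⟨b, hμ, X.gidx_injective χ ((GamSurj.pinch_eq_succ (fun a => X.gidx χ (e c 0 a))
          ((X.gidx_strictMono χ).comp (he c 0)).injective _ a).1 hb')⟩
      · rintro ⟨b, hμ, hb⟩
        exact ⟨_, (X.marks_eq_succ χ μ i _).2 ⟨b, hμ, rfl⟩,
          (GamSurj.pinch_eq_succ (fun a => X.gidx χ (e c 0 a))
            ((X.gidx_strictMono χ).comp (he c 0)).injective _ a).2 (congrArg (X.gidx χ) hb)⟩
    rw [← h]
    exact Gam.map_comp_apply F (X.marks χ μ) (GamSurj.incl.map _) v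

end Gluing

end GammaHomology

end

noncomputable section

namespace GammaHomology

/-! ### Decomposition of glued forests, and the two extreme cuts. -/

section GlueSum

variable {n : ℕ} {t : Str n} (X : Over t) (χ : Fin (n + 1) →o Fin 2)
variable {k : Type u} [CommRing k] (F : Gam ⥤ ModuleCat.{u} k)

/-- The projection of the glued forest to the string. -/
def Over.glueProj {j : Fin (n + 1)} (v : X.GlueV χ j) : Fin (t.obj j).card :=
  Sum.elim id (fun b => X.proj b.1) (ofLex v)

/-- Merging takes place along the projection, so the string under a vertex does not notice the cut.
-/
theorem Over.glueProj_tr {i j : Fin (n + 1)} (h : i ≤ j) (v : X.GlueV χ i) :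
    X.glueProj χ (X.glueTr χ h v) = t.tr h (X.glueProj χ v) := by
  refine X.glue_cases χ (P := fun v => X.glueProj χ (X.glueTr χ h v) = t.tr h (X.glueProj χ v)) v
    (fun a => rfl) fun b hi => ?_
  by_cases hj : χ j = 0
  · rw [X.glueTr_inr χ h b hi hj]
    exact X.proj_tr h b
  · rw [X.glueTr_inr' χ h b hi hj]
    rfl

/-- A family of forests over the components of a string which are the preimages of the components
in a forest over the string. -/
structure Over.Components where
  /-- the forests over the components -/
  X' : ∀ c, Over (t.component c)
  /-- the inclusions -/
  β : ∀ c {j : Fin (n + 1)}, (X' c).B j → X.B j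
  strictMono : ∀ c (j : Fin (n + 1)), StrictMono (β c (j := j))
  tr : ∀ c {i j : Fin (n + 1)} (h : i ≤ j) b, β c ((X' c).tr h b) = X.tr h (β c b)
  proj : ∀ c {j : Fin (n + 1)} b, X.proj (β c (j := j) b) = t.cemb c j ((X' c).proj b)
  mem_range : ∀ c {j : Fin (n + 1)} (b : X.B j), t.tr (Fin.le_last j) (X.proj b) = c →
    b ∈ Set.range (β c (j := j))

variable {X}

/-- The inclusion of a component of the glued forest. -/
def Over.Components.gmap (Y : X.Components) (c : Fin (t.obj (Fin.last n)).card)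
    {j : Fin (n + 1)} (v : (Y.X' c).GlueV χ j) : X.GlueV χ j :=
  toLex (Sum.map (t.cemb c j) (fun b => ⟨Y.β c b.1, b.2⟩) (ofLex v))

theorem Over.Components.gmap_strictMono (Y : X.Components) (c : Fin (t.obj (Fin.last n)).card)
    (j : Fin (n + 1)) : StrictMono (Y.gmap χ c (j := j)) := by
  intro v w
  refine (Y.X' c).glue_cases χ (P := fun v => v < w → Y.gmap χ c v < Y.gmap χ c w) v
    (fun a => ?_) (fun a ha => ?_) <;>
  refine (Y.X' c).glue_cases χ (P := fun w => _ < w → Y.gmap χ c _ < Y.gmap χ c w) w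
    (fun b h => ?_) (fun b hb h => ?_)
  · exact Sum.Lex.inl_lt_inl_iff.2 (t.cemb_strictMono c j (Sum.Lex.inl_lt_inl_iff.1 h))
  · exact Sum.Lex.inl_lt_inr _ _
  · exact (Sum.Lex.not_inr_lt_inl h).elim
  · have hab : (⟨a, ha⟩ : {_b : (Y.X' c).B j // χ j = 0}) < ⟨b, hb⟩ := Sum.Lex.inr_lt_inr_iff.1 h
    have hab' : (⟨Y.β c a, ha⟩ : {_b : X.B j // χ j = 0}) < ⟨Y.β c b, hb⟩ :=
      Y.strictMono c j (Subtype.mk_lt_mk.1 hab)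
    exact Sum.Lex.inr_lt_inr_iff.2 hab'

theorem Over.Components.gmap_tr (Y : X.Components) (c : Fin (t.obj (Fin.last n)).card)
    {i j : Fin (n + 1)} (h : i ≤ j) (v : (Y.X' c).GlueV χ i) :
    Y.gmap χ c ((Y.X' c).glueTr χ h v) = X.glueTr χ h (Y.gmap χ c v) := by
  refine (Y.X' c).glue_cases χ (P := fun v => Y.gmap χ c ((Y.X' c).glueTr χ h v) =
    X.glueTr χ h (Y.gmap χ c v)) v (fun a => ?_) fun b hi => ?_
  · exact congrArg (fun a => toLex (Sum.inl a)) (t.cemb_tr c h a)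
  · by_cases hj : χ j = 0
    · rw [(Y.X' c).glueTr_inr χ h b hi hj]
      refine Eq.trans ?_ (X.glueTr_inr χ h (Y.β c b) hi hj).symm
      exact congrArg toLex (congrArg Sum.inr (Subtype.ext (Y.tr c h b)))
    · rw [(Y.X' c).glueTr_inr' χ h b hi hj]
      refine Eq.trans ?_ (X.glueTr_inr' χ h (Y.β c b) hi hj).symm
      refine congrArg (fun a => toLex (Sum.inl a)) ?_
      rw [Y.proj]
      exact t.cemb_tr c h _

theorem Over.Components.glueProj_gmap (Y : X.Components) (c : Fin (t.obj (Fin.last n)).card)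
    {j : Fin (n + 1)} (v : (Y.X' c).GlueV χ j) :
    X.glueProj χ (Y.gmap χ c v) = t.cemb c j ((Y.X' c).glueProj χ v) := by
  refine (Y.X' c).glue_cases χ (P := fun v => X.glueProj χ (Y.gmap χ c v) =
    t.cemb c j ((Y.X' c).glueProj χ v)) v (fun a => rfl) fun b hi => ?_
  exact Y.proj c b

theorem Over.Components.mem_range_gmap (Y : X.Components) (c : Fin (t.obj (Fin.last n)).card)
    {j : Fin (n + 1)} (v : X.GlueV χ j) (h : t.tr (Fin.le_last j) (X.glueProj χ v) = c) :
    ∃ w, Y.gmap χ c w = v := by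
  revert h
  refine X.glue_cases χ (P := fun v => t.tr (Fin.le_last j) (X.glueProj χ v) = c →
    ∃ w, Y.gmap χ c w = v) v (fun a h => ?_) fun b hi h => ?_
  · have ha : a ∈ Set.range (t.cemb c j) := by rw [t.range_cemb]; exact h
    obtain ⟨a, rfl⟩ := ha
    exact ⟨toLex (Sum.inl a), rfl⟩
  · obtain ⟨b, rfl⟩ := Y.mem_range c b h
    exact ⟨toLex (Sum.inr ⟨b, hi⟩), rfl⟩

theorem Over.Components.gmap_lift (Y : X.Components) (c : Fin (t.obj (Fin.last n)).card)
    {j : Fin (n + 1)} (b : (Y.X' c).B j) :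
    Y.gmap χ c ((Y.X' c).lift χ b) = X.lift χ (Y.β c b) := by
  rw [Over.lift, Over.lift]
  split_ifs with h
  · rfl
  · exact congrArg (fun a => toLex (Sum.inl a)) (Y.proj c b).symm

theorem Over.tr_proj_lift {j : Fin (n + 1)} (b : X.B j) :
    X.glueProj χ (X.lift χ b) = X.proj b := by
  rw [Over.lift]
  split_ifs with h <;> rfl

variable (X)

/-- The vertex of the glued forest with a given number. -/
def Over.vert {j : Fin (n + 1)} (a : Fin ((X.glue χ).toStr.obj j).card) : X.GlueV χ j :=
  (X.glue χ).num j a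

theorem Over.vert_gidx {j : Fin (n + 1)} (v : X.GlueV χ j) : X.vert χ (X.gidx χ v) = v :=
  ((X.glue χ).num j).apply_symm_apply v

theorem Over.vert_strictMono {j : Fin (n + 1)} : StrictMono (X.vert χ (j := j)) :=
  ((X.glue χ).num j).strictMono

theorem Over.vert_injective {j : Fin (n + 1)} : Function.Injective (X.vert χ (j := j)) :=
  (X.vert_strictMono χ).injective

theorem Over.vert_tr {i j : Fin (n + 1)} (h : i ≤ j) (a : Fin ((X.glue χ).toStr.obj i).card) :
    X.vert χ ((X.glue χ).toStr.tr h a) = X.glueTr χ h (X.vert χ a) := by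
  obtain ⟨v, rfl⟩ := X.gidx_surjective χ a
  exact (congrArg (X.vert χ) (X.glue_tr χ h v)).trans
    ((X.vert_gidx χ _).trans (congrArg (X.glueTr χ h) (X.vert_gidx χ v).symm))

variable {X}

/-- The glued forest is the sum of its parts over the components of the string. -/
theorem Over.Components.glueSum_eq_sum (Y : X.Components) {p : ℕ} (μ : Fin p → Option (X.B 0))
    (μ' : ∀ c, Fin p → Option ((Y.X' c).B 0))
    (hμ : ∀ c i b, μ' c i = some b ↔ μ i = some (Y.β c b)) (v : F.obj ⟨p⟩) :
    X.glueSum χ F μ v = ∑ c, (Y.X' c).glueSum χ F (μ' c) v := by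
  -- The root under a vertex determines the part that contains it; disjointness and exhaustion both
  -- follow from this.
  have hcomp : ∀ c j (w : (Y.X' c).GlueV χ j),
      t.tr (Fin.le_last j) (X.glueProj χ (Y.gmap χ c w)) = c := fun c j w => by
    rw [Y.glueProj_gmap, t.tr_cemb]
  refine X.forest_glueSum χ F μ (fun c => ((Y.X' c).glue χ).toStr)
    (fun c j a => Y.gmap χ c ((Y.X' c).vert χ a))
    (fun c j => (Y.gmap_strictMono χ c j).comp ((Y.X' c).vert_strictMono χ))
    (fun c i j h a => ?_) (fun c j g a h => ?_) ⟨?_, ?_⟩ (fun c => (Y.X' c).marks χ (μ' c))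
    (fun c i a => ?_) v
  · exact (congrArg (Y.gmap χ c) ((Y.X' c).vert_tr χ h a)).trans (Y.gmap_tr χ c h _)
  · have h1 := (X.glueProj_tr χ (Fin.le_last j) g).symm.trans
      ((t.tr_self le_rfl _).symm.trans
        ((congrArg (fun g => t.tr le_rfl (X.glueProj χ g)) h).trans
          (hcomp c (Fin.last n) ((Y.X' c).vert χ a))))
    obtain ⟨w, rfl⟩ := Y.mem_range_gmap χ c g h1
    exact ⟨(Y.X' c).gidx χ w, congrArg (Y.gmap χ c) ((Y.X' c).vert_gidx χ w)⟩
  · rintro ⟨c, a⟩ ⟨c', a'⟩ (h : Y.gmap χ c ((Y.X' c).vert χ a) = Y.gmap χ c' ((Y.X' c').vert χ a'))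
    have hc : c = c' := (hcomp c _ ((Y.X' c).vert χ a)).symm.trans
      ((congrArg (fun g => t.tr le_rfl (X.glueProj χ g)) h).trans
        (hcomp c' _ ((Y.X' c').vert χ a')))
    subst hc
    exact congrArg (Sigma.mk c)
      ((Y.X' c).vert_injective χ ((Y.gmap_strictMono χ c _).injective h))
  · intro g
    obtain ⟨w, hw⟩ := Y.mem_range_gmap χ _ g rfl
    exact ⟨⟨_, (Y.X' _).gidx χ w⟩, (congrArg (Y.gmap χ _) ((Y.X' _).vert_gidx χ w)).trans hw⟩
  · refine ((Y.X' c).marks_eq_succ χ (μ' c) i a).trans ?_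
    constructor
    · rintro ⟨b, hb, rfl⟩
      exact ⟨_, (hμ c i b).1 hb, ((congrArg (Y.gmap χ c) ((Y.X' c).vert_gidx χ _)).trans
        (Y.gmap_lift χ c b)).symm⟩
    · rintro ⟨b, hb, hb'⟩
      obtain ⟨b, rfl⟩ := Y.mem_range c b
        ((congrArg (t.tr _) ((X.tr_proj_lift χ b).symm.trans (congrArg (X.glueProj χ) hb'))).trans
          (hcomp c 0 _))
      refine ⟨b, (hμ c i b).2 hb, (Y.X' c).vert_injective χ
        (((Y.X' c).vert_gidx χ _).trans ((Y.gmap_strictMono χ c 0).injective ?_))⟩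
      exact (Y.gmap_lift χ c b).trans hb'

variable (X)

/-- Relabelling the marks along κ amounts to applying κ to the coefficient. This reconciles marks
made before and after the passage to a component. -/
theorem Over.glueSum_map {p q : ℕ} (μ : Fin p → Option (X.B 0)) (μ' : Fin q → Option (X.B 0))
    (κ : (⟨p⟩ : Gam) ⟶ ⟨q⟩)
    (h : ∀ i b, μ i = some b ↔ ∃ i' : Fin q, κ.1 i.succ = i'.succ ∧ μ' i' = some b)
    (v : F.obj ⟨p⟩) : X.glueSum χ F μ' ((F.map κ).hom v) = X.glueSum χ F μ v := by
  refine congrArg (RWMod.forest (GamSurj.incl ⋙ F) (X.glue χ).toStr) ?_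
  have h' : κ ≫ X.marks χ μ' = X.marks χ μ := by
    refine Gam.hom_ext_succ _ _ fun i a => ?_
    refine (Gam.comp_eq_succ κ (X.marks χ μ') i a).trans
      (Iff.trans ?_ (X.marks_eq_succ χ μ i a).symm)
    constructor
    · rintro ⟨b, hb, hb'⟩
      obtain ⟨b', hμ', rfl⟩ := (X.marks_eq_succ χ μ' b a).1 hb'
      exact ⟨b', (h i b').2 ⟨b, hb, hμ'⟩, rfl⟩
    · rintro ⟨b', hb', rfl⟩
      obtain ⟨i', hi', hb'⟩ := (h i b').1 hb'
      exact ⟨i', hi', (X.marks_eq_succ χ μ' i' _).2 ⟨b', hb', rfl⟩⟩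
  rw [← h']
  exact Gam.map_comp_apply F κ (X.marks χ μ') v

/-- If nothing is glued to it, the glued forest is the string. -/
theorem Over.glueSum_one (s : OneStr n) (X : Over s.str) (hχ : ∀ j, χ j ≠ 0) {p : ℕ}
    (μ : Fin p → Option (X.B 0)) (ρ : (⟨p⟩ : Gam) ⟶ ⟨s.dom⟩)
    (hρ : ∀ i a, ρ.1 i.succ = a.succ ↔ ∃ b, μ i = some b ∧ X.proj b = a) (v : F.obj ⟨p⟩) :
    X.glueSum χ F μ v = RWMod.of (GamSurj.incl ⋙ F) s ((F.map ρ).hom v) := by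
  have hsurj : ∀ j (g : X.GlueV χ j), ∃ a, (toLex (Sum.inl a) : X.GlueV χ j) = g := fun j g =>
    X.glue_cases χ (P := fun g => ∃ a, (toLex (Sum.inl a) : X.GlueV χ j) = g) g
      (fun a => ⟨a, rfl⟩) fun b h => (hχ j h).elim
  refine (X.forest_glueSum χ F μ (fun _ : Unit => s.str) (fun _ _ a => toLex (Sum.inl a))
    (fun _ _ => Sum.Lex.inl_strictMono) (fun _ _ _ _ _ => rfl) (fun _ j g _ _ => hsurj j g)
    ⟨?_, ?_⟩ (fun _ => ρ) (fun _ i a => (hρ i a).trans ?_) v).trans ?_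
  · rintro ⟨_, a⟩ ⟨_, b⟩ h
    have : a = b := Sum.inl.inj (toLex.injective h)
    rw [this]
  · intro g
    obtain ⟨a, rfl⟩ := hsurj _ g
    exact ⟨⟨(), a⟩, rfl⟩
  · refine exists_congr fun b => and_congr_right fun _ => ?_
    rw [Over.lift, dif_neg (hχ 0)]
    exact ⟨fun h => congrArg _ (congrArg _ h), fun h => Sum.inl.inj (toLex.injective h)⟩
  · rw [Fintype.sum_unique]
    exact RWMod.forest_of_last (GamSurj.incl ⋙ F) s _

/-- If everything is glued, the glued forest is the disjoint union of the string and the forest. -/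
theorem Over.glueSum_zero (s : OneStr n) (X : Over s.str) (hχ : ∀ j, χ j = 0) {p : ℕ}
    (μ : Fin p → Option (X.B 0)) {ι : Type} [Fintype ι] (r : ι → OneStr n)
    (e : ∀ c j, Fin ((r c).str.obj j).card → X.B j) (he : ∀ c j, StrictMono (e c j))
    (hes : ∀ c i j (h : i ≤ j) a, e c j ((r c).str.tr h a) = X.tr h (e c i a))
    (hcl : ∀ c j b a, X.tr (Fin.le_last j) b = e c (Fin.last n) a → b ∈ Set.range (e c j))
    (hb : Function.Bijective fun p : Σ c, Fin ((r c).str.obj (Fin.last n)).card =>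
      e p.1 (Fin.last n) p.2)
    (ρ : ∀ c, (⟨p⟩ : Gam) ⟶ ⟨(r c).dom⟩)
    (hρ : ∀ c i a, (ρ c).1 i.succ = a.succ ↔ μ i = some (e c 0 a)) (v : F.obj ⟨p⟩) :
    X.glueSum χ F μ v =
      RWMod.of (GamSurj.incl ⋙ F) s ((F.map (⟨fun _ => 0, rfl⟩ : (⟨p⟩ : Gam) ⟶ ⟨s.dom⟩)).hom v) +
      ∑ c, RWMod.of (GamSurj.incl ⋙ F) (r c) ((F.map (ρ c)).hom v) := by
  have hl : ∀ b : X.B 0, X.lift χ b = toLex (Sum.inr ⟨b, hχ 0⟩) := fun b => dif_pos (hχ 0)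
  -- The index `none` is the string and `some c` is a tree of X. Marks are lifted to the copy of X,
  -- so the string receives none and its coefficient is pushed along the zero map.
  refine (X.forest_glueSum χ F μ (fun c : Option ι => (c.elim s r).str)
    (fun c j => match c with
      | none => fun a => toLex (Sum.inl a)
      | some c => fun a => toLex (Sum.inr ⟨e c j a, hχ j⟩))
    (fun c j => ?_) (fun c i j h a => ?_) (fun c j g a h => ?_) ⟨?_, ?_⟩
    (fun c => match c with
      | none => ⟨fun _ => 0, rfl⟩
      | some c => ρ c) (fun c i a => ?_) v).trans ?_
  · cases c with
    | none => exact Sum.Lex.inl_strictMono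
    | some c => exact fun a b h => Sum.Lex.inr_lt_inr_iff.2 (he c j h)
  · cases c with
    | none => rfl
    | some c =>
      refine Eq.trans ?_ (X.glueTr_inr χ h _ (hχ i) (hχ j)).symm
      exact congrArg toLex (congrArg Sum.inr (Subtype.ext (hes c i j h a)))
  · cases c with
    | none =>
      revert h
      refine X.glue_cases χ (P := fun g => X.glueTr χ (Fin.le_last j) g = toLex (Sum.inl a) →
        g ∈ Set.range fun a => toLex (Sum.inl a)) g (fun b _ => ⟨b, rfl⟩) fun b hj h => ?_
      rw [X.glueTr_inr χ _ b hj (hχ _)] at h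
      exact (Sum.inr_ne_inl (toLex.injective h)).elim
    | some c =>
      revert h
      refine X.glue_cases χ (P := fun g => X.glueTr χ (Fin.le_last j) g =
        toLex (Sum.inr ⟨e c (Fin.last n) a, hχ _⟩) →
        g ∈ Set.range fun a => toLex (Sum.inr ⟨e c j a, hχ j⟩)) g (fun b h => ?_) fun b hj h => ?_
      · exact (Sum.inl_ne_inr (toLex.injective h)).elim
      · rw [X.glueTr_inr χ _ b hj (hχ _)] at h
        obtain ⟨a, rfl⟩ := hcl c j b a (congrArg Subtype.val (Sum.inr.inj (toLex.injective h)))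
        exact ⟨a, rfl⟩
  · rintro ⟨_ | c, a⟩ ⟨_ | c', a'⟩ h
    · have : a = a' := Sum.inl.inj (toLex.injective h)
      rw [this]
    · exact (Sum.inl_ne_inr (toLex.injective h)).elim
    · exact (Sum.inr_ne_inl (toLex.injective h)).elim
    · have h1 := hb.1 (a₁ := ⟨c, a⟩) (a₂ := ⟨c', a'⟩)
        (congrArg Subtype.val (Sum.inr.inj (toLex.injective h)))
      obtain ⟨rfl, h2⟩ := Sigma.mk.inj h1
      rw [eq_of_heq h2]
  · intro g
    refine X.glue_cases χ (P := fun g => g ∈ Set.range fun p : Σ c : Option ι,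
      Fin ((c.elim s r).str.obj (Fin.last n)).card => (match p.1 with
      | none => fun a => toLex (Sum.inl a)
      | some c => fun a => toLex (Sum.inr ⟨e c (Fin.last n) a, hχ _⟩) :
        Fin ((p.1.elim s r).str.obj (Fin.last n)).card → X.GlueV χ (Fin.last n)) p.2) g (fun a => ⟨⟨none, a⟩, rfl⟩) fun b _ => ?_
    obtain ⟨⟨c, a⟩, rfl⟩ := hb.2 b
    exact ⟨⟨some c, a⟩, rfl⟩
  · cases c with
    | none =>
      refine ⟨fun h => (Fin.succ_ne_zero a h.symm).elim, fun ⟨b, _, h⟩ => ?_⟩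
      rw [hl] at h
      exact (Sum.inr_ne_inl (toLex.injective h)).elim
    | some c =>
      refine (hρ c i a).trans ⟨fun h => ⟨_, h, hl _⟩, fun ⟨b, hb, h⟩ => ?_⟩
      rw [hl] at h
      rw [hb]
      exact congrArg some (congrArg Subtype.val (Sum.inr.inj (toLex.injective h)))
  · rw [Fintype.sum_option]
    refine congrArg₂ (· + ·) (RWMod.forest_of_last (GamSurj.incl ⋙ F) s _)
      (Finset.sum_congr rfl fun c _ => RWMod.forest_of_last (GamSurj.incl ⋙ F) (r c) _)

end GlueSum

end GammaHomology

end

noncomputable section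

namespace GammaHomology

/-! ### Simplicial homotopies from families indexed by maps to the interval. -/

section Homotopies

open scoped Simplicial

/-- The map `{0, …, n + 1} → {0, 1}` that sends exactly the elements up to `i` to `0`. -/
def cut {n : ℕ} (i : Fin (n + 1)) : Fin (n + 1 + 1) →o Fin 2 where
  toFun j := if j ≤ i.castSucc then 0 else 1
  monotone' a b h := by
    dsimp only
    split_ifs with h1 h2
    · exact le_rfl
    · exact Fin.zero_le _
    · exact (h1 (h.trans ‹_›)).elim
    · exact le_rfl

theorem cut_apply {n : ℕ} (i : Fin (n + 1)) (j : Fin (n + 1 + 1)) :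
    cut i j = if (j : ℕ) ≤ i then 0 else 1 := rfl

section Family

variable {C : Type*} [Category* C] {X Y : SimplicialObject C}
  (H : ∀ n, (Fin (n + 1) →o Fin 2) → (X.obj (op ⦋n⦌) ⟶ Y.obj (op ⦋n⦌)))

/-- With h_i composed of the degeneracy s_i and H at the cut after i, naturality of H reduces each
homotopy identity to an identity of monotone maps and an equality of cuts. -/
theorem family_comp_map
    (hH : ∀ {m n : ℕ} (θ : ⦋m⦌ ⟶ ⦋n⦌) (χ : Fin (n + 1) →o Fin 2),
      H n χ ≫ Y.map θ.op = X.map θ.op ≫ H m (χ.comp θ.toOrderHom))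
    {m n l p : ℕ} (θ : ⦋m⦌ ⟶ ⦋n⦌) (ψ : ⦋n⦌ ⟶ ⦋p⦌) (χ : Fin (n + 1) →o Fin 2)
    (ψ' : ⦋m⦌ ⟶ ⦋l⦌) (θ' : ⦋l⦌ ⟶ ⦋p⦌) (χ' : Fin (m + 1) →o Fin 2) (h1 : θ ≫ ψ = ψ' ≫ θ')
    (h2 : ∀ j, χ (θ.toOrderHom j) = χ' j) :
    (X.map ψ.op ≫ H n χ) ≫ Y.map θ.op = X.map θ'.op ≫ X.map ψ'.op ≫ H m χ' := by
  obtain rfl : χ.comp θ.toOrderHom = χ' := OrderHom.ext _ _ (funext h2)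
  rw [Category.assoc, hH, ← Category.assoc, ← Category.assoc, ← X.map_comp, ← X.map_comp,
    ← op_comp, ← op_comp, h1]

theorem family_comp_map_of_eq_id
    (hH : ∀ {m n : ℕ} (θ : ⦋m⦌ ⟶ ⦋n⦌) (χ : Fin (n + 1) →o Fin 2),
      H n χ ≫ Y.map θ.op = X.map θ.op ≫ H m (χ.comp θ.toOrderHom))
    {m n : ℕ} (θ : ⦋m⦌ ⟶ ⦋n⦌) (ψ : ⦋n⦌ ⟶ ⦋m⦌)
    (χ : Fin (n + 1) →o Fin 2) (h1 : θ ≫ ψ = 𝟙 _) :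
    (X.map ψ.op ≫ H n χ) ≫ Y.map θ.op = H m (χ.comp θ.toOrderHom) := by
  rw [Category.assoc, hH, ← Category.assoc, ← X.map_comp, ← op_comp, h1, op_id, X.map_id,
    Category.id_comp]

/-- A simplicial homotopy, from a family of maps that depends in a natural way on a map to the
interval. -/
def homotopyOfFamily
    (hH : ∀ {m n : ℕ} (θ : ⦋m⦌ ⟶ ⦋n⦌) (χ : Fin (n + 1) →o Fin 2),
      H n χ ≫ Y.map θ.op = X.map θ.op ≫ H m (χ.comp θ.toOrderHom))
    (f g : X ⟶ Y)
    (hf : ∀ n χ, (∀ j, χ j = 0) → H n χ = f.app (op ⦋n⦌))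
    (hg : ∀ n χ, (∀ j, χ j ≠ 0) → H n χ = g.app (op ⦋n⦌)) :
    SimplicialObject.Homotopy f g where
  -- The degeneracy doubles position i, and the cut passes between its two copies: positions up to i
  -- are sent to 0 and the others to 1.
  h {n} i := X.map (SimplexCategory.σ i).op ≫ H (n + 1) (cut i)
  -- Omitting position 0 removes the only position that is sent to 0, which leaves g. Dually, the
  -- last face of the last h leaves f.
  h_zero_comp_δ_zero n := by
    refine (family_comp_map_of_eq_id H hH (SimplexCategory.δ 0) _ _
      (SimplexCategory.δ_comp_σ_self' rfl)).trans (hg n _ fun j => ?_)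
    change cut 0 (Fin.succAbove 0 j) ≠ 0
    simp [cut_apply]
  h_last_comp_δ_last n := by
    refine (family_comp_map_of_eq_id H hH (SimplexCategory.δ (Fin.last (n + 1))) _ _
      (SimplexCategory.δ_comp_σ_succ' rfl)).trans (hf n _ fun j => ?_)
    change cut (Fin.last n) (Fin.succAbove (Fin.last (n + 1)) j) = 0
    simp [cut_apply]
    omega
  h_succ_comp_δ_castSucc_of_lt i j hij := by
    refine family_comp_map H hH (SimplexCategory.δ i.castSucc) _ _ _ _ _
      (SimplexCategory.δ_comp_σ_of_le hij) fun l => ?_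
    change cut j.succ (Fin.succAbove i.castSucc l) = _
    rw [cut_apply, cut_apply]
    rw [Fin.le_def] at hij
    refine if_congr ?_ rfl rfl
    rw [Fin.succAbove]
    split_ifs with h <;> rw [Fin.lt_def] at h <;> simp at h hij ⊢; omega
  -- The two cuts differ only at position j + 1, which this face omits.
  h_succ_comp_δ_castSucc_succ j := by
    refine (family_comp_map_of_eq_id H hH (SimplexCategory.δ j.castSucc.succ) _ _
      (SimplexCategory.δ_comp_σ_self' rfl)).trans (Eq.trans ?_
      (family_comp_map_of_eq_id H hH (SimplexCategory.δ j.castSucc.succ) _ _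
      (SimplexCategory.δ_comp_σ_succ' rfl)).symm)
    refine congrArg (H _) (OrderHom.ext _ _ (funext fun l => ?_))
    change cut j.succ (Fin.succAbove j.castSucc.succ l) =
      cut j.castSucc (Fin.succAbove j.castSucc.succ l)
    rw [cut_apply, cut_apply]
    refine if_congr ?_ rfl rfl
    rw [Fin.succAbove]
    split_ifs with h <;> rw [Fin.lt_def] at h <;> simp at h ⊢ <;> omega
  h_castSucc_comp_δ_succ_of_lt i j hji := by
    refine family_comp_map H hH (SimplexCategory.δ i.succ) _ _ _ _ _
      (SimplexCategory.δ_comp_σ_of_gt hji) fun l => ?_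
    change cut j.castSucc (Fin.succAbove i.succ l) = _
    rw [cut_apply, cut_apply]
    rw [Fin.lt_def] at hji
    refine if_congr ?_ rfl rfl
    rw [Fin.succAbove]
    split_ifs with h <;> rw [Fin.lt_def] at h <;> simp at h hji ⊢; omega
  h_comp_σ_castSucc_of_le i j hij := by
    refine family_comp_map H hH (SimplexCategory.σ i.castSucc) _ _ _ _ _
      (SimplexCategory.σ_comp_σ hij) fun l => ?_
    change cut j (Fin.predAbove i.castSucc l) = _
    rw [cut_apply, cut_apply]
    rw [Fin.le_def] at hij
    refine if_congr ?_ rfl rfl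
    rw [Fin.predAbove]
    split_ifs with h <;> rw [Fin.lt_def] at h <;> simp at h hij ⊢; omega
  h_comp_σ_succ_of_lt i j hji := by
    refine family_comp_map H hH (SimplexCategory.σ i.succ) _ _ _ _ _
      (SimplexCategory.σ_comp_σ hji).symm fun l => ?_
    change cut j (Fin.predAbove i.succ l) = _
    rw [cut_apply, cut_apply]
    rw [Fin.le_def] at hji
    refine if_congr ?_ rfl rfl
    rw [Fin.predAbove]
    split_ifs with h <;> rw [Fin.lt_def] at h <;> simp at h hji ⊢; omega

end Family

end Homotopies

end GammaHomology

end

noncomputable section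

namespace GammaHomology

/-! ### The zero maps of Γ act trivially on homology. -/

section Retract

open scoped Simplicial

variable {k : Type u} [CommRing k] (F : Gam ⥤ ModuleCat.{u} k)

/-- A basepoint-preserving map as a partially defined map. -/
def Gam.partialMap {p q : ℕ} (φ : (⟨p⟩ : Gam) ⟶ ⟨q⟩) (i : Fin p) : Option (Fin q) :=
  if h : φ.1 i.succ = 0 then none else some ((φ.1 i.succ).pred h)

theorem Gam.partialMap_eq_some {p q : ℕ} (φ : (⟨p⟩ : Gam) ⟶ ⟨q⟩) (i : Fin p) (b : Fin q) :
    Gam.partialMap φ i = some b ↔ φ.1 i.succ = b.succ := by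
  rw [Gam.partialMap]
  split_ifs with h
  · simpa [h] using (Fin.succ_ne_zero b).symm
  · rw [Option.some_inj, Fin.pred_eq_iff_eq_succ]

/-- The strings over the components of a string. -/
def Over.selfComponents {n : ℕ} (t : Str n) : (Over.self t).Components where
  X' c := Over.self (t.component c)
  β c {j} b := t.cemb c j b
  strictMono c j := t.cemb_strictMono c j
  tr c _ _ h b := t.cemb_tr c h b
  proj _ _ _ := rfl
  mem_range c {j} b h := by
    refine (Set.ext_iff.1 (t.range_cemb c j) b).2 h

/-- The endomorphism of a `Γ`-module that is given by the zero maps in `Γ`. -/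
def basepointMap : F ⟶ F where
  app p := F.map (⟨fun _ => 0, rfl⟩ : p ⟶ p)
  naturality {p q} f := by
    rw [← F.map_comp, ← F.map_comp]
    exact congrArg F.map (Subtype.ext (funext fun i => f.2.symm))

theorem rwSimplicialMap_of {F G : GamSurj ⥤ ModuleCat.{u} k} (η : F ⟶ G) {n : ℕ} (s : OneStr n)
    (v : F.obj ⟨s.dom⟩) : ((rwSimplicialMap η).app (op ⦋n⦌)).hom (RWMod.of F s v) =
      RWMod.of G s ((η.app ⟨s.dom⟩).hom v) :=
  DirectSum.lmap_lof (fun s : OneStr n => (η.app ⟨s.dom⟩).hom) s v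

/-- The sum of the forests glued from two copies of a string. -/
def doubling (n : ℕ) (χ : Fin (n + 1) →o Fin 2) :
    RWMod (GamSurj.incl ⋙ F) n →ₗ[k] RWMod (GamSurj.incl ⋙ F) n :=
  DirectSum.toModule k (OneStr n) _ fun s => (Over.self s.str).glueSum χ F some

theorem doubling_of {n : ℕ} (χ : Fin (n + 1) →o Fin 2) (s : OneStr n) (v : F.obj ⟨s.dom⟩) :
    doubling F n χ (RWMod.of (GamSurj.incl ⋙ F) s v) =
      (Over.self s.str).glueSum χ F some v :=
  DirectSum.toModule_lof (R := k) (M := fun s : OneStr n => (GamSurj.incl ⋙ F).obj ⟨s.dom⟩)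
    (φ := fun s => (Over.self s.str).glueSum χ F some) s v

/-- The pullback of two glued copies of a tree splits over the components of the pulled-back tree
into glued copies of these components, with the marks that `Str.coeffMap` leaves in each of them. -/
theorem map_doubling {m n : ℕ} (θ : Fin (m + 1) →o Fin (n + 1)) (χ : Fin (n + 1) →o Fin 2) :
    RWMod.map (GamSurj.incl ⋙ F) θ ∘ₗ doubling F n χ =
      doubling F m (χ.comp θ) ∘ₗ RWMod.map (GamSurj.incl ⋙ F) θ := by
  refine DirectSum.linearMap_ext k fun s => LinearMap.ext fun v => ?_
  change RWMod.map (GamSurj.incl ⋙ F) θ (doubling F n χ (RWMod.of (GamSurj.incl ⋙ F) s v)) =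
    doubling F m (χ.comp θ) (RWMod.map (GamSurj.incl ⋙ F) θ (RWMod.of (GamSurj.incl ⋙ F) s v))
  rw [RWMod.map_of, RWMod.mapOf_apply, _root_.map_sum]
  refine (congrArg (RWMod.map (GamSurj.incl ⋙ F) θ) (doubling_of F χ s v)).trans ?_
  refine ((Over.self s.str).map_glueSum χ F some θ v).trans ?_
  refine ((Over.selfComponents (s.str.pull θ)).glueSum_eq_sum (χ.comp θ) F
    (fun i => some (s.str.tr (Fin.zero_le (θ 0)) i))
    (fun c => Gam.partialMap (GamSurj.incl.map (s.str.coeffMap θ c))) (fun c i b => ?_) v).trans ?_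
  · refine (Gam.partialMap_eq_some _ i b).trans ((s.str.coeffMap_eq_succ θ c i b).trans ?_)
    exact Option.some_inj.symm
  · refine Finset.sum_congr rfl fun c _ => ?_
    refine Eq.trans ?_ (doubling_of F (χ.comp θ) ((s.str.pull θ).tree c) _).symm
    refine (((Over.selfComponents (s.str.pull θ)).X' c).glueSum_map (χ.comp θ) F
      (Gam.partialMap (GamSurj.incl.map (s.str.coeffMap θ c))) some
      (GamSurj.incl.map (s.str.coeffMap θ c)) (fun i b => ?_) v).symm
    refine (Gam.partialMap_eq_some _ i b).trans ?_
    constructor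
    · intro h
      exact ⟨b, h, rfl⟩
    · rintro ⟨i', h, hi'⟩
      rw [← Option.some_inj.1 hi']
      exact h

theorem doubling_one {n : ℕ} (χ : Fin (n + 1) →o Fin 2) (hχ : ∀ j, χ j ≠ 0) :
    doubling F n χ = LinearMap.id := by
  refine DirectSum.linearMap_ext k fun s => LinearMap.ext fun v => ?_
  refine (doubling_of F χ s v).trans ?_
  refine (Over.glueSum_one χ F s (Over.self s.str) hχ some (𝟙 _) (fun i a => ?_) v).trans ?_
  · refine Fin.succ_inj.trans ⟨fun h => ⟨i, rfl, h⟩, ?_⟩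
    rintro ⟨b, hb, rfl⟩
    exact Option.some_inj.1 hb
  · rw [F.map_id]
    rfl

/-- The copies are disjoint. The original tree carries no marks and contributes the coefficient
pushed along the zero map; the second copy carries all marks and contributes the identity. -/
theorem doubling_zero {n : ℕ} (χ : Fin (n + 1) →o Fin 2) (hχ : ∀ j, χ j = 0) :
    doubling F n χ = ((rwSimplicialMap (Functor.whiskerLeft GamSurj.incl (basepointMap F)) +
      𝟙 (rwSimplicial (GamSurj.incl ⋙ F))).app (op ⦋n⦌)).hom := by
  refine DirectSum.linearMap_ext k fun s => LinearMap.ext fun v => ?_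
  refine (doubling_of F χ s v).trans ?_
  refine (Over.glueSum_zero χ F s (Over.self s.str) hχ some (fun _ : Unit => s)
    (fun _ _ a => a) (fun _ _ => strictMono_id) (fun _ _ _ _ _ => rfl)
    (fun _ _ b _ _ => ⟨b, rfl⟩) ⟨?_, fun a => ⟨⟨(), a⟩, rfl⟩⟩ (fun _ => 𝟙 _)
    (fun _ i a => ?_) v).trans ?_
  · rintro ⟨_, a⟩ ⟨_, b⟩ (h : a = b)
    rw [h]
  · exact Fin.succ_inj.trans Option.some_inj.symm
  · rw [Fintype.sum_unique]
    refine congrArg₂ (· + ·)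
      (rwSimplicialMap_of (Functor.whiskerLeft GamSurj.incl (basepointMap F)) s v).symm ?_
    rw [F.map_id]
    rfl

/-- The homotopy that is given by the forests glued from two copies of a string. -/
def doublingHomotopy : SimplicialObject.Homotopy
    (rwSimplicialMap (Functor.whiskerLeft GamSurj.incl (basepointMap F)) +
      𝟙 (rwSimplicial (GamSurj.incl ⋙ F))) (𝟙 (rwSimplicial (GamSurj.incl ⋙ F))) :=
  homotopyOfFamily (X := rwSimplicial (GamSurj.incl ⋙ F)) (Y := rwSimplicial (GamSurj.incl ⋙ F))
    (fun n χ => ModuleCat.ofHom (doubling F n χ))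
    (fun θ χ => ModuleCat.hom_ext (map_doubling F θ.toOrderHom χ)) _ _
    (fun _ χ hχ => ModuleCat.hom_ext (doubling_zero F χ hχ))
    (fun _ χ hχ => ModuleCat.hom_ext (doubling_one F χ hχ))

/-- The doubling homotopy gives b + 1 = 1 on homology. -/
theorem homologyMap_basepointMap (n : ℕ) : HomologicalComplex.homologyMap
    (rwComplexMap (Functor.whiskerLeft GamSurj.incl (basepointMap F))) n = 0 := by
  have h := (doublingHomotopy F).map_homology_eq n
  rw [Functor.map_add, Functor.map_add] at h
  exact left_eq_add.1 (h.symm.trans (add_comm _ _))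

end Retract

end GammaHomology

end

noncomputable section

namespace GammaHomology

/-! ### Vanishing of positive homology for free Γ-modules. -/

section Free

open scoped Simplicial

variable (k : Type u) [CommRing k] {J : Type u} (d : J → Gam)

/-- The direct sum of the representable `Γ`-modules `k[Γ([d j], -)]`. -/
def freeGam : Gam ⥤ ModuleCat.{u} k where
  obj y := ModuleCat.of k ((Σ j, (d j ⟶ y)) →₀ k)
  map f := ModuleCat.ofHom (Finsupp.lmapDomain k k fun p => ⟨p.1, p.2 ≫ f⟩)
  map_id y := by
    ext1
    exact Finsupp.lmapDomain_id k k
  map_comp f g := by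
    ext1
    refine Eq.trans ?_ (Finsupp.lmapDomain_comp k k _ _)
    rfl

/-- The basis elements of a free `Γ`-module. -/
def freeGam.basis {y : Gam} (j : J) (φ : d j ⟶ y) : (freeGam k d).obj y :=
  Finsupp.single (⟨j, φ⟩ : Σ j, (d j ⟶ y)) (1 : k)

theorem freeGam.map_basis {y z : Gam} (j : J) (φ : d j ⟶ y) (f : y ⟶ z) :
    ((freeGam k d).map f).hom (freeGam.basis k d j φ) = freeGam.basis k d j (φ ≫ f) :=
  Finsupp.mapDomain_single

/-- The linear maps out of a free `Γ`-module. -/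
def freeGam.desc {N : Type u} [AddCommGroup N] [Module k N] (y : Gam)
    (f : ∀ j, (d j ⟶ y) → N) : (freeGam k d).obj y →ₗ[k] N :=
  Finsupp.linearCombination k fun p : Σ j, (d j ⟶ y) => f p.1 p.2

theorem freeGam.desc_basis {N : Type u} [AddCommGroup N] [Module k N] (y : Gam)
    (f : ∀ j, (d j ⟶ y) → N) (j : J) (φ : d j ⟶ y) :
    freeGam.desc k d y f (freeGam.basis k d j φ) = f j φ :=
  (Finsupp.linearCombination_single k (1 : k) _).trans (one_smul k _)

variable {k d} in
theorem freeGam.hom_ext {N : Type u} [AddCommGroup N] [Module k N] {y : Gam}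
    {f g : (freeGam k d).obj y →ₗ[k] N}
    (h : ∀ j φ, f (freeGam.basis k d j φ) = g (freeGam.basis k d j φ)) : f = g :=
  Finsupp.lhom_ext' fun p => LinearMap.ext_ring (h p.1 p.2)

/-- The non-basepoints that are not sent to the basepoint. -/
abbrev Gam.Supp {p q : Gam} (φ : p ⟶ q) : Type := {i : Fin p.size // φ.1 i.succ ≠ 0}

/-- The values of a map at the elements that are not sent to the basepoint. -/
def Gam.val {p q : Gam} (φ : p ⟶ q) (i : Gam.Supp φ) : Fin q.size := (φ.1 i.1.succ).pred i.2

theorem Gam.val_eq {p q : Gam} (φ : p ⟶ q) (i : Gam.Supp φ) (b : Fin q.size) :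
    Gam.val φ i = b ↔ φ.1 i.1.succ = b.succ :=
  Fin.pred_eq_iff_eq_succ i.2

/-- The tautological marks by the support of a map. -/
def Gam.suppMark {p q : Gam} (φ : p ⟶ q) (i : Fin p.size) : Option (Gam.Supp φ) :=
  if h : φ.1 i.succ = 0 then none else some ⟨i, h⟩

theorem Gam.suppMark_eq_some {p q : Gam} (φ : p ⟶ q) (i : Fin p.size) (b : Gam.Supp φ) :
    Gam.suppMark φ i = some b ↔ i = b.1 := by
  rw [Gam.suppMark]
  split_ifs with h
  · refine ⟨fun h' => h'.elim, ?_⟩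
    rintro rfl
    exact (b.2 h).elim
  · rw [Option.some_inj, Subtype.ext_iff]

/-- The sum of the forests glued from a string and the paths that start at the values of a
map. -/
def sprouting (n : ℕ) (χ : Fin (n + 1) →o Fin 2) :
    RWMod (GamSurj.incl ⋙ freeGam k d) n →ₗ[k] RWMod (GamSurj.incl ⋙ freeGam k d) n :=
  DirectSum.toModule k (OneStr n) _ fun s => freeGam.desc k d ⟨s.dom⟩ fun j φ =>
    (Over.const s.str (Gam.Supp φ) (Gam.val φ)).glueSum χ (freeGam k d) (Gam.suppMark φ)
      (freeGam.basis k d j (𝟙 _))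

theorem sprouting_of {n : ℕ} (χ : Fin (n + 1) →o Fin 2) (s : OneStr n) (j : J)
    (φ : d j ⟶ ⟨s.dom⟩) :
    sprouting k d n χ (RWMod.of (GamSurj.incl ⋙ freeGam k d) s (freeGam.basis k d j φ)) =
    (Over.const s.str (Gam.Supp φ) (Gam.val φ)).glueSum χ (freeGam k d) (Gam.suppMark φ)
      (freeGam.basis k d j (𝟙 _)) := by
  refine (DirectSum.toModule_lof (R := k)
    (M := fun s : OneStr n => (GamSurj.incl ⋙ freeGam k d).obj ⟨s.dom⟩) s _).trans ?_
  exact freeGam.desc_basis k d ⟨s.dom⟩ _ j φ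

theorem Over.const_proj_zero {n : ℕ} (t : Str n) (D : Type) [LinearOrder D] [Fintype D]
    (f : D → Fin (t.obj 0).card) (a : D) :
    (Over.const t D f).proj (j := 0) a = f a :=
  t.tr_self _ _

/-- The parts, over the components, of the pullback of a union of paths. -/
def Over.constComponents {m n : ℕ} (θ : Fin (m + 1) →o Fin (n + 1)) (s : Str n) {p : Gam}
    (φ : p ⟶ ⟨(s.obj 0).card⟩) :
    ((Over.const s (Gam.Supp φ) (Gam.val φ)).pull θ).Components where
  X' c := Over.const ((s.pull θ).component c) (Gam.Supp (φ ≫ GamSurj.incl.map (s.coeffMap θ c)))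
    (Gam.val (φ ≫ GamSurj.incl.map (s.coeffMap θ c)))
  β c _ b := ⟨b.1, fun h => b.2 (by
    change (s.coeffMap θ c).1 (φ.1 _) = 0
    rw [h]
    exact (s.coeffMap θ c).2.1)⟩
  strictMono _ _ _ _ h := h
  tr _ _ _ _ _ := rfl
  -- The support of the composite consists of the indices whose value, pushed to x_{θ(0)}, lies in
  -- the component of c; there it is the root of the path in that component.
  proj c j b := by
    obtain ⟨a, ha, ha'⟩ := (Gam.comp_eq_succ φ (GamSurj.incl.map (s.coeffMap θ c)) b.1 _).1
      ((Gam.val_eq _ b _).1 rfl)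
    have h1 := (s.coeffMap_eq_succ θ c a _).1 ha'
    refine Eq.trans ?_ ((s.pull θ).cemb_tr c (Fin.zero_le j) _).symm
    refine Eq.trans ?_ (congrArg ((s.pull θ).tr (Fin.zero_le j)) h1)
    refine Eq.trans ?_ (s.tr_tr (Fin.zero_le (θ 0)) (θ.monotone (Fin.zero_le j)) a).symm
    exact congrArg (s.tr _) ((Gam.val_eq φ _ a).2 ha)
  mem_range c {j} b h := by
    have h1 : s.tr (Fin.zero_le (θ 0)) (Gam.val φ b) ∈ Set.range ((s.pull θ).cemb c 0) := by
      rw [(s.pull θ).range_cemb]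
      refine Eq.trans (s.tr_tr (Fin.zero_le (θ 0)) (θ.monotone (Fin.le_last 0)) _) ?_
      exact (s.tr_tr _ _ _).symm.trans h
    obtain ⟨a, ha⟩ := h1
    have h2 := (Gam.comp_eq_succ φ (GamSurj.incl.map (s.coeffMap θ c)) b.1 a).2
      ⟨_, (Gam.val_eq φ b _).1 rfl, (s.coeffMap_eq_succ θ c _ a).2 ha.symm⟩
    exact ⟨⟨b.1, fun h => Fin.succ_ne_zero a (h2.symm.trans h)⟩, rfl⟩

/-- The paths break up over the components of the pulled-back tree. Restricted to one of them, the
basis element φ becomes its composite with `Str.coeffMap`, which is again a basis element. -/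
theorem map_sprouting {m n : ℕ} (θ : Fin (m + 1) →o Fin (n + 1)) (χ : Fin (n + 1) →o Fin 2) :
    RWMod.map (GamSurj.incl ⋙ freeGam k d) θ ∘ₗ sprouting k d n χ =
      sprouting k d m (χ.comp θ) ∘ₗ RWMod.map (GamSurj.incl ⋙ freeGam k d) θ := by
  refine DirectSum.linearMap_ext k fun s => freeGam.hom_ext fun j φ => ?_
  change RWMod.map (GamSurj.incl ⋙ freeGam k d) θ (sprouting k d n χ
      (RWMod.of (GamSurj.incl ⋙ freeGam k d) s (freeGam.basis k d j φ))) =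
    sprouting k d m (χ.comp θ) (RWMod.map (GamSurj.incl ⋙ freeGam k d) θ
      (RWMod.of (GamSurj.incl ⋙ freeGam k d) s (freeGam.basis k d j φ)))
  rw [RWMod.map_of, RWMod.mapOf_apply, _root_.map_sum]
  refine (congrArg (RWMod.map (GamSurj.incl ⋙ freeGam k d) θ)
    (sprouting_of k d χ s j φ)).trans ?_
  refine ((Over.const s.str (Gam.Supp φ) (Gam.val φ)).map_glueSum χ (freeGam k d)
    (Gam.suppMark φ) θ _).trans ?_
  refine ((Over.constComponents θ s.str φ).glueSum_eq_sum (χ.comp θ) (freeGam k d) _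
    (fun c => Gam.suppMark (φ ≫ GamSurj.incl.map (s.str.coeffMap θ c))) (fun c i b => ?_) _).trans ?_
  · refine (Gam.suppMark_eq_some _ i b).trans (Iff.trans ?_ Option.map_eq_some_iff.symm)
    constructor
    · intro h
      exact ⟨(Over.constComponents θ s.str φ).β c b, (Gam.suppMark_eq_some φ i _).2 h, rfl⟩
    · rintro ⟨b', hb', rfl⟩
      exact (Gam.suppMark_eq_some φ i _).1 hb'
  · refine Finset.sum_congr rfl fun c _ => ?_
    refine Eq.trans ?_ (congrArg (fun v => sprouting k d m (χ.comp θ)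
      (RWMod.of (GamSurj.incl ⋙ freeGam k d) ((s.str.pull θ).tree c) v))
        (freeGam.map_basis k d j φ (GamSurj.incl.map (s.str.coeffMap θ c)))).symm
    exact (sprouting_of k d (χ.comp θ) ((s.str.pull θ).tree c) j _).symm

/-- All paths have merged into the tree, so the marks are those of φ, and φ applied to the universal
element `𝟙` returns the basis element φ. -/
theorem sprouting_one {n : ℕ} (χ : Fin (n + 1) →o Fin 2) (hχ : ∀ j, χ j ≠ 0) :
    sprouting k d n χ = LinearMap.id := by
  refine DirectSum.linearMap_ext k fun s => freeGam.hom_ext fun j φ => ?_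
  refine (sprouting_of k d χ s j φ).trans ?_
  refine (Over.glueSum_one χ (freeGam k d) s (Over.const s.str (Gam.Supp φ) (Gam.val φ)) hχ
    (Gam.suppMark φ) φ (fun i a => ?_) (freeGam.basis k d j (𝟙 _))).trans ?_
  · constructor
    · intro h
      have h0 : φ.1 i.succ ≠ 0 := fun h' => Fin.succ_ne_zero a (h.symm.trans h')
      refine ⟨⟨i, h0⟩, (Gam.suppMark_eq_some φ i ⟨i, h0⟩).2 rfl,
        (Over.const_proj_zero _ _ _ _).trans ((Gam.val_eq φ ⟨i, h0⟩ a).2 h)⟩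
    · rintro ⟨b, hb, rfl⟩
      rw [(Gam.suppMark_eq_some φ i b).1 hb]
      exact ((Gam.val_eq φ b _).1 rfl).trans
        (congrArg Fin.succ (Over.const_proj_zero _ _ _ _).symm)
  · refine congrArg (RWMod.of (GamSurj.incl ⋙ freeGam k d) s) ?_
    refine (freeGam.map_basis k d j (𝟙 (d j)) φ).trans ?_
    rw [Category.id_comp]

/-- The constant string. -/
def OneStr.path (n : ℕ) : OneStr n := ⟨(Functor.const _).obj ⟨1, le_rfl⟩, rfl⟩

/-- The map that sends all elements except for a given one to the basepoint. -/
def Gam.proj {p : Gam} (i : Fin p.size) : p ⟶ ⟨1⟩ :=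
  ⟨Fin.cases 0 fun i' => if i' = i then 1 else 0, rfl⟩

theorem Gam.proj_eq_succ {p : Gam} (i i' : Fin p.size) (a : Fin 1) :
    (Gam.proj i).1 i'.succ = a.succ ↔ i' = i := by
  obtain rfl : a = 0 := Subsingleton.elim _ _
  change (if i' = i then (1 : Fin 2) else 0) = 1 ↔ _
  split_ifs with h <;> simp [h]

/-- The inclusion of the constant simplicial module on `F[1]`. -/
def pathMap (F : Gam ⥤ ModuleCat.{u} k) : (SimplicialObject.const (ModuleCat.{u} k)).obj (F.obj ⟨1⟩) ⟶
    rwSimplicial (GamSurj.incl ⋙ F) where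
  app n := ModuleCat.ofHom (RWMod.of (GamSurj.incl ⋙ F) (OneStr.path n.unop.len))
  naturality {n m} θ := by
    apply ModuleCat.hom_ext
    refine LinearMap.ext fun v => ?_
    change RWMod.of (GamSurj.incl ⋙ F) (OneStr.path m.unop.len) v =
      RWMod.map (GamSurj.incl ⋙ F) θ.unop.toOrderHom
        (RWMod.of (GamSurj.incl ⋙ F) (OneStr.path n.unop.len) v)
    refine Eq.trans ?_ (RWMod.map_of (GamSurj.incl ⋙ F) θ.unop.toOrderHom
      (OneStr.path n.unop.len) v).symm
    refine Eq.trans ?_ (RWMod.mapOf_of_last (GamSurj.incl ⋙ F) θ.unop.toOrderHom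
      (OneStr.path n.unop.len) v rfl).symm
    refine congrArg (RWMod.of (GamSurj.incl ⋙ F) (OneStr.path m.unop.len)) ?_
    have : GamSurj.incl.map (GamSurj.ofSurj ((OneStr.path n.unop.len).str.tr
        (Fin.zero_le (θ.unop.toOrderHom 0))) ((OneStr.path n.unop.len).str.tr_surjective _)) =
        𝟙 (⟨1⟩ : Gam) := Gam.hom_ext_succ _ _ fun i a => Iff.rfl
    refine Eq.trans ?_ (congrArg (fun f => (F.map f).hom v) this).symm
    change v = (F.map (𝟙 _)).hom v
    rw [F.map_id]
    rfl

/-- The sum of the restrictions to the elements, for an element of a free `Γ`-module. -/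
def restrictMap (n : ℕ) :
    RWMod (GamSurj.incl ⋙ freeGam k d) n →ₗ[k] (freeGam k d).obj ⟨1⟩ :=
  DirectSum.toModule k (OneStr n) _ fun s => freeGam.desc k d ⟨s.dom⟩ fun j φ =>
    ∑ i : Gam.Supp φ, freeGam.basis k d j (Gam.proj i.1)

theorem restrictMap_of {n : ℕ} (s : OneStr n) (j : J) (φ : d j ⟶ ⟨s.dom⟩) :
    restrictMap k d n (RWMod.of (GamSurj.incl ⋙ freeGam k d) s (freeGam.basis k d j φ)) =
      ∑ i : Gam.Supp φ, freeGam.basis k d j (Gam.proj i.1) := by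
  refine (DirectSum.toModule_lof (R := k)
    (M := fun s : OneStr n => (GamSurj.incl ⋙ freeGam k d).obj ⟨s.dom⟩) s _).trans ?_
  exact freeGam.desc_basis k d ⟨s.dom⟩ _ j φ

/-- `sprouting` as a morphism of `k`-modules. -/
def sproutingHom (n : ℕ) (χ : Fin (n + 1) →o Fin 2) :
    (rwSimplicial (GamSurj.incl ⋙ freeGam k d)).obj (op ⦋n⦌) ⟶
      (rwSimplicial (GamSurj.incl ⋙ freeGam k d)).obj (op ⦋n⦌) :=
  ModuleCat.ofHom (sprouting k d n χ)

/-- `restrictMap` as a morphism of `k`-modules. -/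
def restrictHom (n : ℕ) :
    (rwSimplicial (GamSurj.incl ⋙ freeGam k d)).obj (op ⦋n⦌) ⟶
      ((SimplicialObject.const (ModuleCat.{u} k)).obj ((freeGam k d).obj ⟨1⟩)).obj (op ⦋n⦌) :=
  ModuleCat.ofHom (restrictMap k d n)

theorem sproutingHom_naturality {m n : ℕ} (θ : ⦋m⦌ ⟶ ⦋n⦌) (χ : Fin (n + 1) →o Fin 2) :
    sproutingHom k d n χ ≫ (rwSimplicial (GamSurj.incl ⋙ freeGam k d)).map θ.op =
      (rwSimplicial (GamSurj.incl ⋙ freeGam k d)).map θ.op ≫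
        sproutingHom k d m (χ.comp θ.toOrderHom) :=
  ModuleCat.hom_ext (map_sprouting k d θ.toOrderHom χ)

theorem sproutingHom_one {n : ℕ} (χ : Fin (n + 1) →o Fin 2) (hχ : ∀ j, χ j ≠ 0) :
    sproutingHom k d n χ = 𝟙 _ :=
  ModuleCat.hom_ext (sprouting_one k d χ hχ)

/-- The unmarked tree yields the zero-map term. Each index in the support of φ yields a separate
constant path that carries this one mark, hence the coefficient `Gam.proj`. -/
theorem sproutingHom_zero {n : ℕ} (χ : Fin (n + 1) →o Fin 2) (hχ : ∀ j, χ j = 0) :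
    sproutingHom k d n χ = (rwSimplicialMap (Functor.whiskerLeft GamSurj.incl
      (basepointMap (freeGam k d)))).app (op ⦋n⦌) +
      restrictHom k d n ≫ (pathMap k (freeGam k d)).app (op ⦋n⦌) := by
  apply ModuleCat.hom_ext
  refine DirectSum.linearMap_ext k fun s => freeGam.hom_ext fun j φ => ?_
  refine (sprouting_of k d χ s j φ).trans ?_
  refine (Over.glueSum_zero χ (freeGam k d) s (Over.const s.str (Gam.Supp φ) (Gam.val φ)) hχ
    (Gam.suppMark φ) (fun _ : Gam.Supp φ => OneStr.path n)
    (fun c _ _ => c) (fun _ _ a b h => (h.ne (Subsingleton.elim (α := Fin 1) _ _)).elim)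
    (fun _ _ _ _ _ => rfl) (fun c j b a h => ⟨(0 : Fin 1), h.symm⟩)
    ⟨?_, fun a => ⟨⟨a, (0 : Fin 1)⟩, rfl⟩⟩
    (fun i => Gam.proj i.1) (fun c i a => ?_) (freeGam.basis k d j (𝟙 (d j)))).trans ?_
  · rintro ⟨a, x⟩ ⟨b, y⟩ (h : a = b)
    obtain rfl : x = y := Subsingleton.elim (α := Fin 1) _ _
    rw [h]
  · exact (Gam.proj_eq_succ _ _ _).trans (Gam.suppMark_eq_some φ i c).symm
  · refine congrArg₂ (· + ·) ?_ ?_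
    · refine Eq.trans ?_ (rwSimplicialMap_of (Functor.whiskerLeft GamSurj.incl
        (basepointMap (freeGam k d))) s (freeGam.basis k d j φ)).symm
      refine congrArg (RWMod.of (GamSurj.incl ⋙ freeGam k d) s) ?_
      refine (freeGam.map_basis k d j _ _).trans (Eq.trans ?_ (freeGam.map_basis k d j _ _).symm)
      rfl
    · refine Eq.trans ?_ (congrArg (RWMod.of (GamSurj.incl ⋙ freeGam k d) (OneStr.path n))
        (restrictMap_of k d s j φ)).symm
      refine Eq.trans ?_ (_root_.map_sum (RWMod.of (GamSurj.incl ⋙ freeGam k d)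
        (OneStr.path n)) _ _).symm
      refine Finset.sum_congr rfl fun i _ => ?_
      refine congrArg (RWMod.of (GamSurj.incl ⋙ freeGam k d) (OneStr.path n)) ?_
      exact (freeGam.map_basis k d j _ _).trans
        (congrArg (freeGam.basis k d j) (Category.id_comp (Gam.proj i.1)))

variable {k} in
theorem RWMod.of_injective (F : GamSurj ⥤ ModuleCat.{u} k) {n : ℕ} (s : OneStr n) :
    Function.Injective (RWMod.of F s) :=
  DirectSum.of_injective (β := fun s : OneStr n => F.obj ⟨s.dom⟩) s

instance (F : Gam ⥤ ModuleCat.{u} k) (n : SimplexCategoryᵒᵖ) : Mono ((pathMap k F).app n) :=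
  (ModuleCat.mono_iff_injective _).2
    (RWMod.of_injective (GamSurj.incl ⋙ F) (OneStr.path n.unop.len))

/-- A direct check is avoided. Naturality of the sprouting family at χ = 0 minus naturality of the
zero-map term is this identity composed with the monomorphism `pathMap`, which can be cancelled. -/
theorem restrictHom_naturality {m n : ℕ} (θ : ⦋m⦌ ⟶ ⦋n⦌) :
    (rwSimplicial (GamSurj.incl ⋙ freeGam k d)).map θ.op ≫ restrictHom k d m =
      restrictHom k d n ≫ ((SimplicialObject.const (ModuleCat.{u} k)).obj
        ((freeGam k d).obj ⟨1⟩)).map θ.op := by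
  rw [← cancel_mono ((pathMap k (freeGam k d)).app (op ⦋m⦌))]
  have h1 := sproutingHom_naturality k d θ (OrderHom.const _ 0)
  rw [sproutingHom_zero k d (OrderHom.const _ 0) fun _ => rfl,
    sproutingHom_zero k d ((OrderHom.const _ 0).comp θ.toOrderHom) fun _ => rfl,
    Preadditive.add_comp, Preadditive.comp_add, ← NatTrans.naturality, add_right_inj] at h1
  rw [Category.assoc, Category.assoc, NatTrans.naturality, ← h1, Category.assoc]

/-- The simplicial map to the constant simplicial module. -/
def restrictSimplicial : rwSimplicial (GamSurj.incl ⋙ freeGam k d) ⟶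
    (SimplicialObject.const (ModuleCat.{u} k)).obj ((freeGam k d).obj ⟨1⟩) where
  app n := restrictHom k d n.unop.len
  naturality {_ _} θ := restrictHom_naturality k d θ.unop

/-- The homotopy that is given by the forests glued from a string and paths. -/
def sproutingHomotopy : SimplicialObject.Homotopy
    (rwSimplicialMap (Functor.whiskerLeft GamSurj.incl (basepointMap (freeGam k d))) +
      restrictSimplicial k d ≫ pathMap k (freeGam k d))
    (𝟙 (rwSimplicial (GamSurj.incl ⋙ freeGam k d))) :=
  homotopyOfFamily (sproutingHom k d) (sproutingHom_naturality k d) _ _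
    (fun _ χ hχ => sproutingHom_zero k d χ hχ) (fun _ χ hχ => sproutingHom_one k d χ hχ)

/-- On positive homology the homotopy writes the identity as the zero-map term, which vanishes, plus
a map through a constant simplicial module, which has no positive homology. -/
theorem isZero_homology_freeGam (n : ℕ) :
    IsZero ((rwComplex (GamSurj.incl ⋙ freeGam k d)).homology (n + 1)) := by
  have h := (sproutingHomotopy k d).map_homology_eq (n + 1)
  have hz : IsZero ((HomologicalComplex.homologyFunctor _ _ (n + 1)).obj
      ((AlgebraicTopology.alternatingFaceMapComplex (ModuleCat.{u} k)).obj
        ((SimplicialObject.const (ModuleCat.{u} k)).obj ((freeGam k d).obj ⟨1⟩)))) :=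
    IsZero.of_iso (HomologicalComplex.ExactAt.isZero_homology
      (ChainComplex.alternatingConst_exactAt ((freeGam k d).obj ⟨1⟩) (n + 1) n.succ_ne_zero))
      ((HomologicalComplex.homologyFunctor _ _ (n + 1)).mapIso
        (AlgebraicTopology.alternatingFaceMapComplexConst.app ((freeGam k d).obj ⟨1⟩)))
  rw [Functor.map_add, Functor.map_add, Functor.map_comp, Functor.map_comp,
    CategoryTheory.Functor.map_id, CategoryTheory.Functor.map_id] at h
  have h1 : (HomologicalComplex.homologyFunctor _ _ (n + 1)).map
      ((AlgebraicTopology.alternatingFaceMapComplex (ModuleCat.{u} k)).map (rwSimplicialMap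
        (Functor.whiskerLeft GamSurj.incl (basepointMap (freeGam k d))))) = 0 :=
    homologyMap_basepointMap (freeGam k d) (n + 1)
  rw [h1, zero_add, hz.eq_zero_of_tgt ((HomologicalComplex.homologyFunctor _ _ (n + 1)).map
    ((AlgebraicTopology.alternatingFaceMapComplex _).map (restrictSimplicial k d))), zero_comp] at h
  exact (IsZero.iff_id_eq_zero _).2 h.symm

end Free

end GammaHomology

end

noncomputable section

namespace GammaHomology

/-! ### Derived functors by dimension shifting. -/

section DimensionShift

variable {C D : Type*} [Category* C] [Category* D] [Abelian C] [Abelian D]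
  (T : C ⥤ ChainComplex D ℕ) [T.Additive] (L : C ⥤ D)

/-- The degree zero homology of an exact functor to chain complexes is right exact. -/
theorem preservesFiniteColimits_of_iso_homology_zero [L.Additive]
    (e : T ⋙ HomologicalComplex.homologyFunctor D _ 0 ≅ L)
    (hT : ∀ S : ShortComplex C, S.ShortExact → (S.map T).ShortExact) :
    PreservesFiniteColimits L := by
  -- Right exactness is checked on short exact sequences: exactness in the middle comes from the
  -- long exact homology sequence, and the epimorphism from the absence of chains below degree zero.
  refine (Functor.preservesFiniteColimits_tfae L |>.out 0 3 :) |>.1 fun S hS => ⟨?_, ?_⟩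
  · exact (ShortComplex.exact_iff_of_iso (S.mapNatIso e)).1 ((hT S hS).homology_exact₂ 0)
  · have : Epi (T.map S.g) := (hT S hS).epi_g
    have : Epi ((HomologicalComplex.homologyFunctor D _ 0).map (T.map S.g)) := by
      have : Epi ((T.map S.g).f 0) := inferInstance
      exact HomologicalComplex.epi_homologyMap_of_epi_of_not_rel (T.map S.g) 0 (by simp)
    have h : L.map S.g = e.inv.app _ ≫
        (HomologicalComplex.homologyFunctor D _ 0).map (T.map S.g) ≫ e.hom.app _ :=
      (e.inv_hom_id_app_assoc _ _).symm.trans (congrArg _ (e.hom.naturality S.g).symm)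
    rw [h]
    infer_instance

/-- The short exact sequence of the boundaries and the opcycles. -/
theorem shortExact_opcycles (K : ChainComplex C ℕ) (n : ℕ) (hK : K.ExactAt (n + 1)) :
    (ShortComplex.mk (K.fromOpcycles (n + 1) n) (K.pOpcycles n) (by
      rw [← cancel_epi (K.pOpcycles (n + 1)), K.p_fromOpcycles_assoc, K.d_pOpcycles,
        comp_zero])).ShortExact where
  exact := by
    refine ShortComplex.exact_of_g_is_cokernel _ (CokernelCofork.IsColimit.ofπ' _ _ fun k hk =>
      ⟨K.descOpcycles k (n + 1) (by simp) (by
        rw [← K.p_fromOpcycles, Category.assoc]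
        exact (congrArg _ hk).trans comp_zero), by simp⟩)
  mono_f := by
    refine Preadditive.mono_of_cancel_zero _ fun {Z} g hg => ?_
    -- The kernel of `fromOpcycles` is the homology in degree n + 1, which vanishes.
    have h1 := (K.homologyIsKernel (n + 1) (j := n) (by simp)).fac (KernelFork.ofι g hg)
      WalkingParallelPair.zero
    have h2 := hK.isZero_homology.eq_zero_of_tgt
      ((K.homologyIsKernel (n + 1) (j := n) (by simp)).lift (KernelFork.ofι g hg))
    rw [h2, zero_comp] at h1
    exact h1.symm

/-- Homology is also the kernel of the map induced on the cokernel of the incoming map; the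
hypotheses supply such right homology data. -/
theorem nonempty_homology_iso_of_exact {S : ShortComplex D} {Q H : D} (p : S.X₂ ⟶ Q)
    (g' : Q ⟶ S.X₃) (hg : p ≫ g' = S.g) (wp : S.f ≫ p = 0)
    (hp : IsColimit (CokernelCofork.ofπ p wp)) (ι : H ⟶ Q) [Mono ι] (w : ι ≫ g' = 0)
    (hex : (ShortComplex.mk ι g' w).Exact) : Nonempty (S.homology ≅ H) := by
  have hdesc : hp.desc (CokernelCofork.ofπ _ S.zero) = g' :=
    Cofork.IsColimit.hom_ext hp ((hp.fac _ WalkingParallelPair.one).trans hg.symm)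
  let R : S.RightHomologyData :=
    { Q := Q
      H := H
      p := p
      ι := ι
      wp := wp
      hp := hp
      wι := by rw [hdesc, w]
      hι := KernelFork.IsLimit.ofι' _ _ fun k hk =>
        ⟨hex.lift k ((congrArg (k ≫ ·) hdesc).symm.trans hk), hex.lift_f k _⟩ }
  exact ⟨R.homologyIso⟩

/-- The end of the long exact sequence of T, whose connecting map is a monomorphism because H_1 of
the middle term vanishes, carried over to L along e. -/
theorem exists_mono_exact (e : T ⋙ HomologicalComplex.homologyFunctor D _ 0 ≅ L)
    (hT : ∀ S : ShortComplex C, S.ShortExact → (S.map T).ShortExact) (S : ShortComplex C)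
    (hS : S.ShortExact) (h : IsZero ((T.obj S.X₂).homology 1)) :
    ∃ (δ : (T.obj S.X₃).homology 1 ⟶ L.obj S.X₁) (w : δ ≫ L.map S.f = 0), Mono δ ∧
      (ShortComplex.mk δ (L.map S.f) w).Exact := by
  let H := HomologicalComplex.homologyFunctor D (ComplexShape.down ℕ) 0
  obtain ⟨δ, w, hδ, hex⟩ : ∃ (δ : (T.obj S.X₃).homology 1 ⟶ (T ⋙ H).obj S.X₁)
      (w : δ ≫ (T ⋙ H).map S.f = 0), Mono δ ∧
        (ShortComplex.mk δ ((T ⋙ H).map S.f) w).Exact :=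
    ⟨(hT S hS).δ 1 0 rfl, (hT S hS).δ_comp 1 0 rfl, (hT S hS).mono_δ 1 0 rfl h,
      (hT S hS).homology_exact₁ 1 0 rfl⟩
  have w' : (δ ≫ e.hom.app S.X₁) ≫ L.map S.f = 0 := by
    rw [Category.assoc, ← e.hom.naturality, ← Category.assoc, w, zero_comp]
  refine ⟨δ ≫ e.hom.app S.X₁, w', mono_comp _ _, ?_⟩
  refine (ShortComplex.exact_iff_of_iso (ShortComplex.isoMk (S₁ := .mk δ ((T ⋙ H).map S.f) w)
    (S₂ := .mk (δ ≫ e.hom.app S.X₁) (L.map S.f) w') (Iso.refl _) (e.app S.X₁) (e.app S.X₂)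
      (Category.id_comp _) (e.hom.naturality _).symm)).1 hex

/-- Right exactness makes L of the opcycles in degree n + 1 the cokernel of the incoming
differential of L(K). The homology is thus the kernel of its map to L(K_n), which
`exists_mono_exact` identifies through the boundary sequence. -/
theorem nonempty_homology_mapHomologicalComplex_iso [L.Additive]
    (e : T ⋙ HomologicalComplex.homologyFunctor D _ 0 ≅ L)
    (hT : ∀ S : ShortComplex C, S.ShortExact → (S.map T).ShortExact) (K : ChainComplex C ℕ) (n : ℕ)
    (hK : K.ExactAt (n + 1)) (h : IsZero ((T.obj (K.X n)).homology 1)) :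
    Nonempty (((L.mapHomologicalComplex _).obj K).homology (n + 1) ≅
      (T.obj (K.opcycles n)).homology 1) := by
  have := preservesFiniteColimits_of_iso_homology_zero T L e hT
  obtain ⟨δ, w, _, hex⟩ := exists_mono_exact T L e hT _ (shortExact_opcycles K n hK) h
  obtain ⟨i⟩ := nonempty_homology_iso_of_exact
    (S := ((L.mapHomologicalComplex (ComplexShape.down ℕ)).obj K).sc' (n + 2) (n + 1) n)
    (L.map (K.pOpcycles (n + 1))) (L.map (K.fromOpcycles (n + 1) n))
    ((L.map_comp _ _).symm.trans (congrArg L.map (K.p_fromOpcycles _ _)))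
    ((L.map_comp _ _).symm.trans ((congrArg L.map (K.d_pOpcycles _ _)).trans (L.map_zero _ _)))
    (CokernelCofork.mapIsColimit _ (K.opcyclesIsCokernel (n + 2) (n + 1) (by simp)) L) δ w hex
  exact ⟨ShortComplex.homologyMapIso (HomologicalComplex.isoSc' _ _ _ _ (by simp) (by simp)) ≪≫ i⟩

/-- A functor `L` that is the degree zero homology of an exact functor `T` to chain complexes, such
that the higher homology of `T` vanishes on projective objects, has the homology of `T` as
its derived functors. -/
theorem nonempty_leftDerived_iso [L.Additive] [EnoughProjectives C]
    (e : T ⋙ HomologicalComplex.homologyFunctor D _ 0 ≅ L)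
    (hT : ∀ S : ShortComplex C, S.ShortExact → (S.map T).ShortExact)
    (hP : ∀ (P : C) [Projective P] (n : ℕ), IsZero ((T.obj P).homology (n + 1))) (X : C) (n : ℕ) :
    Nonempty ((L.leftDerived n).obj X ≅ (T.obj X).homology n) := by
  have := preservesFiniteColimits_of_iso_homology_zero T L e hT
  cases n with
  | zero => exact ⟨L.leftDerivedZeroIsoSelf.app X ≪≫ (e.app X).symm⟩
  | succ m =>
    let P := projectiveResolution X
    let K := P.complex
    have hS := fun n => hT _ (shortExact_opcycles K n (P.complex_exactAt_succ n))
    -- The opcycles of the resolution are the syzygies of X. T of a term of the resolution has no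
    -- positive homology, so the connecting maps are isomorphisms.
    have hshift : ∀ l n, Nonempty ((T.obj (K.opcycles n)).homology (l + 2) ≅
        (T.obj (K.opcycles (n + 1))).homology (l + 1)) := fun l n =>
      ⟨(hS n).δIso (l + 2) (l + 1) rfl (hP (K.X n) _) (hP (K.X n) _)⟩
    have h1 : ∀ m n, Nonempty ((T.obj (K.opcycles n)).homology (m + 1) ≅
        (T.obj (K.opcycles (n + m))).homology 1) := by
      intro m
      induction m with
      | zero => exact fun n => ⟨Iso.refl _⟩
      | succ m ih =>
        intro n
        obtain ⟨i⟩ := hshift m n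
        obtain ⟨j⟩ := ih (n + 1)
        rw [add_right_comm, add_assoc] at j
        exact ⟨i ≪≫ j⟩
    obtain ⟨i⟩ := h1 m 0
    rw [zero_add] at i
    obtain ⟨j⟩ := nonempty_homology_mapHomologicalComplex_iso T L e hT K m
      (P.complex_exactAt_succ m) (hP (K.X m) 0)
    -- The opcycles in degree zero are the cokernel of the first differential, that is, X itself.
    exact ⟨P.isoLeftDerivedObj L (m + 1) ≪≫ j ≪≫ i.symm ≪≫
      (HomologicalComplex.homologyFunctor D _ (m + 1)).mapIso (T.mapIso
        ((K.opcyclesIsCokernel 1 0 (by simp)).coconePointUniqueUpToIso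
          P.isColimitCokernelCofork))⟩

end DimensionShift

end GammaHomology

end

noncomputable section

namespace GammaHomology

/-! ### Exactness of the complex in F, and vanishing on projectives. -/

section RWFunctor

open scoped Simplicial

variable (k : Type u) [CommRing k]

theorem rwSimplicialMap_app {F G : GamSurj ⥤ ModuleCat.{u} k} (η : F ⟶ G) (n : SimplexCategoryᵒᵖ) :
    ((rwSimplicialMap η).app n).hom =
      DirectSum.lmap fun s : OneStr n.unop.len => (η.app ⟨s.dom⟩).hom := rfl

/-- The functor that sends a `Γ`-module to its Robinson-Whitehouse simplicial module. -/
def rwSimplicialFunctor : (Gam ⥤ ModuleCat.{u} k) ⥤ SimplicialObject (ModuleCat.{u} k) where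
  obj F := rwSimplicial (GamSurj.incl ⋙ F)
  map η := rwSimplicialMap (Functor.whiskerLeft GamSurj.incl η)
  map_id F := by
    ext n : 2
    refine (rwSimplicialMap_app k _ n).trans (Eq.trans ?_ (DirectSum.lmap_id (R := k)
      (M := fun s : OneStr n.unop.len => F.obj ⟨s.dom⟩)))
    rfl
  map_comp η η' := by
    ext n : 2
    refine (rwSimplicialMap_app k _ n).trans (Eq.trans ?_ (DirectSum.lmap_comp (R := k)
      (fun s : OneStr n.unop.len => (η.app ⟨s.dom⟩).hom) (fun s => (η'.app ⟨s.dom⟩).hom)))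
    rfl

/-- The functor that sends a `Γ`-module to its Robinson-Whitehouse complex. -/
def rwFunctor : (Gam ⥤ ModuleCat.{u} k) ⥤ ChainComplex (ModuleCat.{u} k) ℕ :=
  rwSimplicialFunctor k ⋙ AlgebraicTopology.alternatingFaceMapComplex _

instance : (rwSimplicialFunctor k).Additive where
  map_add {F G η η'} := by
    ext n : 2
    refine DirectSum.linearMap_ext k fun s => LinearMap.ext fun v => ?_
    refine (DirectSum.lmap_lof (fun s : OneStr n.unop.len => ((η + η').app ⟨s.dom⟩).hom)
      s v).trans ?_
    refine Eq.trans ?_ (congrArg₂ (· + ·) (DirectSum.lmap_lof (fun s : OneStr n.unop.len =>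
      (η.app ⟨s.dom⟩).hom) s v) (DirectSum.lmap_lof (fun s : OneStr n.unop.len =>
      (η'.app ⟨s.dom⟩).hom) s v)).symm
    exact map_add _ _ _

instance : (rwFunctor k).Additive := by
  unfold rwFunctor
  infer_instance

/-- In each degree the functor is a direct sum of evaluations, and evaluations and direct sums are
exact. -/
theorem shortExact_rwFunctor (S : ShortComplex (Gam ⥤ ModuleCat.{u} k)) (hS : S.ShortExact) :
    (S.map (rwFunctor k)).ShortExact := by
  have hp : ∀ p : Gam, (S.map ((evaluation Gam (ModuleCat.{u} k)).obj p)).ShortExact := fun p =>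
    hS.map_of_exact _
  refine HomologicalComplex.shortExact_of_degreewise_shortExact _ fun n =>
    { exact := ?_, mono_f := ?_, epi_g := ?_ }
  · refine (ShortComplex.moduleCat_exact_iff_range_eq_ker _).2 ?_
    refine (DirectSum.range_lmap fun s : OneStr n => (S.f.app ⟨s.dom⟩).hom).trans (Eq.trans ?_
      (DirectSum.ker_lmap fun s : OneStr n => (S.g.app ⟨s.dom⟩).hom).symm)
    exact congrArg (fun N : ∀ s : OneStr n, Submodule k (S.X₂.obj ⟨s.dom⟩) =>
      (Submodule.pi Set.univ N).comap (DirectSum.coeFnLinearMap k))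
      (funext fun s => (hp ⟨s.dom⟩).exact.moduleCat_range_eq_ker)
  · refine (ModuleCat.mono_iff_injective _).2 ?_
    exact (DirectSum.lmap_injective _).2 fun s => (hp ⟨s.dom⟩).moduleCat_injective_f
  · refine (ModuleCat.epi_iff_surjective _).2 ?_
    exact (DirectSum.lmap_surjective _).2 fun s => (hp ⟨s.dom⟩).moduleCat_surjective_g

/-- The canonical map from a free `Γ`-module to a `Γ`-module. -/
def freeGam.toModule (P : Gam ⥤ ModuleCat.{u} k) :
    freeGam k (fun j : Σ c : Gam, P.obj c => j.1) ⟶ P where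
  app y := ModuleCat.ofHom (freeGam.desc k _ y fun j φ => (P.map φ).hom j.2)
  naturality {y z} f := by
    refine ModuleCat.hom_ext (freeGam.hom_ext fun j φ => ?_)
    refine (congrArg (freeGam.desc k (fun j : Σ c : Gam, P.obj c => j.1) z fun j φ =>
      (P.map φ).hom j.2) (freeGam.map_basis k (fun j : Σ c : Gam, P.obj c => j.1) j φ f)).trans ?_
    refine (freeGam.desc_basis k (fun j : Σ c : Gam, P.obj c => j.1) z
      (fun j φ => (P.map φ).hom j.2) j (φ ≫ f)).trans ?_
    refine Eq.trans ?_ (congrArg (P.map f).hom (freeGam.desc_basis k (fun j : Σ c : Gam, P.obj c => j.1) y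
      (fun j φ => (P.map φ).hom j.2) j φ)).symm
    exact (Gam.map_comp_apply P φ f j.2).symm

instance (P : Gam ⥤ ModuleCat.{u} k) : Epi (freeGam.toModule k P) := by
  rw [NatTrans.epi_iff_epi_app]
  -- The element v is the image of the identity in the summand indexed by (y, v).
  refine fun y => (ModuleCat.epi_iff_surjective _).2 fun v =>
    ⟨freeGam.basis k _ (⟨y, v⟩ : Σ c : Gam, P.obj c) (𝟙 y), ?_⟩
  refine (freeGam.desc_basis k (fun j : Σ c : Gam, P.obj c => j.1) y (fun j φ => (P.map φ).hom j.2) ⟨y, v⟩ (𝟙 y)).trans ?_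
  rw [P.map_id]
  rfl

/-- A projective Γ-module is a retract of the free module on all its elements, so the identity of
its homology factors through zero. -/
theorem isZero_homology_rwFunctor (P : Gam ⥤ ModuleCat.{u} k) [Projective P] (n : ℕ) :
    IsZero (((rwFunctor k).obj P).homology (n + 1)) := by
  let H := rwFunctor k ⋙ HomologicalComplex.homologyFunctor _ _ (n + 1)
  have hs : Projective.factorThru (𝟙 P) (freeGam.toModule k P) ≫ freeGam.toModule k P = 𝟙 P :=
    Projective.factorThru_comp _ _
  have h0 : IsZero (H.obj (freeGam k (fun j : Σ c : Gam, P.obj c => j.1))) :=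
    isZero_homology_freeGam k _ n
  have h1 := congrArg H.map hs
  rw [H.map_comp, h0.eq_zero_of_tgt (H.map (Projective.factorThru _ _)), zero_comp, H.map_id] at h1
  exact (IsZero.iff_id_eq_zero _).2 h1.symm

end RWFunctor

end GammaHomology

end

noncomputable section

namespace GammaHomology

/-! ### Degree zero homology is the tensor product with t. -/

section DegreeZero

open scoped Simplicial

variable {k : Type u} [CommRing k] (F : Gam ⥤ ModuleCat.{u} k)

/-- The counterpart of `RWMod.of_congr` for maps of Γ that need not be surjective. -/
theorem RWMod.of_congr_of_incl {n : ℕ} {s t : OneStr n} (h : s = t) {p : Gam}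
    (φ : p ⟶ ⟨s.dom⟩) (ψ : p ⟶ ⟨t.dom⟩) (H : ∀ i, (φ.1 i : ℕ) = ψ.1 i) (v : F.obj p) :
    RWMod.of (GamSurj.incl ⋙ F) s ((F.map φ).hom v) =
      RWMod.of (GamSurj.incl ⋙ F) t ((F.map ψ).hom v) := by
  subst h
  have : φ = ψ := Subtype.ext (funext fun i => Fin.ext (H i))
  rw [this]

/-- Consequently degree zero of the complex is one copy of F[1]. -/
theorem OneStr.eq_path (s : OneStr 0) : s = OneStr.path 0 := by
  have h : ∀ i : Fin 1, (s.str.obj i).card = 1 := fun i => by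
    obtain rfl : i = Fin.last 0 := Subsingleton.elim _ _
    exact s.card_last
  refine OneStr.ext (Str.ext h fun i j hij a b hab => ?_)
  have h1 := (s.str.tr hij a).isLt.trans_eq (h j)
  have h2 : ((OneStr.path 0).str.tr hij b : ℕ) < 1 := ((OneStr.path 0).str.tr hij b).isLt
  omega

theorem Gam.hom_ext_val {p : Gam} {x y : ℕ} (h : x = y) (φ : p ⟶ ⟨x⟩) (ψ : p ⟶ ⟨y⟩)
    (H : ∀ (i : Fin p.size) (a : Fin x) (b : Fin y), (a : ℕ) = b →
      (φ.1 i.succ = a.succ ↔ ψ.1 i.succ = b.succ)) (i) : (φ.1 i : ℕ) = ψ.1 i := by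
  subst h
  rw [Gam.hom_ext_succ φ ψ fun i a => H i a a rfl]

/-- The sum of the components of a discrete forest. -/
theorem RWMod.forest_zero (t : Str 0) (v : F.obj ⟨(t.obj 0).card⟩) :
    RWMod.forest (GamSurj.incl ⋙ F) t v = ∑ c : Fin (t.obj 0).card,
      RWMod.of (GamSurj.incl ⋙ F) (OneStr.path 0)
        ((F.map (Gam.proj (p := ⟨(t.obj 0).card⟩) c)).hom v) := by
  refine (RWMod.forest_apply (GamSurj.incl ⋙ F) t v).trans (Finset.sum_congr rfl fun c _ => ?_)
  refine RWMod.of_congr_of_incl F (s := t.tree c) (t := OneStr.path 0) (OneStr.eq_path _)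
    (p := ⟨(t.obj 0).card⟩) (GamSurj.incl.map (t.collapse c)) (Gam.proj (p := ⟨(t.obj 0).card⟩) c)
    ?_ v
  refine Gam.hom_ext_val (t.component_last c) _ _ fun i a b _ => ?_
  refine (t.collapse_eq_succ c i a).trans (Iff.trans ?_ (Gam.proj_eq_succ c i b).symm)
  rw [show t.cemb c 0 a = c from (t.tr_self _ _).symm.trans (t.tr_cemb c 0 a)]

/-- The based function with value `1` outside of the basepoint. -/
def basedOne (k : Type u) [CommRing k] (p : Gam) : basedFun k p :=
  ⟨Fin.cases 0 fun _ => 1, show _ = _ from rfl⟩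

/-- The class of `φ ⊗ v` in `t ⊗ F`. -/
def tensorMk (p : Gam) (φ : basedFun k p) (v : F.obj p) : (tensorFunctor (basedCochains k)).obj F :=
  (tensorRel (basedCochains k) F).mkQ (DirectSum.lof k Gam
    (fun p => ((basedCochains k).obj (op p) ⊗[k] F.obj p : Type u)) p (φ ⊗ₜ[k] v))

theorem tensorMk_map {p q : Gam} (f : p ⟶ q) (φ : basedFun k q) (v : F.obj p) :
    tensorMk F p (((basedCochains k).map f.op).hom φ) v = tensorMk F q φ ((F.map f).hom v) := by
  refine (Submodule.Quotient.eq _).2 (Submodule.subset_span ⟨p, q, f, φ, v, rfl⟩)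

/-- `tensorMk` as a bilinear map. -/
def tensorMkHom (p : Gam) : basedFun k p →ₗ[k] F.obj p →ₗ[k] (tensorFunctor (basedCochains k)).obj F :=
  (TensorProduct.mk k (basedFun k p) (F.obj p)).compr₂
    ((tensorRel (basedCochains k) F).mkQ ∘ₗ DirectSum.lof k Gam
      (fun p => ((basedCochains k).obj (op p) ⊗[k] F.obj p : Type u)) p)

theorem tensor_hom_ext {N : Type u} [AddCommGroup N] [Module k N]
    {f g : (tensorFunctor (basedCochains k)).obj F →ₗ[k] N}
    (h : ∀ p φ v, f (tensorMk F p φ v) = g (tensorMk F p φ v)) : f = g := by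
  refine Submodule.linearMap_qext _ (DirectSum.linearMap_ext k fun p => ?_)
  exact TensorProduct.ext' fun φ v => h p φ v

/-- The pullback of the function 1 along `Gam.proj i` is the indicator function of i, and these form
a basis of the based functions. -/
theorem basedFun_eq_sum (p : Gam) (φ : basedFun k p) :
    φ = ∑ i : Fin p.size, φ.1 i.succ • ((basedCochains k).map (Gam.proj i).op).hom (basedOne k ⟨1⟩) := by
  let g : Fin p.size → basedFun k p := fun i =>
    φ.1 i.succ • ((basedCochains k).map (Gam.proj i).op).hom (basedOne k ⟨1⟩)
  have key : ∀ i x, (g i).1 x = φ.1 (Fin.succ i) * (basedOne k ⟨1⟩).1 ((Gam.proj i).1 x) :=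
    fun _ _ => rfl
  have hs : ∀ x, (∑ i, g i : basedFun k p).1 x = ∑ i, (g i).1 x := fun x => by
    rw [Submodule.coe_sum, Finset.sum_apply]
  refine Subtype.ext (funext fun x => ?_)
  refine Eq.trans ?_ (hs x).symm
  refine Eq.trans ?_ (Finset.sum_congr rfl fun i _ => key i x).symm
  refine Fin.cases ?_ (fun j => ?_) x
  · refine Eq.trans φ.2 (Finset.sum_eq_zero fun i _ => ?_).symm
    exact mul_zero _
  · rw [Finset.sum_eq_single j]
    · rw [(Gam.proj_eq_succ j j 0).2 rfl]
      exact (mul_one _).symm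
    · intro i _ hij
      have : (Gam.proj i).1 j.succ = 0 := if_neg hij.symm
      rw [this]
      exact mul_zero _
    · simp

/-- The map from degree zero to the tensor product of functors. -/
def toTensor : RWMod (GamSurj.incl ⋙ F) 0 →ₗ[k] (tensorFunctor (basedCochains k)).obj F :=
  DirectSum.toModule k (OneStr 0) _ fun s => tensorMkHom F ⟨s.dom⟩ (basedOne k ⟨s.dom⟩)

theorem toTensor_of (s : OneStr 0) (v : F.obj ⟨s.dom⟩) :
    toTensor F (RWMod.of (GamSurj.incl ⋙ F) s v) = tensorMk F ⟨s.dom⟩ (basedOne k ⟨s.dom⟩) v :=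
  DirectSum.toModule_lof (R := k) (M := fun s : OneStr 0 => (GamSurj.incl ⋙ F).obj ⟨s.dom⟩)
    (φ := fun s : OneStr 0 => tensorMkHom F ⟨s.dom⟩ (basedOne k ⟨s.dom⟩)) s v

/-- Moving the projections across the tensor sign shows that t ⊗ F is generated by the classes over
[1]. -/
theorem tensorMk_eq_sum (p : Gam) (φ : basedFun k p) (v : F.obj p) :
    tensorMk F p φ v = ∑ i : Fin p.size, φ.1 i.succ •
      tensorMk F ⟨1⟩ (basedOne k ⟨1⟩) ((F.map (Gam.proj i)).hom v) := by
  refine (congrArg ((tensorMkHom F p).flip v) (basedFun_eq_sum p φ)).trans ?_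
  refine (_root_.map_sum ((tensorMkHom F p).flip v) _ _).trans (Finset.sum_congr rfl fun i _ => ?_)
  refine (map_smul ((tensorMkHom F p).flip v) _ _).trans ?_
  exact congrArg (φ.1 i.succ • ·) (tensorMk_map F (Gam.proj i) _ v)

theorem toTensor_forest (t : Str 0) (v : F.obj ⟨(t.obj 0).card⟩) :
    toTensor F (RWMod.forest (GamSurj.incl ⋙ F) t v) =
      tensorMk F ⟨(t.obj 0).card⟩ (basedOne k _) v := by
  rw [RWMod.forest_zero, _root_.map_sum]
  refine Eq.trans ?_ (tensorMk_eq_sum F ⟨(t.obj 0).card⟩ (basedOne k _) v).symm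
  refine Finset.sum_congr rfl fun c _ => ?_
  refine (toTensor_of F (OneStr.path 0) _).trans ?_
  exact (one_smul k _).symm

/-- The constant function 1 pulls back to the constant function 1 along a map that sends only the
basepoint to the basepoint. The value is thus the same for all θ, in particular for both faces of
degree one. -/
theorem toTensor_map {n : ℕ} (θ : Fin 1 →o Fin (n + 1)) (s : OneStr n) (v : F.obj ⟨s.dom⟩) :
    toTensor F (RWMod.map (GamSurj.incl ⋙ F) θ (RWMod.of (GamSurj.incl ⋙ F) s v)) =
      tensorMk F ⟨s.dom⟩ (basedOne k ⟨s.dom⟩) v := by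
  refine (congrArg (toTensor F) (RWMod.map_of_eq_forest (GamSurj.incl ⋙ F) θ s v)).trans ?_
  refine (toTensor_forest F (s.str.pull θ) _).trans ?_
  refine (tensorMk_map F (GamSurj.incl.map (s.str.pullHom θ)) (basedOne k _) v).symm.trans ?_
  refine congrArg (fun φ => tensorMk F ⟨s.dom⟩ φ v) (Subtype.ext (funext ?_))
  exact Fin.cases rfl fun i => rfl

theorem rwComplex_d_one_zero : ((rwComplex (GamSurj.incl ⋙ F)).d 1 0).hom =
    RWMod.map (GamSurj.incl ⋙ F) (SimplexCategory.δ (0 : Fin 2)).toOrderHom -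
      RWMod.map (GamSurj.incl ⋙ F) (SimplexCategory.δ (1 : Fin 2)).toOrderHom := by
  refine (congrArg ModuleCat.Hom.hom (AlgebraicTopology.AlternatingFaceMapComplex.obj_d_eq
    (rwSimplicial (GamSurj.incl ⋙ F)) 0)).trans ?_
  rw [Fin.sum_univ_two]
  simp only [Fin.val_zero, pow_zero, one_smul, Fin.val_one, pow_one, neg_smul, ← sub_eq_add_neg]
  rfl

/-- The map that sends all elements other than the basepoint to the non-basepoint. -/
def Gam.fold (p : Gam) : p ⟶ ⟨1⟩ := ⟨Fin.cases 0 fun _ => 1, rfl⟩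

/-- The zero map. -/
def Gam.zero (p q : Gam) : p ⟶ q := ⟨fun _ => 0, rfl⟩

/-! ### The relations that the faces of degree one impose. -/

section Relations

variable {F} {N : Type u} [AddCommGroup N] [Module k N]
  (q : RWMod (GamSurj.incl ⋙ F) 0 →ₗ[k] N)

/-- The restriction of a linear map to the summand of the trivial string. -/
def onPath : F.obj ⟨1⟩ →ₗ[k] N := q ∘ₗ RWMod.of (GamSurj.incl ⋙ F) (OneStr.path 0)

/-- A linear map out of degree zero that agrees on the two faces of all elements of degree one. -/
def EqualizesFaces : Prop := ∀ (s : OneStr 1) (w : F.obj ⟨s.dom⟩),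
  q (RWMod.map (GamSurj.incl ⋙ F) (SimplexCategory.δ (0 : Fin 2)).toOrderHom
    (RWMod.of (GamSurj.incl ⋙ F) s w)) =
  q (RWMod.map (GamSurj.incl ⋙ F) (SimplexCategory.δ (1 : Fin 2)).toOrderHom
    (RWMod.of (GamSurj.incl ⋙ F) s w))

/-- For a single map onto {1}, the face ∂_0 folds all elements into one, and ∂_1 is the sum of the
restrictions to the individual elements. -/
theorem onPath_fold (hq : EqualizesFaces q) (s : OneStr 1) (w : F.obj ⟨s.dom⟩) :
    onPath q ((F.map (Gam.fold ⟨s.dom⟩)).hom w) =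
      ∑ i : Fin s.dom, onPath q ((F.map (Gam.proj (p := ⟨s.dom⟩) i)).hom w) := by
  have h := ((congrArg q (RWMod.map_of_eq_forest (GamSurj.incl ⋙ F) _ s w)).symm.trans
    (hq s w)).trans (congrArg q (RWMod.map_of_eq_forest (GamSurj.incl ⋙ F) _ s w))
  have h0 : ∀ θ : Fin 1 →o Fin 2, q (RWMod.forest (GamSurj.incl ⋙ F) (s.str.pull θ)
      (((GamSurj.incl ⋙ F).map (s.str.pullHom θ)).hom w)) =
      ∑ c : Fin ((s.str.pull θ).obj 0).card,
        onPath q ((F.map (GamSurj.incl.map (s.str.pullHom θ) ≫ Gam.proj c)).hom w) := by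
    intro θ
    refine (congrArg q (RWMod.forest_zero F (s.str.pull θ) _)).trans ?_
    refine (_root_.map_sum q _ _).trans (Finset.sum_congr rfl fun c _ => ?_)
    exact congrArg (onPath q) (Gam.map_comp_apply F (GamSurj.incl.map (s.str.pullHom θ))
      (Gam.proj (p := ⟨((s.str.pull θ).obj 0).card⟩) c) w)
  rw [h0, h0] at h
  refine Eq.trans ?_ (h.trans ?_)
  · have hu : Unique (Fin ((s.str.pull (SimplexCategory.δ (0 : Fin 2)).toOrderHom).obj 0).card) := by
      rw [show ((s.str.pull (SimplexCategory.δ (0 : Fin 2)).toOrderHom).obj 0).card = 1 from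
        s.card_last]
      infer_instance
    rw [Fintype.sum_unique]
    refine congrArg (fun f => onPath q ((F.map f).hom w)) (Gam.hom_ext_succ _ _ fun i a => ?_)
    refine Iff.trans ?_ (Gam.comp_eq_succ _ _ i a).symm
    obtain rfl : a = 0 := Subsingleton.elim _ _
    exact iff_of_true rfl ⟨_, rfl, (Gam.proj_eq_succ _ _ _).2 (@Subsingleton.elim _ hu.instSubsingleton _ _)⟩
  · refine Finset.sum_congr rfl fun i _ => ?_
    refine congrArg (fun f => onPath q ((F.map f).hom w)) ?_
    refine Gam.hom_ext_succ _ _ fun i' a => ?_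
    refine (Gam.comp_eq_succ _ _ i' a).trans (Iff.trans ?_ (Gam.proj_eq_succ _ i' a).symm)
    constructor
    · rintro ⟨b, hb, hb'⟩
      rw [← (Gam.proj_eq_succ _ _ _).1 hb']
      exact ((s.str.tr_self _ _).symm.trans ((s.str.pullHom_eq_succ _ i' b).1 hb) : _)
    · rintro rfl
      exact ⟨_, (s.str.pullHom_eq_succ _ _ _).2 (s.str.tr_self _ _),
        (Gam.proj_eq_succ _ _ _).2 rfl⟩

/-- The string `{1, …, x + 1} → {1}`. -/
def OneStr.cone (x : ℕ) : OneStr 1 :=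
  ⟨ComposableArrows.mk₁ (X₀ := (⟨x + 1, Nat.le_add_left 1 x⟩ : Omega)) (X₁ := ⟨1, le_rfl⟩)
    ⟨fun _ => (0 : Fin 1), fun _ => ⟨(0 : Fin (x + 1)), Subsingleton.elim (α := Fin 1) _ _⟩⟩, rfl⟩

theorem Gam.hom_ext_succ' {p r : Gam} (φ ψ : p ⟶ r) (h : ∀ i : Fin p.size, φ.1 i.succ = ψ.1 i.succ) :
    φ = ψ :=
  Gam.hom_ext_succ φ ψ fun i a => by rw [h i]

variable {q}

/-- The relation for the string {1, …, x + 1} → {1} with a coefficient pushed forward along ψ, which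
need not be surjective. The shift by one keeps the domain nonempty. -/
theorem onPath_fold_comp (hq : EqualizesFaces q) {p : Gam} (x : ℕ) (ψ : p ⟶ ⟨x + 1⟩) (v : F.obj p) :
    onPath q ((F.map (ψ ≫ Gam.fold ⟨x + 1⟩)).hom v) =
      ∑ i : Fin (x + 1), onPath q ((F.map (ψ ≫ Gam.proj (p := ⟨x + 1⟩) i)).hom v) := by
  refine (congrArg (onPath q) (Gam.map_comp_apply F ψ (Gam.fold ⟨x + 1⟩) v)).symm.trans ?_
  refine (onPath_fold q hq (OneStr.cone x) ((F.map ψ).hom v)).trans ?_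
  exact Finset.sum_congr rfl fun i _ =>
    congrArg (onPath q) (Gam.map_comp_apply F ψ (Gam.proj (p := ⟨x + 1⟩) i) v)

/-- Factor the zero map through [2]: the fold and both projections turn it into the zero map again,
so the value equals twice itself. -/
theorem onPath_zero (hq : EqualizesFaces q) (p : Gam) (v : F.obj p) :
    onPath q ((F.map (Gam.zero p ⟨1⟩)).hom v) = 0 := by
  have h := onPath_fold_comp hq 1 (Gam.zero p ⟨2⟩) v
  rw [Fin.sum_univ_two] at h
  have h' : onPath q ((F.map (Gam.zero p ⟨1⟩)).hom v) = onPath q ((F.map (Gam.zero p ⟨1⟩)).hom v) +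
    onPath q ((F.map (Gam.zero p ⟨1⟩)).hom v) := h
  exact left_eq_add.1 h'

/-- A map to [1] is determined by its support; spreading the support out over distinct elements and
folding them writes it as the sum of the projections in the support. Indices outside it contribute
zero by `onPath_zero`. -/
theorem onPath_hom (hq : EqualizesFaces q) {p : Gam} (χ : p ⟶ ⟨1⟩) (v : F.obj p) :
    onPath q ((F.map χ).hom v) = ∑ i : Fin p.size,
      if χ.1 i.succ ≠ 0 then onPath q ((F.map (Gam.proj i)).hom v) else 0 := by
  -- The target has one element more than p, which ψ never hits. It covers the case of p without
  -- non-basepoints, and its summand is the zero map.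
  let ψ : p ⟶ ⟨p.size + 1⟩ :=
    ⟨Fin.cases 0 fun i => if χ.1 i.succ ≠ 0 then i.castSucc.succ else 0, rfl⟩
  have hψ : ∀ i : Fin p.size, ψ.1 i.succ = if χ.1 i.succ ≠ 0 then i.castSucc.succ else 0 :=
    fun _ => rfl
  have h0 : χ = ψ ≫ Gam.fold ⟨p.size + 1⟩ := Gam.hom_ext_succ' _ _ fun i => by
    rw [show (ψ ≫ Gam.fold ⟨p.size + 1⟩).1 i.succ = (Gam.fold ⟨p.size + 1⟩).1 (ψ.1 i.succ) from rfl,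
      hψ]
    split_ifs with h
    · exact Fin.eq_one_of_ne_zero _ h
    · exact not_not.1 h
  rw [h0]
  refine (onPath_fold_comp hq p.size ψ v).trans ?_
  rw [Fin.sum_univ_castSucc, ← h0]
  have hlast : ψ ≫ Gam.proj (p := ⟨p.size + 1⟩) (Fin.last p.size) = Gam.zero p ⟨1⟩ :=
    Gam.hom_ext_succ' _ _ fun i => by
      rw [show (ψ ≫ Gam.proj (p := ⟨p.size + 1⟩) (Fin.last p.size)).1 i.succ =
        (Gam.proj (p := ⟨p.size + 1⟩) (Fin.last p.size)).1 (ψ.1 i.succ) from rfl, hψ]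
      split_ifs with h
      · exact if_neg (Fin.castSucc_lt_last i).ne
      · rfl
  rw [hlast, onPath_zero hq, add_zero]
  refine Finset.sum_congr rfl fun i _ => ?_
  have hi : ∀ j : Fin p.size, (ψ ≫ Gam.proj (p := ⟨p.size + 1⟩) i.castSucc).1 j.succ =
      if χ.1 j.succ ≠ 0 then (Gam.proj i).1 j.succ else 0 := fun j => by
    rw [show (ψ ≫ Gam.proj (p := ⟨p.size + 1⟩) i.castSucc).1 j.succ =
      (Gam.proj (p := ⟨p.size + 1⟩) i.castSucc).1 (ψ.1 j.succ) from rfl, hψ]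
    split_ifs with h
    · exact if_congr (Fin.castSucc_injective _).eq_iff rfl rfl
    · rfl
  split_ifs with h
  · congr 4
    refine Gam.hom_ext_succ' _ _ fun j => (hi j).trans ?_
    split_ifs with h'
    · rfl
    · refine (if_neg ?_).symm
      rintro rfl
      exact h' h
  · rw [← onPath_zero hq p v]
    congr 4
    refine Gam.hom_ext_succ' _ _ fun j => (hi j).trans ?_
    split_ifs with h'
    · refine if_neg ?_
      rintro rfl
      exact h h'
    · rfl

variable (q) in
/-- The bilinear map `(φ, v) ↦ ∑ φ(i) q(v_i)`. -/
def evalPath (p : Gam) : basedFun k p →ₗ[k] F.obj p →ₗ[k] N :=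
  LinearMap.mk₂ k (fun φ v => ∑ i : Fin p.size, φ.1 i.succ • onPath q ((F.map (Gam.proj i)).hom v))
    (fun φ φ' v => by
      rw [← Finset.sum_add_distrib]
      exact Finset.sum_congr rfl fun i _ => add_smul _ _ _)
    (fun c φ v => by
      rw [Finset.smul_sum]
      exact Finset.sum_congr rfl fun i _ => mul_smul _ _ _)
    (fun φ v v' => by
      simp only [map_add, smul_add, Finset.sum_add_distrib])
    (fun c φ v => by
      simp only [map_smul, Finset.smul_sum]
      exact Finset.sum_congr rfl fun i _ => smul_comm _ _ _)

/-- Both sides are the sum over pairs (i, j) with f(i) = j: the composite of f with the projection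
to j has the fibre of j as its support, so `onPath_hom` applies. -/
theorem evalPath_map (hq : EqualizesFaces q) {p r : Gam} (f : p ⟶ r) (φ : basedFun k r) (v : F.obj p) :
    evalPath q p (((basedCochains k).map f.op).hom φ) v = evalPath q r φ ((F.map f).hom v) := by
  change ∑ i : Fin p.size, φ.1 (f.1 i.succ) • onPath q ((F.map (Gam.proj i)).hom v) =
    ∑ j : Fin r.size, φ.1 j.succ • onPath q ((F.map (Gam.proj j)).hom ((F.map f).hom v))
  have h : ∀ j : Fin r.size, onPath q ((F.map (Gam.proj j)).hom ((F.map f).hom v)) =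
      ∑ i : Fin p.size, if f.1 i.succ = j.succ then onPath q ((F.map (Gam.proj i)).hom v) else 0 := by
    intro j
    refine (congrArg (onPath q) (Gam.map_comp_apply F f (Gam.proj j) v)).trans ?_
    refine (onPath_hom hq (f ≫ Gam.proj j) v).trans (Finset.sum_congr rfl fun i _ => ?_)
    refine if_congr ?_ rfl rfl
    rw [show (f ≫ Gam.proj j).1 i.succ = (Gam.proj j).1 (f.1 i.succ) from rfl]
    cases f.1 i.succ using Fin.cases with
    | zero => exact iff_of_false (fun h => h rfl) (Fin.succ_ne_zero j).symm
    | succ a =>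
      rw [Fin.succ_inj, ← Gam.proj_eq_succ j a 0]
      exact ⟨fun h => Fin.eq_one_of_ne_zero _ h, fun h => h ▸ Fin.succ_ne_zero _⟩
  simp only [h, Finset.smul_sum, smul_ite, smul_zero]
  rw [Finset.sum_comm]
  refine Finset.sum_congr rfl fun i _ => ?_
  cases hi : f.1 i.succ using Fin.cases with
  | zero =>
    rw [show φ.1 0 = 0 from φ.2, zero_smul]
    exact (Finset.sum_eq_zero fun j _ => if_neg (Fin.succ_ne_zero j).symm).symm
  | succ a =>
    simp only [Fin.succ_inj]
    rw [Finset.sum_ite_eq]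
    exact (if_pos (Finset.mem_univ _)).symm

/-- The map out of `t ⊗ F` induced by `q`. -/
def ofTensor (hq : EqualizesFaces q) : (tensorFunctor (basedCochains k)).obj F →ₗ[k] N :=
  (tensorRel (basedCochains k) F).liftQ
    (DirectSum.toModule k Gam N fun p => TensorProduct.lift (evalPath q p)) <|
      Submodule.span_le.2 <| by
        rintro _ ⟨p, r, f, φ, v, rfl⟩
        change _ = _
        rw [map_sub, DirectSum.toModule_lof, DirectSum.toModule_lof, sub_eq_zero]
        exact evalPath_map hq f φ v

/-- A map that equalizes the faces factors through t ⊗ F. On a generator, the factorization gives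
the sum over the components of the discrete forest, which is the generator itself. -/
theorem ofTensor_toTensor (hq : EqualizesFaces q) (z : RWMod (GamSurj.incl ⋙ F) 0) : ofTensor hq (toTensor F z) = q z := by
  suffices h : ofTensor hq ∘ₗ toTensor F = q from LinearMap.congr_fun h z
  refine DirectSum.linearMap_ext k fun s => LinearMap.ext fun v => ?_
  change ofTensor hq (toTensor F (RWMod.of (GamSurj.incl ⋙ F) s v)) =
    q (RWMod.of (GamSurj.incl ⋙ F) s v)
  refine (congrArg (ofTensor hq) (toTensor_of F s v)).trans ?_
  have h1 : ofTensor hq (tensorMk F ⟨s.dom⟩ (basedOne k ⟨s.dom⟩) v) =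
      evalPath q ⟨s.dom⟩ (basedOne k ⟨s.dom⟩) v :=
    DirectSum.toModule_lof (R := k)
      (M := fun p : Gam => ((basedCochains k).obj (op p) ⊗[k] F.obj p : Type u))
      (φ := fun p => TensorProduct.lift (evalPath q p)) ⟨s.dom⟩ _
  refine h1.trans ?_
  have h2 : RWMod.of (GamSurj.incl ⋙ F) s v = _ :=
    (RWMod.forest_of_last (GamSurj.incl ⋙ F) s v).symm.trans (RWMod.forest_zero F s.str v)
  rw [h2]
  refine Eq.trans ?_ (_root_.map_sum q _ _).symm
  exact Finset.sum_congr (s₁ := (Finset.univ : Finset (Fin s.dom))) rfl fun i _ =>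
    one_smul k (onPath q ((F.map (Gam.proj (p := ⟨s.dom⟩) i)).hom v))

end Relations

theorem toTensor_d (z : RWMod (GamSurj.incl ⋙ F) 1) :
    toTensor F (((rwComplex (GamSurj.incl ⋙ F)).d 1 0).hom z) = 0 := by
  suffices h : toTensor F ∘ₗ ((rwComplex (GamSurj.incl ⋙ F)).d 1 0).hom =
      (0 : RWMod (GamSurj.incl ⋙ F) 1 →ₗ[k] (tensorFunctor (basedCochains k)).obj F) from LinearMap.congr_fun h z
  rw [rwComplex_d_one_zero F]
  refine DirectSum.linearMap_ext k fun s => LinearMap.ext fun v => ?_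
  refine (map_sub (toTensor F) _ _).trans (sub_eq_zero.2 ?_)
  exact (toTensor_map F _ s v).trans (toTensor_map F _ s v).symm

/-- By `tensorMk_eq_sum` the classes over [1] suffice, and they come from the trivial string. -/
theorem toTensor_surjective : Function.Surjective (toTensor F) := by
  rw [← LinearMap.range_eq_top, eq_top_iff]
  have h : ∀ p φ v, tensorMk F p φ v ∈ LinearMap.range (toTensor F) := by
    intro p φ v
    rw [tensorMk_eq_sum]
    exact Submodule.sum_mem _ fun i _ => Submodule.smul_mem _ _
      ⟨_, toTensor_of F (OneStr.path 0) ((F.map (Gam.proj i)).hom v)⟩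
  have h' : (LinearMap.range (toTensor F)).mkQ = 0 :=
    tensor_hom_ext F fun p φ v => (Submodule.Quotient.mk_eq_zero _).2 (h p φ v)
  rw [← LinearMap.ker_eq_top.2 h', Submodule.ker_mkQ]

/-- The projection modulo boundaries equalizes the faces and so factors through `toTensor`; whatever
`toTensor` kills is a boundary. -/
theorem exists_d_of_toTensor_eq_zero (z : RWMod (GamSurj.incl ⋙ F) 0) (hz : toTensor F z = 0) :
    ∃ y, ((rwComplex (GamSurj.incl ⋙ F)).d 1 0).hom y = z := by
  let q : RWMod (GamSurj.incl ⋙ F) 0 →ₗ[k]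
      (RWMod (GamSurj.incl ⋙ F) 0 ⧸ LinearMap.range ((rwComplex (GamSurj.incl ⋙ F)).d 1 0).hom) :=
    (LinearMap.range ((rwComplex (GamSurj.incl ⋙ F)).d 1 0).hom).mkQ
  have hq : EqualizesFaces q := fun s w => by
    refine (Submodule.Quotient.eq _).2 ⟨RWMod.of (GamSurj.incl ⋙ F) s w, ?_⟩
    rw [rwComplex_d_one_zero]
    rfl
  have h : q z = 0 := by rw [← ofTensor_toTensor hq, hz, map_zero]
  exact (Submodule.Quotient.mk_eq_zero _).1 h

/-- The augmentation of the complex of `F` by `t ⊗ F`. -/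
def toTensorHom : ((rwFunctor k).obj F).X 0 ⟶ (tensorFunctor (basedCochains k)).obj F :=
  ModuleCat.ofHom (toTensor F)

theorem d_toTensorHom : ((rwFunctor k).obj F).d 1 0 ≫ toTensorHom F = 0 :=
  ModuleCat.hom_ext (LinearMap.ext fun z => toTensor_d F z)

/-- The map `toTensorHom` on the quotient by the boundaries. -/
def opcyclesToTensor :
    ((rwFunctor k).obj F).opcycles 0 ⟶ (tensorFunctor (basedCochains k)).obj F :=
  ((rwFunctor k).obj F).descOpcycles (toTensorHom F) 1 (by simp) (d_toTensorHom F)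

instance : IsIso (opcyclesToTensor F) := by
  rw [opcyclesToTensor, ChainComplex.isIso_descOpcycles_iff]
  refine ⟨(ShortComplex.moduleCat_exact_iff _).2 fun z hz => ?_,
    (ModuleCat.epi_iff_surjective _).2 (toTensor_surjective F)⟩
  exact exists_d_of_toTensor_eq_zero F z hz

theorem toTensorHom_naturality {F G : Gam ⥤ ModuleCat.{u} k} (η : F ⟶ G) :
    ((rwFunctor k).map η).f 0 ≫ toTensorHom G =
      toTensorHom F ≫ (tensorFunctor (basedCochains k)).map η := by
  refine ModuleCat.hom_ext (DirectSum.linearMap_ext k fun s => LinearMap.ext fun v => ?_)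
  change toTensor G (DirectSum.lmap (fun s : OneStr 0 => (η.app ⟨s.dom⟩).hom)
      (RWMod.of (GamSurj.incl ⋙ F) s v)) =
    ((tensorFunctor (basedCochains k)).map η).hom (toTensor F (RWMod.of (GamSurj.incl ⋙ F) s v))
  have h1 : DirectSum.lmap (fun s : OneStr 0 => (η.app ⟨s.dom⟩).hom)
      (RWMod.of (GamSurj.incl ⋙ F) s v) =
        RWMod.of (GamSurj.incl ⋙ G) s ((η.app ⟨s.dom⟩).hom v) :=
    DirectSum.lmap_lof (fun s : OneStr 0 => (η.app ⟨s.dom⟩).hom) s v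
  refine (congrArg (toTensor G) h1).trans ((toTensor_of G s _).trans ?_)
  refine Eq.trans ?_ (congrArg ((tensorFunctor (basedCochains k)).map η).hom
    (toTensor_of F s v)).symm
  exact congrArg (tensorRel (basedCochains k) G).mkQ (tensorMapAux_lof (basedCochains k) η ⟨s.dom⟩
    (basedOne k ⟨s.dom⟩ ⊗ₜ[k] v)).symm

variable (k) in
/-- The homology in degree zero of the complex of `F` is `t ⊗ F`. -/
def homologyZeroIso : rwFunctor k ⋙ HomologicalComplex.homologyFunctor _ _ 0 ≅
    tensorFunctor (basedCochains k) :=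
  NatIso.ofComponents
    (fun F => ChainComplex.isoHomologyι₀ ((rwFunctor k).obj F) ≪≫ asIso (opcyclesToTensor F))
    fun {F G} η => by
      have h : HomologicalComplex.opcyclesMap ((rwFunctor k).map η) 0 ≫ opcyclesToTensor G =
          opcyclesToTensor F ≫ (tensorFunctor (basedCochains k)).map η := by
        rw [← cancel_epi (((rwFunctor k).obj F).pOpcycles 0)]
        simp [toTensorHom_naturality, opcyclesToTensor]
      change HomologicalComplex.homologyMap ((rwFunctor k).map η) 0 ≫
        ((rwFunctor k).obj G).homologyι 0 ≫ opcyclesToTensor G =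
          (((rwFunctor k).obj F).homologyι 0 ≫ opcyclesToTensor F) ≫
            (tensorFunctor (basedCochains k)).map η
      rw [HomologicalComplex.homologyι_naturality_assoc, Category.assoc, h]

end DegreeZero

end GammaHomology

end

/-! ### Comparison with Tor, and the theorem. -/

namespace GammaHomology

/-- The homology of the complex of `F` is `Tor^Γ(t, F)`. -/
theorem nonempty_functorTor_iso (k : Type u) [CommRing k] (F : Gam ⥤ ModuleCat.{u} k) (n : ℕ) :
    Nonempty (functorTor (basedCochains k) n F ≅ (rwComplex (GamSurj.incl ⋙ F)).homology n) :=
  nonempty_leftDerived_iso (rwFunctor k) (tensorFunctor (basedCochains k)) (homologyZeroIso k)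
    (fun S hS => shortExact_rwFunctor k S hS) (fun P _ n => isZero_homology_rwFunctor k P n) F n

end GammaHomology

theorem mainTheorem5
    {k A M : Type u} [CommRing k] [CommRing A] [Algebra k A] (ε : A →ₐ[k] k)
    [AddCommGroup M] [Module k M] [Module A M] [IsScalarTower k A M] [Module.Flat k M] :
    ∃ P : GammaHomology.CGamma k A M ⟶ GammaHomology.CGammaIdeal ε M,
      (∀ n : ℕ, P.f n = GammaHomology.pruning ε M n) ∧
      GammaHomology.CGammaIncl ε M ≫ P = 𝟙 (GammaHomology.CGammaIdeal ε M) ∧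
      Nonempty (GammaHomology.CGamma k A M ≅ GammaHomology.CGammaIdeal ε M ⊞ kernel P) ∧
      ∀ n : ℕ, Nonempty (GammaHomology.HGamma k A M n ≅
        (GammaHomology.CGammaIdeal ε M).homology n ⊞ (kernel P).homology n) := by
  let P := GammaHomology.pruneChain M ε
  have hP : GammaHomology.CGammaIncl ε M ≫ P = 𝟙 (GammaHomology.CGammaIdeal ε M) :=
    GammaHomology.CGammaIncl_pruneChain M ε
  let S : ShortComplex (ChainComplex (ModuleCat.{u} k) ℕ) := ShortComplex.mk (kernel.ι P) P (by simp)
  have hS : S.Exact := ShortComplex.exact_kernel P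
  -- The kernel sequence of P has the inclusion as a section, so it splits as a sequence of chain
  -- complexes.
  let σ : S.Splitting := ShortComplex.Splitting.ofExactOfSection S hS (GammaHomology.CGammaIncl ε M)
    hP (inferInstanceAs (Mono (kernel.ι P)))
  let e : GammaHomology.CGamma k A M ≅ GammaHomology.CGammaIdeal ε M ⊞ kernel P :=
    σ.isoBinaryBiproduct ≪≫ biprod.braiding _ _
  refine ⟨P, fun n => rfl, hP, ⟨e⟩, fun n => ?_⟩
  obtain ⟨f⟩ := GammaHomology.nonempty_functorTor_iso k (GammaHomology.loday k A M) n
  let H := HomologicalComplex.homologyFunctor (ModuleCat.{u} k) (ComplexShape.down ℕ) n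
  -- Homology is additive, hence carries the splitting of complexes to one of modules.
  have := preservesBinaryBiproducts_of_preservesBiproducts H
  exact ⟨f ≪≫ H.mapIso e ≪≫ H.mapBiprod _ _⟩
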